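/- Let $d\ge 3$ and $w\in\mathbb R$. All manifolds $M$ are smooth, Hausdorff, second countable, connected, oriented and $d$-dimensional; all metrics $g$ are smooth and Riemannian, and $\omega$ denotes the volume form of $g$ and the orientation. A hypersurface $\Sigma\subset M$ is the zero locus of a smooth defining function $s$ (so $ds\neq0$ along $\Sigma$). Sections of the density bundle $\mathcal E[a]$ of a conformal manifold $(M,\boldsymbol c)$ are identified with families $(f_g)_{g\in\boldsymbol c}$ of smooth functions such that $f_{\Omega^2g}=\Omega^a f_g$ for all smooth $\Omega>0$. *Coupled conformal invariants.* Let $P$ assign to each $(M,g)$ and each smooth function $s$ on $M$ a function $P(s;g)$ on $M$ such that: (1) $P(\phi^*s;\phi^*g)=\phi^*P(s;g)$ for all diffeomorphisms $\phi$ of $M$ (the orientation being pulled back too); (2) there is one universal polynomial which, in every local coordinate system, gives $P(s;g)$ in terms of finitely many of the $\partial_{a_1}\cdots\partial_{a_k}g_{bc}$, $(\det g)^{-1}$, $\partial_{b_1}\cdots\partial_{b_l}s$ and $\omega_{a_1\dots a_d}$; (3) $P(\Omega s;\Omega^2g)=\Omega^wP(s;g)$ for all smooth $\Omega>0$. Thus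 $P$ is a weight-$w$ coupled conformal invariant of densities of weight $1$: for $\sigma=(\sigma_g)\in\Gamma(\mathcal E[1])$ the functions $P(\sigma_g;g)$ form a section $P(\sigma,\boldsymbol g)$ of $\mathcal E[w]$. *Hypersurface invariants.* A Riemannian hypersurface pre-invariant $Q$ assigns to each $(M,g)$ and defining function $s$ of a hypersurface a function $Q(s;g)$ on $M$ such that: (i) it is natural under diffeomorphisms as in (1); (ii) $Q(s;g)|_\Sigma=Q(s';g)|_\Sigma=:Q(\Sigma;g)$ whenever $s,s'$ define the same $\Sigma$ and induce the same orientation on it; (iii) where $ds\ne0$, it is given in every local coordinate system by one universal polynomial in the quantities listed in (2) and $\|ds\|_g^{-1}$. It is a weight-$w$ conformal covariant of hypersurfaces if moreover $Q(\Sigma;\Omega^2g)=\Omega^wQ(\Sigma;g)$ along $\Sigma$ for all smooth $\Omega>0$. *Conformal unit defining densities.* $\bar\sigma\in\Gamma(\mathcal E[1])$ is a conformal unit defining density for $\Sigma$ if, in every scale $g\in\boldsymbol c$, $s=\bar\sigma_g$ is a defining function for $\Sigma$ and $$|ds|_g^2-\frac2d\,s\Big(\Delta_g+\frac{\operatorname{Sc}_g}{2(d-1)}\Big)s=1+s^dA_g$$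 for some smooth function $A_g$ on $M$. **Theorem.** Let $P$ be a weight-$w$ coupled conformal invariant of densities of weight $1$ which along hypersurfaces depends on at most the $d$-jet of the density: if $s,s'$ are smooth functions on $(M,g)$ with the same $d$-jet at $x$, and $s(x)=0$, $ds_x\neq0$, then $P(s;g)(x)=P(s';g)(x)$. Then, for conformal unit defining densities $\bar\sigma$, the restriction of $P(\bar\sigma,\boldsymbol g)$ to $\Sigma$ is a conformal hypersurface invariant of weight $w$. That is, there is a weight-$w$ conformal covariant $Q$ of hypersurfaces such that, for every conformal manifold $(M,\boldsymbol c)$, every hypersurface $\Sigma\subset M$, every conformal unit defining density $\bar\sigma$ for $\Sigma$ and every $g\in\boldsymbol c$, $$P(\bar\sigma_g;g)|_\Sigma=Q(s;g)|_\Sigma$$ for every defining function $s$ of $\Sigma$ that induces the same orientation on $\Sigma$ as $\bar\sigma_g$. -/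

import Mathlib

open scoped Manifold ContDiff

universe u

namespace ConformalHypersurface

noncomputable section

/-- The model space `ℝᵈ`. -/
abbrev Coord (d : ℕ) : Type := EuclideanSpace ℝ (Fin d)

/-! ### Local coordinates -/

section Coordinates

variable {d : ℕ}

/-- The `a`-th standard basis vector of `ℝᵈ`. -/
def stdVec (a : Fin d) : Coord d := EuclideanSpace.single a (1 : ℝ)

/-- The partial derivative `∂_a f`. -/
def pd (a : Fin d) (f : Coord d → ℝ) (y : Coord d) : ℝ := fderiv ℝ f y (stdVec a)

/-- The iterated partial derivative `∂_{a₁} ∂_{a₂} ⋯ ∂_{aₖ} f` for the list `[a₁, …, aₖ]`. -/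
def iterPd : List (Fin d) → (Coord d → ℝ) → Coord d → ℝ
  | [], f => f
  | a :: α, f => pd a (iterPd α f)

variable {M : Type u} [TopologicalSpace M] [ChartedSpace (Coord d) M]

/-- The coordinate vector `∂_a` of the chart `φ` at the point with coordinates `y`. -/
def coordVec (φ : OpenPartialHomeomorph M (Coord d)) (y : Coord d) (a : Fin d) :
    TangentSpace (𝓡 d) (φ.symm y) :=
  mfderiv 𝓘(ℝ, Coord d) (𝓡 d) φ.symm y (stdVec a)

/-- The atlas of all smooth local coordinate systems of `M`. -/
abbrev smoothAtlas (d : ℕ) (M : Type u) [TopologicalSpace M] [ChartedSpace (Coord d) M] :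
    Set (OpenPartialHomeomorph M (Coord d)) :=
  IsManifold.maximalAtlas (𝓡 d) ∞ M

/-- A smooth real-valued function on `M`. -/
abbrev SmoothFn (d : ℕ) {M : Type u} [TopologicalSpace M] [ChartedSpace (Coord d) M]
    (f : M → ℝ) : Prop :=
  ContMDiff (𝓡 d) 𝓘(ℝ, ℝ) ∞ f

/-- The exterior derivative `df` at `x`, as a linear form on the tangent space. -/
def differential (d : ℕ) {M : Type u} [TopologicalSpace M] [ChartedSpace (Coord d) M]
    (f : M → ℝ) (x : M) : TangentSpace (𝓡 d) x →L[ℝ] ℝ :=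
  mfderiv (𝓡 d) 𝓘(ℝ, ℝ) f x

/-- `f` and `f'` have the same `k`-jet at `x`: in local coordinates all partial derivatives of order
at most `k` agree at `x`. -/
def SameJet (d k : ℕ) {M : Type u} [TopologicalSpace M] [ChartedSpace (Coord d) M]
    (f f' : M → ℝ) (x : M) : Prop :=
  ∀ φ ∈ smoothAtlas d M, x ∈ φ.source → ∀ α : List (Fin d), α.length ≤ k →
    iterPd α (f ∘ φ.symm) (φ x) = iterPd α (f' ∘ φ.symm) (φ x)

end Coordinates

/-! ### Oriented Riemannian manifolds -/

/-- An oriented Riemannian structure on `M`: a smooth Riemannian metric together with the smooth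
volume form `ω` that the metric and the orientation determine. A `d`-form `ω` is one of the two
volume forms of the metric exactly if `ω(v₁,…,v_d)² = det g(v_i, v_j)` for all tangent vectors, and
the choice of such a (continuous) `ω` is the choice of an orientation. -/
structure OrientedMetric (d : ℕ) (M : Type u) [TopologicalSpace M] [ChartedSpace (Coord d) M]
    [IsManifold (𝓡 d) ∞ M] where
  /-- The Riemannian metric `g`. -/
  metric : Bundle.ContMDiffRiemannianMetric (𝓡 d) ∞ (Coord d)
    (fun x : M => TangentSpace (𝓡 d) x)
  /-- The volume form `ω`. -/
  vol : ∀ x : M, (TangentSpace (𝓡 d) x) [⋀^Fin d]→ₗ[ℝ] ℝ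
  vol_sq : ∀ (x : M) (v : Fin d → TangentSpace (𝓡 d) x),
    (vol x v) ^ 2 = (Matrix.of fun i j => metric.inner x (v i) (v j)).det
  vol_smooth : ∀ φ ∈ smoothAtlas d M,
    ContDiffOn ℝ ∞ (fun y => vol (φ.symm y) (coordVec φ y)) φ.target

section Riemannian

variable {d : ℕ} {M : Type u} [TopologicalSpace M] [ChartedSpace (Coord d) M]
  [IsManifold (𝓡 d) ∞ M]

/-- `G = F^* G'`, for a diffeomorphism `F` of `M`. -/
def IsPullback (F : M ≃ₘ^∞⟮𝓡 d, 𝓡 d⟯ M) (G G' : OrientedMetric d M) : Prop :=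
  (∀ (x : M) (v w : TangentSpace (𝓡 d) x),
    G.metric.inner x v w =
      G'.metric.inner (F x) (mfderiv (𝓡 d) (𝓡 d) F x v) (mfderiv (𝓡 d) (𝓡 d) F x w)) ∧
  ∀ (x : M) (v : Fin d → TangentSpace (𝓡 d) x),
    G.vol x v = G'.vol (F x) (fun i => mfderiv (𝓡 d) (𝓡 d) F x (v i))

/-- `G' = Ω² G` for a smooth positive function `Ω`, with the same orientation (so that the volume
form is multiplied by `Ωᵈ`). -/
def IsRescaling (Ω : M → ℝ) (G G' : OrientedMetric d M) : Prop :=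
  SmoothFn d Ω ∧ (∀ x, 0 < Ω x) ∧
  (∀ (x : M) (v w : TangentSpace (𝓡 d) x),
    G'.metric.inner x v w = Ω x ^ 2 * G.metric.inner x v w) ∧
  ∀ (x : M) (v : Fin d → TangentSpace (𝓡 d) x), G'.vol x v = Ω x ^ d * G.vol x v

/-- The matrix `(g_{ab})` of the metric in the chart `φ` at the point with coordinates `y`. -/
def gram (φ : OpenPartialHomeomorph M (Coord d)) (G : OrientedMetric d M) (y : Coord d) :
    Matrix (Fin d) (Fin d) ℝ :=
  Matrix.of fun a b => G.metric.inner (φ.symm y) (coordVec φ y a) (coordVec φ y b)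

/-- The inverse metric `g^{ab}` in the chart `φ`. -/
def gramInv (φ : OpenPartialHomeomorph M (Coord d)) (G : OrientedMetric d M) (y : Coord d) :
    Matrix (Fin d) (Fin d) ℝ :=
  (gram φ G y)⁻¹

/-- Christoffel symbols `Γ^c_{ab} = ½ g^{ce} (∂_a g_{be} + ∂_b g_{ae} - ∂_e g_{ab})` of the
Levi-Civita connection. -/
def christoffel (φ : OpenPartialHomeomorph M (Coord d)) (G : OrientedMetric d M)
    (c a b : Fin d) (y : Coord d) : ℝ :=
  (1 / 2) * ∑ e, gramInv φ G y c e *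
    (pd a (fun z => gram φ G z b e) y + pd b (fun z => gram φ G z a e) y
      - pd e (fun z => gram φ G z a b) y)

/-- The Riemann tensor `R_{ab}{}^c{}_f`, i.e. the components of
`R(u,v)w = ∇_u ∇_v w - ∇_v ∇_u w - ∇_{[u,v]} w = u^a v^b w^f R_{ab}{}^c{}_f`. -/
def riemann (φ : OpenPartialHomeomorph M (Coord d)) (G : OrientedMetric d M)
    (a b c f : Fin d) (y : Coord d) : ℝ :=
  pd a (christoffel φ G c b f) y - pd b (christoffel φ G c a f) y
    + ∑ e, (christoffel φ G c a e y * christoffel φ G e b f y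
      - christoffel φ G c b e y * christoffel φ G e a f y)

/-- The Ricci tensor `Ric_{ab} = R_{ca}{}^c{}_b`. -/
def ricci (φ : OpenPartialHomeomorph M (Coord d)) (G : OrientedMetric d M)
    (a b : Fin d) (y : Coord d) : ℝ :=
  ∑ c, riemann φ G c a c b y

/-- The scalar curvature `Sc = g^{ab} Ric_{ab}`. -/
def scalarCurv (φ : OpenPartialHomeomorph M (Coord d)) (G : OrientedMetric d M)
    (y : Coord d) : ℝ :=
  ∑ a, ∑ b, gramInv φ G y a b * ricci φ G a b y

/-- `J = Sc / (2 (d - 1))`, the trace of the Schouten tensor. -/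
def schoutenTrace (φ : OpenPartialHomeomorph M (Coord d)) (G : OrientedMetric d M)
    (y : Coord d) : ℝ :=
  scalarCurv φ G y / (2 * ((d : ℝ) - 1))

/-- The Laplacian `Δ s = g^{ab} ∇_a ∇_b s`. -/
def laplacian (φ : OpenPartialHomeomorph M (Coord d)) (G : OrientedMetric d M)
    (s : M → ℝ) (y : Coord d) : ℝ :=
  ∑ a, ∑ b, gramInv φ G y a b *
    (iterPd [a, b] (s ∘ φ.symm) y - ∑ c, christoffel φ G c a b y * pd c (s ∘ φ.symm) y)

/-- The squared length `|ds|² = g^{ab} ∂_a s ∂_b s`. -/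
def gradSq (φ : OpenPartialHomeomorph M (Coord d)) (G : OrientedMetric d M)
    (s : M → ℝ) (y : Coord d) : ℝ :=
  ∑ a, ∑ b, gramInv φ G y a b * pd a (s ∘ φ.symm) y * pd b (s ∘ φ.symm) y

/-- The component `ρ = -(1/d) (Δ + J) σ` of the scale tractor `I_σ = (σ, ∇_a σ, ρ)`, where `s` is
the expression of `σ` in the scale `G`. -/
def rho (φ : OpenPartialHomeomorph M (Coord d)) (G : OrientedMetric d M)
    (s : M → ℝ) (y : Coord d) : ℝ :=
  -(1 / (d : ℝ)) * (laplacian φ G s y + schoutenTrace φ G y * s (φ.symm y))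

/-- The squared length `I_σ² = h(I_σ, I_σ) = |∇σ|² + 2 σ ρ` of the scale tractor
`I_σ = (σ, ∇_a σ, ρ)` in the tractor metric, i.e.
`S(σ) = |∇σ|² - (2/d) σ (Δ + Sc / (2 (d - 1))) σ`. -/
def tractorSq (φ : OpenPartialHomeomorph M (Coord d)) (G : OrientedMetric d M)
    (s : M → ℝ) (y : Coord d) : ℝ :=
  gradSq φ G s y + 2 * s (φ.symm y) * rho φ G s y

end Riemannian

/-! ### Hypersurfaces and defining functions -/

section Defining

variable {d : ℕ} {M : Type u} [TopologicalSpace M] [ChartedSpace (Coord d) M]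

/-- `s` is a defining function of the hypersurface `S`: it is smooth, `S` is its zero locus, and
`ds` vanishes nowhere along `S`. -/
def IsDefiningFunction (d : ℕ) {M : Type u} [TopologicalSpace M] [ChartedSpace (Coord d) M]
    (s : M → ℝ) (S : Set M) : Prop :=
  SmoothFn d s ∧ S = {x | s x = 0} ∧ ∀ x ∈ S, differential d s x ≠ 0

/-- Two defining functions of `S` induce the same orientation on `S`: as `M` is oriented, this means
that the conormals `ds` and `ds'` are positive multiples of each other along `S`. -/
def CompatiblyOriented (d : ℕ) {M : Type u} [TopologicalSpace M] [ChartedSpace (Coord d) M]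
    (s s' : M → ℝ) (S : Set M) : Prop :=
  ∀ x ∈ S, ∃ r : ℝ, 0 < r ∧ differential d s' x = r • differential d s x

/-- `s` is the expression, in the scale `G`, of a conformal unit defining density of `S`:
it defines `S` and `I² = 1 + O(s^d)`, i.e. `I² = 1 + s^d A` for a smooth `A`. -/
def IsConformalUnit [IsManifold (𝓡 d) ∞ M] (G : OrientedMetric d M) (s : M → ℝ) (S : Set M) :
    Prop :=
  IsDefiningFunction d s S ∧ ∃ A : M → ℝ, SmoothFn d A ∧
    ∀ φ ∈ smoothAtlas d M, ∀ x ∈ φ.source, tractorSq φ G s (φ x) = 1 + s x ^ d * A x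

end Defining

/-! ### Conformal structures and densities -/

/-- A conformal structure on the oriented manifold: an equivalence class of (oriented) metrics under
conformal rescaling. -/
structure ConformalStructure (d : ℕ) (M : Type u) [TopologicalSpace M] [ChartedSpace (Coord d) M]
    [IsManifold (𝓡 d) ∞ M] where
  /-- The metrics of the class. -/
  metrics : Set (OrientedMetric d M)
  nonempty : metrics.Nonempty
  related : ∀ G ∈ metrics, ∀ G' ∈ metrics, ∃ Ω : M → ℝ, IsRescaling Ω G G'
  closed : ∀ G ∈ metrics, ∀ (G' : OrientedMetric d M) (Ω : M → ℝ), IsRescaling Ω G G' →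
    G' ∈ metrics

/-- A smooth section of the density bundle `ℰ[w]` of a conformal manifold: every metric of the class
trivialises `ℰ[w]`, so that the section becomes a smooth function, and the functions for `G` and
`Ω² G` differ by the factor `Ω^w`. -/
structure Density {d : ℕ} {M : Type u} [TopologicalSpace M] [ChartedSpace (Coord d) M]
    [IsManifold (𝓡 d) ∞ M] (c : ConformalStructure d M) (w : ℝ) where
  /-- The expression of the density in the scale `G`. -/
  val : c.metrics → M → ℝ
  smooth : ∀ G, SmoothFn d (val G)
  rescale : ∀ (G G' : c.metrics) (Ω : M → ℝ), IsRescaling Ω G.1 G'.1 →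
    ∀ x, val G' x = Ω x ^ w * val G x

/-- `σ` is a conformal unit defining density of `S`. The function `I²` does not depend on the scale,
and off `S`, hence everywhere, the functions `A` for the various scales are determined by
`I² = 1 + σ^d A`: they form a density of weight `-d`. -/
def IsConformalUnitDensity {d : ℕ} {M : Type u} [TopologicalSpace M] [ChartedSpace (Coord d) M]
    [IsManifold (𝓡 d) ∞ M] {c : ConformalStructure d M} (σ : Density c 1) (S : Set M) : Prop :=
  ∀ G : c.metrics, IsConformalUnit G.1 (σ.val G) S

/-! ### Invariants -/

/-- An assignment, to every `d`-manifold with oriented Riemannian structure `G` and function `s`, of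
a function `P(s; G)` on that manifold. -/
abbrev InvariantFamily (d : ℕ) : Type (u + 1) :=
  ∀ (M : Type u) [TopologicalSpace M] [ChartedSpace (Coord d) M] [IsManifold (𝓡 d) ∞ M],
    OrientedMetric d M → (M → ℝ) → M → ℝ

/-- The variables of universal polynomial expressions. -/
inductive JetVar (d : ℕ) : Type
  /-- `∂_{a₁} ⋯ ∂_{aₖ} g_{bc}` -/
  | metric (α : List (Fin d)) (b c : Fin d)
  /-- `(det g)⁻¹` -/
  | detInv
  /-- `∂_{b₁} ⋯ ∂_{bₗ} s` -/
  | fn (α : List (Fin d))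
  /-- `‖ds‖_g⁻¹` -/
  | normInv
  /-- `ω_{a₁ … a_d} = ω(∂_{a₁}, …, ∂_{a_d})` -/
  | vol (a : Fin d → Fin d)

/-- The value of a variable in the chart `φ` at the point with coordinates `y`. -/
def JetVar.value {d : ℕ} {M : Type u} [TopologicalSpace M] [ChartedSpace (Coord d) M]
    [IsManifold (𝓡 d) ∞ M] (φ : OpenPartialHomeomorph M (Coord d)) (G : OrientedMetric d M)
    (s : M → ℝ) (y : Coord d) : JetVar d → ℝ
  | .metric α b c => iterPd α (fun z => gram φ G z b c) y
  | .detInv => ((gram φ G y).det)⁻¹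
  | .fn α => iterPd α (s ∘ φ.symm) y
  | .normInv => (Real.sqrt (gradSq φ G s y))⁻¹
  | .vol a => G.vol (φ.symm y) (fun i => coordVec φ y (a i))

/-- A coupled Riemannian invariant: natural under diffeomorphisms, and given, in every local
coordinate system and for every smooth `s`, by one universal polynomial in the jets of `g` and `s`,
`(det g)⁻¹` and the components of `ω`, without `‖ds‖⁻¹`. -/
structure IsCoupledInvariant {d : ℕ} (P : InvariantFamily.{u} d) : Prop where
  natural : ∀ (M : Type u) [TopologicalSpace M] [ChartedSpace (Coord d) M]
    [IsManifold (𝓡 d) ∞ M] [T2Space M] [SecondCountableTopology M] [ConnectedSpace M]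
    (F : M ≃ₘ^∞⟮𝓡 d, 𝓡 d⟯ M) (G G' : OrientedMetric d M), IsPullback F G G' →
    ∀ s : M → ℝ, SmoothFn d s → ∀ x, P M G (s ∘ F) x = P M G' s (F x)
  polynomial : ∃ p : MvPolynomial (JetVar d) ℝ, JetVar.normInv ∉ p.vars ∧
    ∀ (M : Type u) [TopologicalSpace M] [ChartedSpace (Coord d) M]
      [IsManifold (𝓡 d) ∞ M] [T2Space M] [SecondCountableTopology M] [ConnectedSpace M]
      (G : OrientedMetric d M) (s : M → ℝ), SmoothFn d s →
      ∀ φ ∈ smoothAtlas d M, ∀ x ∈ φ.source,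
        P M G s x = MvPolynomial.eval (JetVar.value φ G s (φ x)) p

/-- A weight `w` coupled conformal covariant of metrics and densities of weight `a`: a coupled
Riemannian invariant with `P(Ω^a s, Ω² g) = Ω^w P(s, g)`. It sends a density `σ ∈ Γ(ℰ[a])` to the
density `P(σ, 𝐠) ∈ Γ(ℰ[w])` whose expression in the scale `G` is `P(σ_G, G)`. -/
structure IsCoupledConformalInvariant {d : ℕ} (a w : ℝ) (P : InvariantFamily.{u} d) : Prop
    extends IsCoupledInvariant P where
  covariant : ∀ (M : Type u) [TopologicalSpace M] [ChartedSpace (Coord d) M]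
    [IsManifold (𝓡 d) ∞ M] [T2Space M] [SecondCountableTopology M] [ConnectedSpace M]
    (G G' : OrientedMetric d M) (Ω : M → ℝ), IsRescaling Ω G G' →
    ∀ s : M → ℝ, SmoothFn d s → ∀ x,
      P M G' (fun z => Ω z ^ a * s z) x = Ω x ^ w * P M G s x

/-- At each point of the hypersurface that `s` defines, `P(s; G)` depends on `s` only through its
`k`-jet at that point. Off the hypersurface nothing is required. -/
def DependsOnJet {d : ℕ} (k : ℕ) (P : InvariantFamily.{u} d) : Prop :=
  ∀ (M : Type u) [TopologicalSpace M] [ChartedSpace (Coord d) M]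
    [IsManifold (𝓡 d) ∞ M] [T2Space M] [SecondCountableTopology M] [ConnectedSpace M]
    (G : OrientedMetric d M) (s s' : M → ℝ), SmoothFn d s → SmoothFn d s' →
    ∀ x, s x = 0 → differential d s x ≠ 0 → SameJet d k s s' x → P M G s x = P M G s' x

/-- A Riemannian hypersurface pre-invariant. As `‖ds‖⁻¹` occurs, the polynomial expression is
required where `ds ≠ 0`, in particular near the hypersurface. -/
structure IsHypersurfacePreInvariant {d : ℕ} (Q : InvariantFamily.{u} d) : Prop where
  natural : ∀ (M : Type u) [TopologicalSpace M] [ChartedSpace (Coord d) M]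
    [IsManifold (𝓡 d) ∞ M] [T2Space M] [SecondCountableTopology M] [ConnectedSpace M]
    (F : M ≃ₘ^∞⟮𝓡 d, 𝓡 d⟯ M) (G G' : OrientedMetric d M), IsPullback F G G' →
    ∀ (s : M → ℝ) (S : Set M), IsDefiningFunction d s S →
      ∀ x, Q M G (s ∘ F) x = Q M G' s (F x)
  independent : ∀ (M : Type u) [TopologicalSpace M] [ChartedSpace (Coord d) M]
    [IsManifold (𝓡 d) ∞ M] [T2Space M] [SecondCountableTopology M] [ConnectedSpace M]
    (G : OrientedMetric d M) (s s' : M → ℝ) (S : Set M),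
    IsDefiningFunction d s S → IsDefiningFunction d s' S → CompatiblyOriented d s s' S →
      ∀ x ∈ S, Q M G s x = Q M G s' x
  polynomial : ∃ q : MvPolynomial (JetVar d) ℝ,
    ∀ (M : Type u) [TopologicalSpace M] [ChartedSpace (Coord d) M]
      [IsManifold (𝓡 d) ∞ M] [T2Space M] [SecondCountableTopology M] [ConnectedSpace M]
      (G : OrientedMetric d M) (s : M → ℝ) (S : Set M), IsDefiningFunction d s S →
      ∀ φ ∈ smoothAtlas d M, ∀ x ∈ φ.source, differential d s x ≠ 0 →
        Q M G s x = MvPolynomial.eval (JetVar.value φ G s (φ x)) q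

/-- A weight `w` conformal covariant of hypersurfaces: a Riemannian hypersurface invariant
`Q(S; g) = Q(s; g)|_S` with `Q(S; Ω² g) = Ω^w Q(S; g)`. -/
structure IsHypersurfaceConformalInvariant {d : ℕ} (w : ℝ) (Q : InvariantFamily.{u} d) : Prop
    extends IsHypersurfacePreInvariant Q where
  covariant : ∀ (M : Type u) [TopologicalSpace M] [ChartedSpace (Coord d) M]
    [IsManifold (𝓡 d) ∞ M] [T2Space M] [SecondCountableTopology M] [ConnectedSpace M]
    (G G' : OrientedMetric d M) (Ω : M → ℝ), IsRescaling Ω G G' →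
    ∀ (s : M → ℝ) (S : Set M), IsDefiningFunction d s S →
      ∀ x ∈ S, Q M G' s x = Ω x ^ w * Q M G s x

end

end ConformalHypersurface

open ConformalHypersurface

namespace ConformalHypersurface

noncomputable section

/-! The equation `I² = 1` can be solved order by order in the direction transverse to the
hypersurface. Let `T` be the transverse derivation with `T s = 1`. If `f` vanishes on the
hypersurface and `u` vanishes to order `j + 2`, then modulo order `j + 2` adding `u` to `f` changes
`I²` by `2 (1 - (j + 1) / d) (T f) |ds|² (T u)`; this is `MetricData.IsHypersurface.tsq_add`. The
factor is nonzero exactly while `j + 1 ≠ d`. Hence, starting from `s / |ds|`, explicit corrections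
push the error of `I² - 1` up to order `d` (`approx_spec`). Conversely, two solutions modulo order
`d` with the same orientation agree up to order `d + 1`, so they have the same `d`-jet along the
hypersurface (`unit_unique`). At `j + 1 = d` the factor vanishes, so this argument determines no jet
beyond the `d`-th.

The solution with `d - 1` corrections is a universal expression in the jets of `g` and `s`, the
inverse metric and `|ds|⁻¹`. It is built once in a free differential algebra (`MetricData.univ`),
where differentiation stays polynomial, and is then evaluated in charts (`evalAt_aeval`,
`iterPd_unitVal`). Substituting it and its derivatives for the jets of the density in the polynomial
of `P` gives the polynomial of `Q` (`substUnit`, `unitInvariant`).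

To relate `Q` to `P`, the local solution is cut off to a global smooth function `t` that agrees with
it near the given point (`exists_isUnitExtension`); then `Q` at that point is `P` of `t`
(`unitInvariant_eq`). Since `P` only sees `d`-jets along hypersurfaces, every assertion about `Q` on
the hypersurface becomes an equality of `d`-jets, which uniqueness supplies once both sides solve
`I² = 1` modulo order `d`: a conformal unit defining density does so by definition, the solution
made from another defining function does because orders of vanishing do not depend on that choice
(`ord_subset`), and `Ω` times the solution for `g` does for `Ω² g` because `I²` is conformally
invariant (`IsMetric.tsq_conf`). Independence of the chart comes from the invariance of `I²` under
coordinate changes (`IsChange.map_tsq`), which rests on the transformation laws of connection,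
Hessian and Ricci tensor. -/

/-! ### Metrics and scale tractors over a differential algebra -/

/-- The data of a metric `g` with inverse `h` over a differential algebra with derivations
`∂_1, …, ∂_d`. -/
structure MetricData (d : ℕ) (R : Type*) [CommRing R] [Algebra ℝ R] where
  /-- The derivations `∂_a`. -/
  D : Fin d → Derivation ℝ R R
  /-- The components `g_{ab}`. -/
  g : Matrix (Fin d) (Fin d) R
  /-- The components `g^{ab}`. -/
  h : Matrix (Fin d) (Fin d) R

namespace MetricData

variable {d : ℕ} {R : Type*} [CommRing R] [Algebra ℝ R] (m : MetricData d R)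

/-- The laws of a metric over an algebra with commuting derivations. -/
structure IsMetric : Prop where
  comm : ∀ a b f, m.D a (m.D b f) = m.D b (m.D a f)
  symm : m.g.transpose = m.g
  mul : m.g * m.h = 1

/-- Christoffel symbols `Γ^c_{ab}`. -/
def chr (c a b : Fin d) : R :=
  (1 / 2 : ℝ) • ∑ e, m.h c e * (m.D a (m.g b e) + m.D b (m.g a e) - m.D e (m.g a b))

/-- The curvature `R_{ab}{}^c{}_f`. -/
def riem (a b c f : Fin d) : R :=
  m.D a (m.chr c b f) - m.D b (m.chr c a f)
    + ∑ e, (m.chr c a e * m.chr e b f - m.chr c b e * m.chr e a f)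

/-- The Ricci tensor. -/
def ric (a b : Fin d) : R := ∑ c, m.riem c a c b

/-- The scalar curvature. -/
def scal : R := ∑ a, ∑ b, m.h a b * m.ric a b

/-- The trace of the Schouten tensor. -/
def schouten : R := (2 * ((d : ℝ) - 1))⁻¹ • m.scal

/-- The Hessian `∇_a ∇_b f`. -/
def hess (f : R) (a b : Fin d) : R := m.D a (m.D b f) - ∑ c, m.chr c a b * m.D c f

/-- The Laplacian. -/
def lap (f : R) : R := ∑ a, ∑ b, m.h a b * m.hess f a b

/-- The inner product `⟨df, df'⟩`. -/
def inn (f f' : R) : R := ∑ a, ∑ b, m.h a b * m.D a f * m.D b f'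

/-- The squared length of the scale tractor of `f`. -/
def tsq (f : R) : R := m.inn f f + 2 * f * (-(1 / (d : ℝ)) • (m.lap f + m.schouten * f))

/-- The approximations of the unit defining density, starting from `s / |ds|` with `N = |ds|⁻¹`. -/
def approx (s N : R) : ℕ → R
  | 0 => s * N
  | k + 1 => approx s N k - ((d : ℝ) / (2 * ((d : ℝ) - (k + 1)) * (k + 2))) •
      (N * s * (m.tsq (approx s N k) - 1))

/-! ### Homomorphisms of differential algebras -/

section Functoriality

variable {m} {A : Type*} [CommRing A] [Algebra ℝ A] {n : MetricData d A} (π : A →ₐ[ℝ] R)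

/-- A homomorphism of differential algebras that preserves the metric. -/
structure IsHom (n : MetricData d A) (m : MetricData d R) (π : A →ₐ[ℝ] R) : Prop where
  map_D : ∀ a f, π (n.D a f) = m.D a (π f)
  map_g : ∀ a b, π (n.g a b) = m.g a b
  map_h : ∀ a b, π (n.h a b) = m.h a b

variable {π} (hπ : IsHom n m π)
include hπ

theorem IsHom.map_chr (c a b : Fin d) : π (n.chr c a b) = m.chr c a b := by
  simp [chr, hπ.map_D, hπ.map_g, hπ.map_h]

theorem IsHom.map_scal : π n.scal = m.scal := by
  simp [scal, ric, riem, hπ.map_D, hπ.map_h, hπ.map_chr]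

theorem IsHom.map_tsq (f : A) : π (n.tsq f) = m.tsq (π f) := by
  have h2 : π 2 = 2 := map_ofNat π 2
  simp [tsq, inn, lap, hess, schouten, hπ.map_D, hπ.map_h, hπ.map_chr, hπ.map_scal, h2]

/-- All the constructions use only ring operations, real scalars, the derivations and the entries of
`g` and `h`. No law of a metric is needed, so the source may be the free algebra `univ`, in which
those laws fail. -/
theorem IsHom.map_approx (s N : A) (k : ℕ) :
    π (n.approx s N k) = m.approx (π s) (π N) k := by
  induction k with
  | zero => simp [approx]
  | succ k ih => simp [approx, hπ.map_tsq, ih]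

end Functoriality

/-! ### The Levi-Civita connection -/

/-- The entrywise derivative of a matrix. -/
def DM (a : Fin d) (A : Matrix (Fin d) (Fin d) R) : Matrix (Fin d) (Fin d) R := A.map (m.D a)

theorem DM_apply (a i j : Fin d) (A : Matrix (Fin d) (Fin d) R) :
    m.DM a A i j = m.D a (A i j) := rfl

theorem DM_mul (a : Fin d) (A B : Matrix (Fin d) (Fin d) R) :
    m.DM a (A * B) = m.DM a A * B + A * m.DM a B := by
  ext i j
  simp only [DM, Matrix.map_apply, Matrix.mul_apply, map_sum, Derivation.leibniz, smul_eq_mul,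
    Matrix.add_apply, ← Finset.sum_add_distrib]
  exact Finset.sum_congr rfl fun _ _ => by ring

theorem DM_add (a : Fin d) (A B : Matrix (Fin d) (Fin d) R) :
    m.DM a (A + B) = m.DM a A + m.DM a B := by
  ext i j; simp [DM]

theorem DM_one (a : Fin d) : m.DM a 1 = 0 := by
  ext i j
  by_cases h : i = j <;> simp [DM, h]

theorem DM_transpose (a : Fin d) (A : Matrix (Fin d) (Fin d) R) :
    m.DM a A.transpose = (m.DM a A).transpose := rfl

/-- The connection matrices `(Γ_a)^c_b`. -/
def conn (a : Fin d) : Matrix (Fin d) (Fin d) R := Matrix.of fun c b => m.chr c a b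

/-- The curvature matrices of connection matrices. -/
def curv (C : Fin d → Matrix (Fin d) (Fin d) R) (a b : Fin d) : Matrix (Fin d) (Fin d) R :=
  m.DM a (C b) - m.DM b (C a) + (C a * C b - C b * C a)

theorem riem_eq_curv (a b c f : Fin d) : m.riem a b c f = m.curv m.conn a b c f := by
  simp [riem, curv, conn, DM, Matrix.mul_apply]

/-- Connection matrices of a torsion-free connection that preserves the metric. -/
structure IsLeviCivita (C : Fin d → Matrix (Fin d) (Fin d) R) : Prop where
  torsion : ∀ a b c, C a c b = C b c a
  metric : ∀ a, m.DM a m.g = (C a).transpose * m.g + m.g * C a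

variable {m}

theorem IsMetric.mul' (hm : m.IsMetric) : m.h * m.g = 1 := mul_eq_one_comm.mp hm.mul

theorem IsMetric.symm_apply (hm : m.IsMetric) (a b : Fin d) : m.g a b = m.g b a :=
  congrFun (congrFun hm.symm b) a

theorem IsMetric.h_symm (hm : m.IsMetric) : m.h.transpose = m.h := by
  have h1 : m.h.transpose * m.g = 1 := by
    have := congrArg Matrix.transpose hm.mul
    rwa [Matrix.transpose_mul, hm.symm, Matrix.transpose_one] at this
  calc m.h.transpose = m.h.transpose * (m.g * m.h) := by rw [hm.mul, mul_one]
    _ = m.h := by rw [← mul_assoc, h1, one_mul]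

theorem IsMetric.h_symm_apply (hm : m.IsMetric) (a b : Fin d) : m.h a b = m.h b a :=
  congrFun (congrFun hm.h_symm b) a

theorem IsMetric.chr_symm (hm : m.IsMetric) (c a b : Fin d) : m.chr c a b = m.chr c b a := by
  simp only [chr]
  congr 1
  refine Finset.sum_congr rfl fun e _ => ?_
  rw [hm.symm_apply a b]; ring

/-- Lowering the upper index cancels the factor `h` in the Christoffel symbol, since `g h = 1`. -/
theorem IsMetric.lower_chr (hm : m.IsMetric) (e a b : Fin d) :
    ∑ c, m.g e c * m.chr c a b =
      (1 / 2 : ℝ) • (m.D a (m.g b e) + m.D b (m.g a e) - m.D e (m.g a b)) := by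
  set v : Fin d → R := fun e => m.D a (m.g b e) + m.D b (m.g a e) - m.D e (m.g a b)
  have h1 : ∀ c, m.chr c a b = (1 / 2 : ℝ) • m.h.mulVec v c := fun c => rfl
  simp only [h1, mul_smul_comm, ← Finset.smul_sum]
  congr 1
  change m.g.mulVec (m.h.mulVec v) e = v e
  rw [Matrix.mulVec_mulVec, hm.mul, Matrix.one_mulVec]

/-- In the sum of two lowered Christoffel symbols with the first and last index exchanged, four of
the six derivatives of `g` cancel and the other two coincide. -/
theorem IsMetric.isLeviCivita_conn (hm : m.IsMetric) : m.IsLeviCivita m.conn where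
  torsion a b c := hm.chr_symm c a b
  metric a := by
    ext b e
    have h1 := hm.lower_chr e a b
    have h2 := hm.lower_chr b a e
    simp only [DM_apply, Matrix.add_apply, Matrix.mul_apply, Matrix.transpose_apply, conn,
      Matrix.of_apply]
    have h3 : ∑ x, m.chr x a b * m.g x e = ∑ x, m.g e x * m.chr x a b :=
      Finset.sum_congr rfl fun x _ => by rw [hm.symm_apply x e, mul_comm]
    rw [h3, h1, h2, ← smul_add]
    have h4 : m.D a (m.g b e) + m.D b (m.g a e) - m.D e (m.g a b) +
        (m.D a (m.g e b) + m.D e (m.g a b) - m.D b (m.g a e)) = (2 : ℝ) • m.D a (m.g b e) := by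
      rw [hm.symm_apply e b, two_smul]; ring
    rw [h4, smul_smul]; norm_num

/-- This is Koszul's argument: the alternating sum of three copies of metric compatibility, with
torsion-freeness, isolates the connection. It reduces coordinate and conformal changes to checking
that a proposed connection is torsion-free and metric. -/
theorem IsMetric.conn_eq (hm : m.IsMetric) {C : Fin d → Matrix (Fin d) (Fin d) R}
    (hC : m.IsLeviCivita C) : m.conn = C := by
  have key : ∀ a b e, m.D a (m.g b e) = ∑ c, m.g e c * C a c b + ∑ c, m.g b c * C a c e := by
    intro a b e
    have := congrFun (congrFun (hC.metric a) b) e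
    simp only [DM_apply, Matrix.add_apply, Matrix.mul_apply, Matrix.transpose_apply] at this
    rw [this]
    congr 1
    exact Finset.sum_congr rfl fun x _ => by rw [hm.symm_apply x e, mul_comm]
  funext a
  ext c b
  have h1 : ∀ e, m.D a (m.g b e) + m.D b (m.g a e) - m.D e (m.g a b) =
      (2 : ℝ) • (m.g.mulVec (fun c => C a c b)) e := by
    intro e
    rw [key, key, key, two_smul]
    simp only [Matrix.mulVec, dotProduct]
    rw [show ∑ c, m.g e c * C b c a = ∑ c, m.g e c * C a c b from
        Finset.sum_congr rfl fun x _ => by rw [hC.torsion],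
      show ∑ c, m.g b c * C e c a = ∑ c, m.g b c * C a c e from
        Finset.sum_congr rfl fun x _ => by rw [hC.torsion],
      show ∑ c, m.g a c * C e c b = ∑ c, m.g a c * C b c e from
        Finset.sum_congr rfl fun x _ => by rw [hC.torsion]]
    ring
  simp only [conn, Matrix.of_apply, chr, h1, mul_smul_comm, ← Finset.smul_sum, smul_smul]
  norm_num
  change m.h.mulVec (m.g.mulVec fun c => C a c b) c = _
  rw [Matrix.mulVec_mulVec, hm.mul', Matrix.one_mulVec]

end MetricData

namespace MetricData

/-! ### Change of coordinates -/

section Change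

variable {d : ℕ} {R R' : Type*} [CommRing R] [Algebra ℝ R] [CommRing R'] [Algebra ℝ R']

/-- `π` is the pullback along a change of coordinates with Jacobian matrix `J`, and it pulls the
metric of `n` back to that of `m`. -/
structure IsChange (n : MetricData d R') (m : MetricData d R) (π : R' →ₐ[ℝ] R)
    (J K : Matrix (Fin d) (Fin d) R) : Prop where
  map_D : ∀ a f, m.D a (π f) = ∑ i, J i a * π (n.D i f)
  closed : ∀ a b i, m.D a (J i b) = m.D b (J i a)
  inv : J * K = 1
  metric : m.g = J.transpose * n.g.map π * J

variable {n : MetricData d R'} {m : MetricData d R} {π : R' →ₐ[ℝ] R}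
  {J K : Matrix (Fin d) (Fin d) R}

theorem matrix_map_mul (π : R' →ₐ[ℝ] R) (A B : Matrix (Fin d) (Fin d) R') :
    (A * B).map π = A.map π * B.map π := by
  ext i j; simp [Matrix.mul_apply]

theorem matrix_map_one (π : R' →ₐ[ℝ] R) : (1 : Matrix (Fin d) (Fin d) R').map π = 1 :=
  Matrix.map_one π (map_zero π) (map_one π)

/-- The pullback of the connection form of `n`. -/
def pullConn (n : MetricData d R') (π : R' →ₐ[ℝ] R) (J : Matrix (Fin d) (Fin d) R) (a : Fin d) :
    Matrix (Fin d) (Fin d) R :=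
  ∑ i, J i a • (n.conn i).map π

theorem IsChange.inv' (hc : IsChange n m π J K) : K * J = 1 := mul_eq_one_comm.mp hc.inv

theorem IsChange.metric_h (hc : IsChange n m π J K) (hm : m.IsMetric) (hn : n.IsMetric) :
    m.h = K * n.h.map π * K.transpose := by
  have h1 : m.g * (K * n.h.map π * K.transpose) = 1 := by
    have e1 : n.g.map π * n.h.map π = 1 := by
      rw [← matrix_map_mul, hn.mul, matrix_map_one]
    have e2 : J.transpose * K.transpose = 1 := by
      rw [← Matrix.transpose_mul, hc.inv', Matrix.transpose_one]
    rw [hc.metric]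
    calc J.transpose * n.g.map π * J * (K * n.h.map π * K.transpose)
        = J.transpose * (n.g.map π * ((J * K) * n.h.map π)) * K.transpose := by
          simp only [Matrix.mul_assoc]
      _ = 1 := by rw [hc.inv, Matrix.one_mul, e1, Matrix.mul_one, e2]
  calc m.h = m.h * (m.g * (K * n.h.map π * K.transpose)) := by rw [h1, Matrix.mul_one]
    _ = _ := by rw [← Matrix.mul_assoc, hm.mul', Matrix.one_mul]

theorem IsChange.DM_map (hc : IsChange n m π J K) (a : Fin d) (A : Matrix (Fin d) (Fin d) R') :
    m.DM a (A.map π) = ∑ i, J i a • (n.DM i A).map π := by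
  ext p q
  simp [DM, hc.map_D, Matrix.sum_apply]

theorem IsChange.DM_inv (hc : IsChange n m π J K) (a : Fin d) :
    m.DM a K = -(K * m.DM a J * K) := by
  have h1 : m.DM a J * K + J * m.DM a K = 0 := by
    rw [← DM_mul, hc.inv, DM_one]
  have h2 : K * (m.DM a J * K + J * m.DM a K) = 0 := by rw [h1, Matrix.mul_zero]
  rw [Matrix.mul_add, ← Matrix.mul_assoc K J, hc.inv', Matrix.one_mul, ← Matrix.mul_assoc] at h2
  exact eq_neg_of_add_eq_zero_right h2

/-- The candidate is the gauge transform by `J` of the pulled-back connection. Closedness of the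
Jacobian makes `K dJ` torsion-free. In the metric law, `dJ` accounts for the derivatives of the two
Jacobian factors of `g` and the conjugated pullback for the derivative of the middle one. -/
theorem IsChange.isLeviCivita (hc : IsChange n m π J K) (hn : n.IsMetric) :
    m.IsLeviCivita fun a => K * m.DM a J + K * pullConn n π J a * J where
  torsion a b c := by
    have h1 : ∀ i, (m.DM a J + pullConn n π J a * J) i b
        = (m.DM b J + pullConn n π J b * J) i a := by
      intro i
      simp only [Matrix.add_apply, DM_apply, hc.closed a b, Matrix.mul_apply, pullConn,
        Matrix.sum_apply, Matrix.smul_apply, Matrix.map_apply, Finset.sum_mul, smul_eq_mul]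
      congr 1
      rw [Finset.sum_comm]
      refine Finset.sum_congr rfl fun p _ => Finset.sum_congr rfl fun q _ => ?_
      simp only [conn, Matrix.of_apply]
      rw [hn.chr_symm]; ring
    simp only [Matrix.mul_assoc, ← Matrix.mul_add]
    rw [Matrix.mul_apply, Matrix.mul_apply]
    exact Finset.sum_congr rfl fun i _ => by rw [h1]
  metric a := by
    have h1 : m.DM a (n.g.map π) = (pullConn n π J a).transpose * n.g.map π
        + n.g.map π * pullConn n π J a := by
      rw [hc.DM_map]
      simp only [hn.isLeviCivita_conn.metric]
      ext p q
      simp only [pullConn, Matrix.transpose_sum, Matrix.sum_mul, Matrix.sum_apply,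
        Matrix.add_apply, Matrix.smul_apply, Matrix.map_apply, Matrix.mul_apply, map_add, map_sum,
        map_mul, Matrix.transpose_apply, smul_eq_mul, mul_add, Finset.sum_add_distrib,
        Finset.mul_sum]
      congr 1
      · refine Finset.sum_congr rfl fun i _ => Finset.sum_congr rfl fun j _ => by ring
      · refine Finset.sum_congr rfl fun i _ => Finset.sum_congr rfl fun j _ => by ring
    have e2 : J.transpose * K.transpose = 1 := by
      rw [← Matrix.transpose_mul, hc.inv', Matrix.transpose_one]
    rw [hc.metric, DM_mul, DM_mul, h1, DM_transpose]
    set B := pullConn n π J a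
    set X := n.g.map π
    set Y := m.DM a J
    have e3 : J.transpose * X * J * (K * Y + K * B * J)
        = J.transpose * X * Y + J.transpose * X * B * J := by
      calc _ = J.transpose * X * ((J * K) * Y) + J.transpose * X * ((J * K) * B * J) := by
            simp only [Matrix.mul_add, Matrix.mul_assoc]
        _ = _ := by rw [hc.inv]; simp only [Matrix.one_mul, Matrix.mul_assoc]
    have e4 : (K * Y + K * B * J).transpose * (J.transpose * X * J)
        = Y.transpose * X * J + J.transpose * B.transpose * X * J := by
      simp only [Matrix.transpose_add, Matrix.transpose_mul, Matrix.add_mul]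
      have e5 : ∀ Z, K.transpose * (J.transpose * Z) = Z := by
        intro Z
        rw [← Matrix.mul_assoc, ← Matrix.transpose_mul, hc.inv, Matrix.transpose_one,
          Matrix.one_mul]
      simp only [Matrix.mul_assoc, e5]
    rw [e3, e4]
    simp only [Matrix.mul_add, Matrix.add_mul, Matrix.mul_assoc]
    abel

theorem IsChange.conn_eq (hc : IsChange n m π J K) (hm : m.IsMetric) (hn : n.IsMetric)
    (a : Fin d) : m.conn a = K * m.DM a J + K * pullConn n π J a * J :=
  congrFun (hm.conn_eq (hc.isLeviCivita hn)) a

/-- The transformation law of the Hessian. -/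
theorem IsChange.hess_eq (hc : IsChange n m π J K) (hm : m.IsMetric) (hn : n.IsMetric) (f : R') :
    Matrix.of (m.hess (π f)) = J.transpose * (Matrix.of (n.hess f)).map π * J := by
  ext a b
  have h0 : J * m.conn a = m.DM a J + pullConn n π J a * J := by
    rw [hc.conn_eq hm hn, Matrix.mul_add, ← Matrix.mul_assoc, hc.inv, Matrix.one_mul,
      ← Matrix.mul_assoc, ← Matrix.mul_assoc, hc.inv, Matrix.one_mul]
  have h1 : ∀ i, ∑ c, J i c * m.chr c a b =
      m.D a (J i b) + ∑ k, (∑ j, J j a * π (n.chr i j k)) * J k b := by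
    intro i
    have := congrFun (congrFun h0 i) b
    simp only [Matrix.mul_apply, Matrix.add_apply, DM_apply, pullConn, Matrix.sum_apply,
      Matrix.smul_apply, Matrix.map_apply, smul_eq_mul, conn, Matrix.of_apply] at this
    exact this
  have h2 : ∑ c, m.chr c a b * m.D c (π f) =
      ∑ i, (m.D a (J i b) + ∑ k, (∑ j, J j a * π (n.chr i j k)) * J k b) * π (n.D i f) := by
    simp only [← h1]
    simp only [hc.map_D, Finset.mul_sum, Finset.sum_mul]
    rw [Finset.sum_comm]
    exact Finset.sum_congr rfl fun i _ => Finset.sum_congr rfl fun c _ => by ring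
  simp only [Matrix.of_apply, hess, h2]
  simp only [Matrix.mul_apply, Matrix.map_apply, Matrix.transpose_apply, Matrix.of_apply, hess]
  simp only [hc.map_D, map_sum, Derivation.leibniz, smul_eq_mul, map_sub, map_mul, add_mul,
    Finset.sum_add_distrib, Finset.sum_mul, Finset.mul_sum, mul_sub, sub_mul,
    Finset.sum_sub_distrib]
  rw [show ∑ x, π (n.D x f) * m.D a (J x b) = ∑ x, m.D a (J x b) * π (n.D x f) from
    Finset.sum_congr rfl fun x _ => mul_comm _ _]
  have h3 : ∑ x, ∑ i, J x b * (J i a * π (n.D i (n.D x f))) =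
      ∑ x, ∑ i, J i a * π (n.D i (n.D x f)) * J x b :=
    Finset.sum_congr rfl fun _ _ => Finset.sum_congr rfl fun _ _ => by ring
  have h4 : ∑ x, ∑ i, ∑ k, J k a * π (n.chr x k i) * J i b * π (n.D x f) =
      ∑ x, ∑ i, ∑ k, J i a * (π (n.chr k i x) * π (n.D k f)) * J x b := by
    rw [Finset.sum_comm]
    refine Finset.sum_congr rfl fun _ _ => ?_
    rw [Finset.sum_comm]
    exact Finset.sum_congr rfl fun _ _ => Finset.sum_congr rfl fun _ _ => by ring
  rw [h3, h4]; ring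

omit [Algebra ℝ R] in
theorem trace_change {A B : Matrix (Fin d) (Fin d) R} (hJK : J * K = 1) :
    (K * A * K.transpose * (J.transpose * B * J)).trace = (A * B).trace := by
  have e2 : K.transpose * J.transpose = 1 := by
    rw [← Matrix.transpose_mul, hJK, Matrix.transpose_one]
  calc (K * A * K.transpose * (J.transpose * B * J)).trace
      = (K * (A * ((K.transpose * J.transpose) * B) * J)).trace := by
        simp only [Matrix.mul_assoc]
    _ = (A * B).trace := by
        rw [e2, Matrix.one_mul, Matrix.trace_mul_comm, Matrix.mul_assoc (A * B), hJK,
          Matrix.mul_one]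

omit [Algebra ℝ R] in
theorem sum_mul_eq_trace (A : Matrix (Fin d) (Fin d) R) (B : Fin d → Fin d → R) :
    ∑ a, ∑ b, A a b * B a b = (A.transpose * Matrix.of B).trace := by
  simp only [Matrix.trace, Matrix.diag, Matrix.mul_apply, Matrix.transpose_apply, Matrix.of_apply]
  rw [Finset.sum_comm]

/-- The inverse metric transforms with `K` and a covariant 2-tensor with `J`; they cancel under the
trace. -/
theorem IsChange.contract (hc : IsChange n m π J K) (hm : m.IsMetric) (hn : n.IsMetric)
    {B : Fin d → Fin d → R} {B' : Fin d → Fin d → R'}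
    (hB : Matrix.of B = J.transpose * (Matrix.of B').map π * J) :
    ∑ a, ∑ b, m.h a b * B a b = π (∑ a, ∑ b, n.h a b * B' a b) := by
  rw [sum_mul_eq_trace, sum_mul_eq_trace, hm.h_symm, hn.h_symm, hc.metric_h hm hn, hB,
    trace_change hc.inv, ← matrix_map_mul]
  simp only [Matrix.trace, Matrix.diag, Matrix.map_apply, map_sum]

/-- Curvature commutes with pullback of connection forms and is conjugated by a gauge
transformation. Both facts are proved by antisymmetrising `∂_a C_b + C_a C_b`. -/
theorem IsChange.curv_eq (hc : IsChange n m π J K) (hm : m.IsMetric) (hn : n.IsMetric)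
    (a b : Fin d) : m.curv m.conn a b =
      K * (∑ i, ∑ j, (J i a * J j b) • (n.curv n.conn i j).map π) * J := by
  set B := pullConn n π J with hB
  have hBd : m.curv B a b = ∑ i, ∑ j, (J i a * J j b) • (n.curv n.conn i j).map π := by
    have hD : ∀ a b, m.DM a (B b) = ∑ i, m.D a (J i b) • (n.conn i).map π +
        ∑ i, ∑ j, (J i a * J j b) • (n.DM i (n.conn j)).map π := by
      intro a b
      have h1 : ∀ i, m.DM a (J i b • (n.conn i).map π) =
          m.D a (J i b) • (n.conn i).map π + J i b • m.DM a ((n.conn i).map π) := by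
        intro i; ext p q
        simp [DM]; ring
      have h2 : m.DM a (B b) = ∑ i, m.DM a (J i b • (n.conn i).map π) := by
        ext p q; simp [DM, hB, pullConn, Matrix.sum_apply]
      rw [h2]
      simp only [h1, hc.DM_map, Finset.sum_add_distrib, Finset.smul_sum, smul_smul]
      congr 1
      rw [Finset.sum_comm]
      exact Finset.sum_congr rfl fun _ _ => Finset.sum_congr rfl fun _ _ => by rw [mul_comm]
    have hP : ∀ a b, B a * B b = ∑ i, ∑ j, (J i a * J j b) • (n.conn i * n.conn j).map π := by
      intro a b
      simp only [hB, pullConn, Matrix.sum_mul, Matrix.mul_sum, matrix_map_mul]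
      rw [Finset.sum_comm]
      refine Finset.sum_congr rfl fun i _ => Finset.sum_congr rfl fun j _ => ?_
      rw [Matrix.smul_mul, Matrix.mul_smul, smul_smul]
    have hsw : ∀ F : Fin d → Fin d → Matrix (Fin d) (Fin d) R,
        ∑ i, ∑ j, (J i b * J j a) • F i j = ∑ i, ∑ j, (J i a * J j b) • F j i := by
      intro F
      rw [Finset.sum_comm]
      exact Finset.sum_congr rfl fun _ _ => Finset.sum_congr rfl fun _ _ => by rw [mul_comm]
    simp only [curv]
    rw [hD, hD, hP, hP, hsw, hsw]
    -- The terms with a derivative of the Jacobian are symmetric in `a`, `b` and drop out of the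
    -- curvature.
    simp only [hc.closed a b]
    rw [add_sub_add_left_eq_sub]
    simp only [← Finset.sum_sub_distrib, ← Finset.sum_add_distrib]
    refine Finset.sum_congr rfl fun i _ => Finset.sum_congr rfl fun j _ => ?_
    ext p q
    simp only [DM, Matrix.add_apply, Matrix.sub_apply, Matrix.smul_apply, Matrix.map_apply,
      map_add, map_sub, smul_eq_mul]
    ring
  rw [← hBd]
  have hJab : m.DM a (m.DM b J) = m.DM b (m.DM a J) := by
    ext p q; simp [DM, hm.comm a b]
  have hconn : ∀ a, m.conn a = K * m.DM a J + K * B a * J := hc.conn_eq hm hn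
  -- Of the five terms on the right, the one with the second derivative of `J` and the sum of the
  -- two with a first derivative of `J` are symmetric in `a`, `b`. Only the conjugate of `∂_a B_b +
  -- B_a B_b` survives antisymmetrisation.
  have hD : ∀ a b, m.DM a (m.conn b) + m.conn a * m.conn b =
      K * m.DM a (m.DM b J) + K * m.DM a (B b) * J + K * B b * m.DM a J +
        K * B a * m.DM b J + K * (B a * B b) * J := by
    intro a b
    have e1 : m.conn a * m.conn b = K * m.DM a J * K * m.DM b J + K * m.DM a J * K * B b * J
        + K * B a * m.DM b J + K * B a * B b * J := by
      have e2 : ∀ Z, J * (K * Z) = Z := fun Z => by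
        rw [← Matrix.mul_assoc, hc.inv, Matrix.one_mul]
      rw [hconn, hconn]
      simp only [Matrix.mul_add, Matrix.add_mul, Matrix.mul_assoc, e2]
      abel
    rw [e1, hconn b]
    simp only [DM_add, DM_mul, hc.DM_inv]
    noncomm_ring
  calc m.curv m.conn a b = (m.DM a (m.conn b) + m.conn a * m.conn b) -
        (m.DM b (m.conn a) + m.conn b * m.conn a) := by simp only [curv]; abel
    _ = _ := by
      rw [hD, hD, hJab]
      simp only [curv]
      noncomm_ring

/-- In the trace, the `K` that transforms the upper index meets the `J` of the first lower index and
they contract to a Kronecker delta. -/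
theorem IsChange.ric_eq (hc : IsChange n m π J K) (hm : m.IsMetric) (hn : n.IsMetric) :
    Matrix.of m.ric = J.transpose * (Matrix.of n.ric).map π * J := by
  ext a b
  have h1 : ∀ c, m.riem c a c b = ∑ p, ∑ q, K c p *
      (∑ i, ∑ j, (J i c * J j a) * π (n.riem i j p q)) * J q b := by
    intro c
    rw [riem_eq_curv, hc.curv_eq hm hn]
    simp only [Matrix.mul_apply, Finset.sum_mul, Matrix.sum_apply, Matrix.smul_apply, smul_eq_mul,
      Matrix.map_apply, ← riem_eq_curv]
    rw [Finset.sum_comm]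
  have hKJ : ∀ i p, ∑ c, J i c * K c p = if i = p then 1 else 0 := by
    intro i p
    have := congrFun (congrFun hc.inv i) p
    rwa [Matrix.mul_apply, Matrix.one_apply] at this
  calc m.ric a b = ∑ c, ∑ p, ∑ q, ∑ i, ∑ j, (J i c * K c p) *
        (J j a * π (n.riem i j p q) * J q b) := by
        simp only [ric, h1, Finset.mul_sum, Finset.sum_mul]
        refine Finset.sum_congr rfl fun _ _ => Finset.sum_congr rfl fun _ _ =>
          Finset.sum_congr rfl fun _ _ => Finset.sum_congr rfl fun _ _ =>
          Finset.sum_congr rfl fun _ _ => by ring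
    _ = ∑ p, ∑ q, ∑ i, ∑ j, (∑ c, J i c * K c p) * (J j a * π (n.riem i j p q) * J q b) := by
        rw [Finset.sum_comm]
        refine Finset.sum_congr rfl fun _ _ => ?_
        rw [Finset.sum_comm]
        refine Finset.sum_congr rfl fun _ _ => ?_
        rw [Finset.sum_comm]
        refine Finset.sum_congr rfl fun _ _ => ?_
        rw [Finset.sum_comm]
        refine Finset.sum_congr rfl fun _ _ => ?_
        rw [Finset.sum_mul]
    _ = ∑ q, (∑ j, J j a * π (n.ric j q)) * J q b := by
        simp only [hKJ, ite_mul, one_mul, zero_mul]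
        rw [Finset.sum_comm]
        refine Finset.sum_congr rfl fun q _ => ?_
        simp only [ric, map_sum, Finset.mul_sum, Finset.sum_mul]
        rw [Finset.sum_comm (γ := Fin d) (s := Finset.univ) (t := Finset.univ)
          (f := fun j c => J j a * π (n.riem c j c q) * J q b)]
        refine Finset.sum_congr rfl fun p _ => ?_
        rw [Finset.sum_comm]
        simp
    _ = _ := by
        simp only [Matrix.mul_apply, Matrix.map_apply, Matrix.transpose_apply, Matrix.of_apply]

theorem IsChange.inn_eq (hc : IsChange n m π J K) (hm : m.IsMetric) (hn : n.IsMetric)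
    (f f' : R') : m.inn (π f) (π f') = π (n.inn f f') := by
  simp only [inn, mul_assoc]
  refine hc.contract hm hn ?_
  ext a b
  simp only [Matrix.of_apply, hc.map_D, Matrix.mul_apply, Matrix.map_apply,
    Matrix.transpose_apply, Finset.sum_mul, Finset.mul_sum, map_mul]
  exact Finset.sum_congr rfl fun _ _ => Finset.sum_congr rfl fun _ _ => by ring

/-- The squared length of the scale tractor does not depend on the coordinates. -/
theorem IsChange.map_tsq (hc : IsChange n m π J K) (hm : m.IsMetric) (hn : n.IsMetric) (f : R') :
    π (n.tsq f) = m.tsq (π f) := by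
  have h1 : m.lap (π f) = π (n.lap f) := hc.contract hm hn (hc.hess_eq hm hn f)
  have h2 : m.scal = π n.scal := hc.contract hm hn (hc.ric_eq hm hn)
  have h3 : m.inn (π f) (π f) = π (n.inn f f) := hc.inn_eq hm hn f f
  have h4 : π 2 = 2 := map_ofNat π 2
  simp only [tsq, schouten, map_add, map_mul, map_smul, h1, h2, h3, h4]

theorem IsChange.map_approx (hc : IsChange n m π J K) (hm : m.IsMetric) (hn : n.IsMetric)
    (s N : R') (k : ℕ) : π (n.approx s N k) = m.approx (π s) (π N) k := by
  induction k with
  | zero => simp [approx]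
  | succ k ih => simp [approx, hc.map_tsq hm hn, ih]

end Change

end MetricData

namespace MetricData

/-! ### Conformal change of the metric -/

section Conformal

variable {d : ℕ} {R : Type*} [CommRing R] [Algebra ℝ R]

/-- The metric `Ω² g`, where `W = Ω⁻¹`. -/
def conf (m : MetricData d R) (Ω W : R) : MetricData d R where
  D := m.D
  g := Ω ^ 2 • m.g
  h := W ^ 2 • m.h

variable {m : MetricData d R} {Ω W : R}

theorem IsMetric.conf (hm : m.IsMetric) (hW : Ω * W = 1) : (m.conf Ω W).IsMetric where
  comm := hm.comm
  symm := by simp [MetricData.conf, Matrix.transpose_smul, hm.symm]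
  mul := by
    simp [MetricData.conf, hm.mul, smul_smul, ← mul_pow, mul_comm W, hW]

/-- `υ_a = Ω⁻¹ ∂_a Ω`. -/
def ups (m : MetricData d R) (Ω W : R) (a : Fin d) : R := W * m.D a Ω

/-- `Υ^a = g^{ab} υ_b`. -/
def upsUp (m : MetricData d R) (Ω W : R) (a : Fin d) : R := ∑ b, m.h a b * m.ups Ω W b

/-- `|υ|²`. -/
def upsSq (m : MetricData d R) (Ω W : R) : R := ∑ a, m.ups Ω W a * m.upsUp Ω W a

/-- The difference of the Levi-Civita connections of `Ω² g` and `g`. -/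
def confDiff (m : MetricData d R) (Ω W : R) (a : Fin d) : Matrix (Fin d) (Fin d) R :=
  Matrix.of fun c b => m.ups Ω W a * (1 : Matrix (Fin d) (Fin d) R) c b
    + (1 : Matrix (Fin d) (Fin d) R) c a * m.ups Ω W b - m.upsUp Ω W c * m.g a b

theorem D_eq_ups (hW : Ω * W = 1) (a : Fin d) : m.D a Ω = Ω * m.ups Ω W a := by
  rw [ups, ← mul_assoc, hW, one_mul]

theorem D_W (hW : Ω * W = 1) (a : Fin d) : m.D a W = -(W * m.ups Ω W a) := by
  have := congrArg (m.D a) hW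
  simp only [Derivation.leibniz, smul_eq_mul, Derivation.map_one_eq_zero] at this
  have h2 : W * (Ω * m.D a W + W * m.D a Ω) = 0 := by rw [this, mul_zero]
  rw [mul_add, ← mul_assoc, mul_comm W Ω, hW, one_mul] at h2
  rw [ups]; linear_combination h2

/-- The form `υ` is `d log Ω`, hence closed; the products of first derivatives are symmetric. -/
theorem IsMetric.D_ups (hm : m.IsMetric) (hW : Ω * W = 1) (a b : Fin d) :
    m.D a (m.ups Ω W b) = m.D b (m.ups Ω W a) := by
  simp only [ups, Derivation.leibniz, smul_eq_mul, hm.comm a b, D_W hW]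
  ring

theorem IsMetric.g_upsUp (hm : m.IsMetric) (a : Fin d) :
    ∑ c, m.g a c * m.upsUp Ω W c = m.ups Ω W a := by
  change m.g.mulVec (m.h.mulVec (m.ups Ω W)) a = _
  rw [Matrix.mulVec_mulVec, hm.mul, Matrix.one_mulVec]

theorem IsMetric.upsUp_g (hm : m.IsMetric) (a : Fin d) :
    ∑ c, m.upsUp Ω W c * m.g c a = m.ups Ω W a := by
  rw [← hm.g_upsUp]
  exact Finset.sum_congr rfl fun c _ => by rw [hm.symm_apply c a, mul_comm]

theorem confDiff_mulVec (a c : Fin d) (X : Fin d → R) :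
    ∑ e, m.confDiff Ω W a c e * X e = m.ups Ω W a * X c
      + (1 : Matrix (Fin d) (Fin d) R) c a * ∑ e, m.ups Ω W e * X e
      - m.upsUp Ω W c * ∑ e, m.g a e * X e := by
  simp only [confDiff, Matrix.of_apply, add_mul, sub_mul, Finset.sum_add_distrib,
    Finset.sum_sub_distrib, Finset.mul_sum, mul_assoc, Matrix.one_apply, ite_mul, one_mul, zero_mul]
  congr 2
  simp

theorem vecMul_confDiff (a b : Fin d) (X : Fin d → R) :
    ∑ e, X e * m.confDiff Ω W a e b = m.ups Ω W a * X b + X a * m.ups Ω W b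
      - (∑ e, X e * m.upsUp Ω W e) * m.g a b := by
  simp only [confDiff, Matrix.of_apply, mul_add, mul_sub, Finset.sum_add_distrib,
    Finset.sum_sub_distrib, Finset.sum_mul, mul_assoc, Matrix.one_apply, ite_mul, one_mul, zero_mul,
    mul_ite, mul_one, mul_zero]
  simp [mul_comm]

theorem IsMetric.trace_confDiff (hm : m.IsMetric) (e : Fin d) :
    ∑ c, m.confDiff Ω W c c e = d * m.ups Ω W e := by
  simp only [confDiff, Matrix.of_apply, Finset.sum_add_distrib, Finset.sum_sub_distrib,
    Matrix.one_apply, if_true, hm.upsUp_g]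
  simp

/-- The difference tensor is symmetric, so torsion stays zero. Lowered and symmetrised, its last two
terms cancel and leave `2 υ_a g`, which matches the derivative of the factor `Ω²`. -/
theorem IsMetric.isLeviCivita_conf (hm : m.IsMetric) (hW : Ω * W = 1) :
    (m.conf Ω W).IsLeviCivita fun a => m.conn a + m.confDiff Ω W a where
  torsion a b c := by
    simp only [Matrix.add_apply, conn, confDiff, Matrix.of_apply, hm.chr_symm c a b,
      hm.symm_apply a b]
    ring
  metric a := by
    ext b e
    have h1 := congrFun (congrFun (hm.isLeviCivita_conn.metric a) b) e
    simp only [DM_apply, Matrix.add_apply, Matrix.mul_apply, Matrix.transpose_apply] at h1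
    simp only [DM_apply, Matrix.add_apply, Matrix.mul_apply, Matrix.transpose_apply, MetricData.conf,
      Matrix.smul_apply, smul_eq_mul, Derivation.leibniz, Derivation.leibniz_pow]
    rw [h1, D_eq_ups hW]
    have h2 : ∑ x, m.confDiff Ω W a x b * m.g x e = m.ups Ω W a * m.g b e
        + m.g a e * m.ups Ω W b - m.ups Ω W e * m.g a b := by
      have := vecMul_confDiff (m := m) (Ω := Ω) (W := W) a b (fun x => m.g e x)
      rw [hm.g_upsUp] at this
      rw [hm.symm_apply b e, hm.symm_apply a e, ← this]
      exact Finset.sum_congr rfl fun x _ => by rw [hm.symm_apply x e, mul_comm]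
    have h3 : ∑ x, m.g b x * m.confDiff Ω W a x e = m.ups Ω W a * m.g b e
        + m.g a b * m.ups Ω W e - m.ups Ω W b * m.g a e := by
      rw [vecMul_confDiff, hm.g_upsUp, hm.symm_apply b a]
    have e1 : ∑ x, (m.conn a x b + m.confDiff Ω W a x b) * (Ω ^ 2 * m.g x e) =
        Ω ^ 2 * (∑ x, m.conn a x b * m.g x e + ∑ x, m.confDiff Ω W a x b * m.g x e) := by
      rw [← Finset.sum_add_distrib, Finset.mul_sum]
      exact Finset.sum_congr rfl fun x _ => by ring
    have e2 : ∑ x, Ω ^ 2 * m.g b x * (m.conn a x e + m.confDiff Ω W a x e) =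
        Ω ^ 2 * (∑ x, m.g b x * m.conn a x e + ∑ x, m.g b x * m.confDiff Ω W a x e) := by
      rw [← Finset.sum_add_distrib, Finset.mul_sum]
      exact Finset.sum_congr rfl fun x _ => by ring
    rw [e1, e2, h2, h3]
    simp only [nsmul_eq_mul]
    push_cast
    ring

theorem IsMetric.conn_conf (hm : m.IsMetric) (hW : Ω * W = 1) (a : Fin d) :
    (m.conf Ω W).conn a = m.conn a + m.confDiff Ω W a :=
  congrFun ((hm.conf hW).conn_eq (hm.isLeviCivita_conf hW)) a

theorem IsMetric.chr_conf (hm : m.IsMetric) (hW : Ω * W = 1) (c a b : Fin d) :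
    (m.conf Ω W).chr c a b = m.chr c a b + m.confDiff Ω W a c b :=
  congrFun (congrFun (hm.conn_conf hW a) c) b

/-- The derivative of the inverse metric. -/
theorem IsMetric.D_h (hm : m.IsMetric) (a c b : Fin d) : m.D a (m.h c b) =
    -(∑ e, m.chr c a e * m.h e b + ∑ e, m.h c e * m.chr b a e) := by
  have h1 : m.DM a m.h * m.g + m.h * m.DM a m.g = 0 := by rw [← DM_mul, hm.mul', DM_one]
  have h2 : m.DM a m.h = -(m.h * m.DM a m.g * m.h) := by
    have : (m.DM a m.h * m.g + m.h * m.DM a m.g) * m.h = 0 := by rw [h1, Matrix.zero_mul]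
    rw [Matrix.add_mul, Matrix.mul_assoc, hm.mul, Matrix.mul_one] at this
    exact eq_neg_of_add_eq_zero_left this
  have h3 : m.h * m.DM a m.g * m.h = m.h * (m.conn a).transpose + m.conn a * m.h := by
    rw [hm.isLeviCivita_conn.metric]
    calc m.h * ((m.conn a).transpose * m.g + m.g * m.conn a) * m.h
        = m.h * (m.conn a).transpose * (m.g * m.h) + (m.h * m.g) * m.conn a * m.h := by
          simp only [Matrix.mul_add, Matrix.add_mul, Matrix.mul_assoc]
      _ = _ := by rw [hm.mul, hm.mul', Matrix.mul_one, Matrix.one_mul]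
  have h4 := congrFun (congrFun (h2.trans (congrArg _ h3)) c) b
  simp only [DM_apply, Matrix.neg_apply, Matrix.add_apply, Matrix.mul_apply,
    Matrix.transpose_apply, conn, Matrix.of_apply] at h4
  rw [h4, add_comm]

/-- The Hessian of `log Ω`. -/
def upsHess (m : MetricData d R) (Ω W : R) (a b : Fin d) : R :=
  m.D a (m.ups Ω W b) - ∑ e, m.ups Ω W e * m.chr e a b

/-- The Laplacian of `log Ω`. -/
def upsLap (m : MetricData d R) (Ω W : R) : R := ∑ a, ∑ b, m.h a b * m.upsHess Ω W a b

/-- Raising an index commutes with covariant differentiation: the derivative of the inverse metric,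
expressed through Christoffel symbols, cancels the divergence term and produces that of the Hessian.
-/
theorem IsMetric.div_upsUp (hm : m.IsMetric) :
    ∑ c, m.D c (m.upsUp Ω W c) + ∑ e, (∑ c, m.chr c c e) * m.upsUp Ω W e = m.upsLap Ω W := by
  have h1 : ∀ c, m.D c (m.upsUp Ω W c) = ∑ b, m.h c b * m.D c (m.ups Ω W b)
      - ∑ e, m.chr c c e * m.upsUp Ω W e - ∑ e, ∑ b, m.h c e * (m.ups Ω W b * m.chr b c e) := by
    intro c
    simp only [upsUp, map_sum, Derivation.leibniz, smul_eq_mul, hm.D_h, Finset.sum_add_distrib,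
      mul_neg, mul_add, Finset.sum_neg_distrib, Finset.mul_sum]
    rw [Finset.sum_comm (f := fun i i_1 => m.ups Ω W i * (m.chr c c i_1 * m.h i_1 i)),
      Finset.sum_comm (f := fun i i_1 => m.ups Ω W i * (m.h c i_1 * m.chr i c i_1))]
    rw [show ∑ y, ∑ x, m.ups Ω W x * (m.chr c c y * m.h y x) =
        ∑ e, ∑ b, m.chr c c e * (m.h e b * m.ups Ω W b) from
        Finset.sum_congr rfl fun _ _ => Finset.sum_congr rfl fun _ _ => by ring,
      show ∑ y, ∑ x, m.ups Ω W x * (m.h c y * m.chr x c y) =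
        ∑ e, ∑ b, m.h c e * (m.ups Ω W b * m.chr b c e) from
        Finset.sum_congr rfl fun _ _ => Finset.sum_congr rfl fun _ _ => by ring]
    ring
  simp only [h1, Finset.sum_sub_distrib, upsLap, upsHess, mul_sub, Finset.mul_sum,
    Finset.sum_mul]
  rw [Finset.sum_comm (f := fun e c => m.chr c c e * m.upsUp Ω W e)]
  ring

/-- For a connection `Γ + S` the curvature splits into that of `Γ`, terms linear in `S` and its
derivative, and terms quadratic in `S`. The claim is the trace of this splitting for the tensor `S`
of a conformal change. -/
theorem IsMetric.ric_conf (hm : m.IsMetric) (hW : Ω * W = 1) (a b : Fin d) :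
    (m.conf Ω W).ric a b = m.ric a b + (2 - d) * m.upsHess Ω W a b - m.g a b * m.upsLap Ω W
      + (d - 2) * (m.ups Ω W a * m.ups Ω W b - m.upsSq Ω W * m.g a b) := by
  set S := m.confDiff Ω W with hS
  set υ := m.ups Ω W with hυ
  set Y := m.upsUp Ω W with hY
  set γ : Fin d → R := fun e => ∑ c, m.chr c c e with hγ
  have hγ' : ∀ e, ∑ c, m.chr c e c = γ e := fun e =>
    Finset.sum_congr rfl fun c _ => hm.chr_symm c e c
  have hexp : ∀ c, (m.conf Ω W).riem c a c b = m.riem c a c b + (m.D c (S a c b) - m.D a (S c c b))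
      + (∑ e, m.chr c c e * S a e b + ∑ e, S c c e * m.chr e a b
        - ∑ e, m.chr c a e * S c e b - ∑ e, S a c e * m.chr e c b)
      + (∑ e, S c c e * S a e b - ∑ e, S a c e * S c e b) := by
    intro c
    simp only [riem, hm.chr_conf hW, ← hS]
    simp only [MetricData.conf, map_add, mul_add, add_mul, Finset.sum_add_distrib,
      Finset.sum_sub_distrib]
    ring
  have hone : ∀ c i j, m.D c ((1 : Matrix (Fin d) (Fin d) R) i j) = 0 := fun c i j =>
    congrFun (congrFun (m.DM_one c) i) j
  have hυY : ∑ e, υ e * Y e = m.upsSq Ω W := rfl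
  -- `A0` and `A1` are the traces of the derivatives of `S`, `A2` to `A5` those of the mixed
  -- products, `A6` and `A7` those of the quadratic terms. The Christoffel symbols then recombine
  -- into covariant derivatives by `hYg` and `hdiv`.
  have A0 : ∑ c, m.D a (S c c b) = d * m.D a (υ b) := by
    rw [← map_sum, hm.trace_confDiff, Derivation.leibniz]
    simp [hυ]
  have A1 : ∑ c, m.D c (S a c b) = m.D b (υ a) + m.D a (υ b) - (∑ c, m.D c (Y c)) * m.g a b
      - ∑ c, Y c * m.D c (m.g a b) := by
    have h1 : ∀ c, m.D c (S a c b) = (1 : Matrix (Fin d) (Fin d) R) c b * m.D c (υ a)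
        + (1 : Matrix (Fin d) (Fin d) R) c a * m.D c (υ b) - m.D c (Y c) * m.g a b
        - Y c * m.D c (m.g a b) := fun c => by
      simp only [hS, confDiff, Matrix.of_apply, map_sub, map_add, Derivation.leibniz, smul_eq_mul,
        hone]
      ring
    rw [Finset.sum_congr rfl fun c _ => h1 c]
    simp [Finset.sum_add_distrib, Matrix.one_apply, Finset.sum_mul]
  have A2 : ∑ c, ∑ e, m.chr c c e * S a e b = υ a * γ b + γ a * υ b
      - (∑ e, γ e * Y e) * m.g a b := by
    rw [Finset.sum_comm]
    simp only [← Finset.sum_mul]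
    exact vecMul_confDiff a b γ
  have A3 : ∑ c, ∑ e, S c c e * m.chr e a b = d * ∑ e, υ e * m.chr e a b := by
    rw [Finset.sum_comm]
    simp only [← Finset.sum_mul, hS, hm.trace_confDiff, Finset.mul_sum, mul_assoc, hυ]
  have A4 : ∑ c, ∑ e, m.chr c a e * S c e b = ∑ e, υ e * m.chr e a b + γ a * υ b
      - ∑ c, Y c * ∑ e, m.chr e c a * m.g e b := by
    have h1 : ∀ c, ∑ e, m.chr c a e * S c e b = υ c * m.chr c a b + m.chr c a c * υ b
      - (∑ e, m.chr c a e * Y e) * m.g c b := fun c => vecMul_confDiff c b _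
    simp only [h1, Finset.sum_sub_distrib, Finset.sum_add_distrib, ← Finset.sum_mul, hγ']
    congr 1
    simp only [Finset.sum_mul, Finset.mul_sum]
    rw [Finset.sum_comm]
    exact Finset.sum_congr rfl fun _ _ => Finset.sum_congr rfl fun _ _ => by
      rw [hm.chr_symm]; ring
  have A5 : ∑ c, ∑ e, S a c e * m.chr e c b = υ a * γ b + ∑ e, υ e * m.chr e a b
      - ∑ c, Y c * ∑ e, m.g a e * m.chr e c b := by
    have h1 : ∀ c, ∑ e, S a c e * m.chr e c b = υ a * m.chr c c b
      + (1 : Matrix (Fin d) (Fin d) R) c a * ∑ e, υ e * m.chr e c b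
      - Y c * ∑ e, m.g a e * m.chr e c b := fun c => confDiff_mulVec a c _
    simp only [h1, Finset.sum_sub_distrib, Finset.sum_add_distrib, ← Finset.mul_sum,
      Matrix.one_apply, ite_mul, one_mul, zero_mul, Finset.sum_ite_eq', Finset.mem_univ, if_true]
    rfl
  have hυS : ∀ c, ∑ e, υ e * S c e b = 2 * (υ c * υ b) - m.upsSq Ω W * m.g c b := fun c => by
    rw [hS, vecMul_confDiff, ← hυ, ← hY, hυY]; ring
  have A6 : ∑ c, ∑ e, S c c e * S a e b = d * (2 * (υ a * υ b) - m.upsSq Ω W * m.g a b) := by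
    rw [Finset.sum_comm]
    simp only [← Finset.sum_mul]
    rw [← hυS a, Finset.mul_sum]
    exact Finset.sum_congr rfl fun e _ => by rw [hS, hm.trace_confDiff, mul_assoc]
  have hgS : ∀ c, ∑ e, m.g a e * S c e b = υ c * m.g a b + m.g a c * υ b - υ a * m.g c b :=
    fun c => by rw [hS, vecMul_confDiff, hm.g_upsUp]
  have A7 : ∑ c, ∑ e, S a c e * S c e b = (d + 2) * (υ a * υ b)
      - 2 * (m.upsSq Ω W * m.g a b) := by
    have h1 : ∀ c, ∑ e, S a c e * S c e b = υ a * S c c b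
      + (1 : Matrix (Fin d) (Fin d) R) c a * (2 * (υ c * υ b) - m.upsSq Ω W * m.g c b)
      - (υ c * Y c * m.g a b + Y c * m.g c a * υ b - υ a * (Y c * m.g c b)) := fun c => by
        have := confDiff_mulVec (m := m) (Ω := Ω) (W := W) a c (fun e => S c e b)
        rw [← hS, ← hυ, ← hY, hυS, hgS] at this
        rw [this, hm.symm_apply a c]; ring
    have hTr : ∑ c, S c c b = d * υ b := hm.trace_confDiff b
    have hYg : ∀ e, ∑ c, Y c * m.g c e = υ e := fun e => hm.upsUp_g e
    rw [Finset.sum_congr rfl fun c _ => h1 c]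
    simp only [Finset.sum_sub_distrib, Finset.sum_add_distrib, ← Finset.mul_sum,
      ← Finset.sum_mul, Matrix.one_apply, ite_mul, one_mul, zero_mul, Finset.sum_ite_eq',
      Finset.mem_univ, if_true, hTr, hYg, hυY]
    ring
  have hYg : ∑ c, Y c * m.D c (m.g a b) = ∑ c, Y c * ∑ e, m.chr e c a * m.g e b
      + ∑ c, Y c * ∑ e, m.g a e * m.chr e c b := by
    rw [← Finset.sum_add_distrib]
    refine Finset.sum_congr rfl fun c _ => ?_
    have := congrFun (congrFun (hm.isLeviCivita_conn.metric c) a) b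
    simp only [DM_apply, Matrix.add_apply, Matrix.mul_apply, Matrix.transpose_apply, conn,
      Matrix.of_apply] at this
    rw [this, mul_add]
  have hdiv : ∑ c, m.D c (Y c) + ∑ e, γ e * Y e = m.upsLap Ω W := hm.div_upsUp
  have hH : m.upsHess Ω W a b = m.D a (υ b) - ∑ e, υ e * m.chr e a b := rfl
  have hsym : m.D b (υ a) = m.D a (υ b) := hm.D_ups hW b a
  rw [ric, Finset.sum_congr rfl fun c _ => hexp c]
  simp only [Finset.sum_add_distrib, Finset.sum_sub_distrib]
  rw [A0, A1, A2, A3, A4, A5, A6, A7, hYg, ← hdiv, hH, hsym, ric]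
  ring

theorem IsMetric.h_g_trace (hm : m.IsMetric) : ∑ a, ∑ b, m.h a b * m.g a b = d := by
  have h1 : ∀ a, ∑ b, m.h a b * m.g a b = (m.h * m.g) a a := fun a => by
    rw [Matrix.mul_apply]
    exact Finset.sum_congr rfl fun b _ => by rw [hm.symm_apply]
  simp [h1, hm.mul']

theorem upsSq_eq : ∑ a, ∑ b, m.h a b * (m.ups Ω W a * m.ups Ω W b) = m.upsSq Ω W := by
  simp only [upsSq, upsUp, Finset.mul_sum]
  exact Finset.sum_congr rfl fun _ _ => Finset.sum_congr rfl fun _ _ => by ring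

/-- Tracing uses `h^{ab} g_{ab} = d`: the coefficients are `(2 - d) - d = -2 (d - 1)` and `(d - 2)
(1 - d)`. -/
theorem IsMetric.scal_conf (hm : m.IsMetric) (hW : Ω * W = 1) :
    (m.conf Ω W).scal = W ^ 2 * (m.scal - 2 * (d - 1) * m.upsLap Ω W
      - (d - 1) * (d - 2) * m.upsSq Ω W) := by
  have h1 : (m.conf Ω W).scal = W ^ 2 * ∑ a, ∑ b, (m.h a b * m.ric a b
      + (2 - d) * (m.h a b * m.upsHess Ω W a b) - m.h a b * m.g a b * m.upsLap Ω W
      + (d - 2) * (m.h a b * (m.ups Ω W a * m.ups Ω W b)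
        - m.upsSq Ω W * (m.h a b * m.g a b))) := by
    simp only [scal, hm.ric_conf hW, Finset.mul_sum]
    refine Finset.sum_congr rfl fun a _ => Finset.sum_congr rfl fun b _ => ?_
    simp only [MetricData.conf, Matrix.smul_apply, smul_eq_mul]
    ring
  rw [h1]
  simp only [Finset.sum_add_distrib, Finset.sum_sub_distrib, ← Finset.mul_sum, ← Finset.sum_mul,
    upsSq_eq, hm.h_g_trace]
  rw [← scal, ← upsLap]
  ring

/-- `⟨υ, df⟩`. -/
def upsInn (m : MetricData d R) (Ω W f : R) : R := ∑ a, ∑ b, m.h a b * (m.ups Ω W a * m.D b f)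

theorem IsMetric.upsInn_symm (hm : m.IsMetric) (f : R) :
    ∑ a, ∑ b, m.h a b * (m.D a f * m.ups Ω W b) = m.upsInn Ω W f := by
  rw [Finset.sum_comm]
  exact Finset.sum_congr rfl fun _ _ => Finset.sum_congr rfl fun _ _ => by
    rw [hm.h_symm_apply]; ring

/-- The difference tensor contributes twice `-⟨υ, df⟩` and, through the trace of `g`, once `d ⟨υ,
df⟩`. -/
theorem IsMetric.lap_conf (hm : m.IsMetric) (hW : Ω * W = 1) (f : R) :
    (m.conf Ω W).lap f = W ^ 2 * (m.lap f + (d - 2) * m.upsInn Ω W f) := by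
  have h0 : ∀ a b, ∑ c, m.confDiff Ω W a c b * m.D c f = m.ups Ω W a * m.D b f +
      m.D a f * m.ups Ω W b - m.g a b * ∑ c, m.D c f * m.upsUp Ω W c := by
    intro a b
    have := vecMul_confDiff (m := m) (Ω := Ω) (W := W) a b (fun c => m.D c f)
    rw [mul_comm (m.g a b), ← this]
    exact Finset.sum_congr rfl fun _ _ => mul_comm _ _
  have h2 : ∑ c, m.D c f * m.upsUp Ω W c = m.upsInn Ω W f := by
    rw [← hm.upsInn_symm]
    simp only [upsUp, Finset.mul_sum]
    exact Finset.sum_congr rfl fun _ _ => Finset.sum_congr rfl fun _ _ => by ring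
  have h1 : (m.conf Ω W).lap f = W ^ 2 * ∑ a, ∑ b, (m.h a b * m.hess f a b
      - m.h a b * (m.ups Ω W a * m.D b f) - m.h a b * (m.D a f * m.ups Ω W b)
      + m.h a b * m.g a b * m.upsInn Ω W f) := by
    have h3 : ∀ a b, (m.conf Ω W).hess f a b = m.hess f a b - (m.ups Ω W a * m.D b f +
        m.D a f * m.ups Ω W b - m.g a b * m.upsInn Ω W f) := by
      intro a b
      rw [← h2, ← h0, hess, hess]
      simp only [hm.chr_conf hW, add_mul, Finset.sum_add_distrib]
      rw [← sub_sub]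
      rfl
    simp only [lap, h3, Finset.mul_sum]
    refine Finset.sum_congr rfl fun a _ => Finset.sum_congr rfl fun b _ => ?_
    simp only [MetricData.conf, Matrix.smul_apply, smul_eq_mul]
    ring
  rw [h1]
  simp only [Finset.sum_add_distrib, Finset.sum_sub_distrib, ← Finset.sum_mul, hm.upsInn_symm,
    hm.h_g_trace]
  rw [← lap, ← upsInn]
  ring

/-- This is the product rule, with the Hessian of `Ω` written as `Ω` times the Hessian of `log Ω`
plus `υ ⊗ υ`. -/
theorem IsMetric.lap_mul (hm : m.IsMetric) (hW : Ω * W = 1) (f : R) : m.lap (Ω * f) =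
    Ω * (m.lap f + 2 * m.upsInn Ω W f + f * (m.upsLap Ω W + m.upsSq Ω W)) := by
  have h1 : ∀ a b, m.hess (Ω * f) a b = Ω * (m.hess f a b + m.ups Ω W a * m.D b f
      + m.D a f * m.ups Ω W b + f * (m.upsHess Ω W a b + m.ups Ω W a * m.ups Ω W b)) := by
    intro a b
    have h2 : ∑ c, m.chr c a b * m.D c (Ω * f) = Ω * ∑ c, m.chr c a b * m.D c f
        + Ω * f * ∑ c, m.ups Ω W c * m.chr c a b := by
      simp only [Derivation.leibniz, smul_eq_mul, D_eq_ups hW, Finset.mul_sum,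
        ← Finset.sum_add_distrib]
      exact Finset.sum_congr rfl fun _ _ => by ring
    rw [hess, h2, hess, upsHess]
    simp only [Derivation.leibniz, smul_eq_mul, D_eq_ups hW, map_add]
    ring
  have h3 : m.lap (Ω * f) = Ω * ∑ a, ∑ b, (m.h a b * m.hess f a b
      + m.h a b * (m.ups Ω W a * m.D b f) + m.h a b * (m.D a f * m.ups Ω W b)
      + f * (m.h a b * m.upsHess Ω W a b + m.h a b * (m.ups Ω W a * m.ups Ω W b))) := by
    simp only [lap, h1, Finset.mul_sum]
    exact Finset.sum_congr rfl fun _ _ => Finset.sum_congr rfl fun _ _ => by ring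
  rw [h3]
  simp only [Finset.sum_add_distrib, ← Finset.mul_sum, hm.upsInn_symm, upsSq_eq]
  rw [← lap, ← upsInn, ← upsLap]
  ring

theorem IsMetric.inn_conf (hm : m.IsMetric) (hW : Ω * W = 1) (f : R) :
    (m.conf Ω W).inn (Ω * f) (Ω * f) =
      m.inn f f + 2 * f * m.upsInn Ω W f + f ^ 2 * m.upsSq Ω W := by
  have h1 : (m.conf Ω W).inn (Ω * f) (Ω * f) = (Ω * W) ^ 2 * ∑ a, ∑ b,
      (m.h a b * m.D a f * m.D b f + f * (m.h a b * (m.ups Ω W a * m.D b f))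
        + f * (m.h a b * (m.D a f * m.ups Ω W b))
        + f ^ 2 * (m.h a b * (m.ups Ω W a * m.ups Ω W b))) := by
    simp only [inn, Finset.mul_sum]
    refine Finset.sum_congr rfl fun _ _ => Finset.sum_congr rfl fun _ _ => ?_
    simp only [MetricData.conf, Matrix.smul_apply, smul_eq_mul, Derivation.leibniz, D_eq_ups hW]
    ring
  rw [h1, hW]
  simp only [Finset.sum_add_distrib, ← Finset.mul_sum, hm.upsInn_symm, upsSq_eq]
  rw [← inn, ← upsInn]
  ring

/-- The squared length of the scale tractor is conformally invariant. -/
theorem IsMetric.tsq_conf (hm : m.IsMetric) (hW : Ω * W = 1) (hd : 2 ≤ d) (f : R) :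
    (m.conf Ω W).tsq (Ω * f) = m.tsq f := by
  have hd0 : (d : ℝ) ≠ 0 := by positivity
  have hd1 : (d : ℝ) - 1 ≠ 0 := by
    have : (2 : ℝ) ≤ d := by exact_mod_cast hd
    linarith
  have hc : ∀ n : ℕ, (n : R) = algebraMap ℝ R n := fun n => (map_natCast _ n).symm
  have h2 : (2 : R) = algebraMap ℝ R 2 := (map_ofNat _ 2).symm
  have hJ : (m.conf Ω W).schouten = W ^ 2 * (m.schouten - m.upsLap Ω W
      - (((d : ℝ) - 2) / 2) • m.upsSq Ω W) := by
    have e1 : ∀ x : R, 2 * ((d : R) - 1) * x = (2 * ((d : ℝ) - 1)) • x := fun x => by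
      rw [Algebra.smul_def, map_mul, map_sub, map_one, ← h2, ← hc]
    have e2 : ∀ x : R, ((d : R) - 1) * ((d : R) - 2) * x = (((d : ℝ) - 1) * ((d : ℝ) - 2)) • x :=
      fun x => by rw [Algebra.smul_def, map_mul, map_sub, map_sub, map_one, ← h2, ← hc]
    rw [schouten, hm.scal_conf hW, e1, e2, schouten, ← mul_smul_comm, smul_sub, smul_sub, smul_smul,
      smul_smul, inv_mul_cancel₀ (by positivity), one_smul]
    congr 3
    field_simp
  have e3 : ((d : R) - 2) = algebraMap ℝ R ((d : ℝ) - 2) := by rw [map_sub, ← h2, ← hc]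
  rw [tsq, hm.inn_conf hW, hm.lap_conf hW, hm.lap_mul hW, hJ, tsq]
  have h5 : m.upsInn Ω W (Ω * f) = Ω * (m.upsInn Ω W f + f * m.upsSq Ω W) := by
    rw [← upsSq_eq]
    simp only [upsInn, Finset.mul_sum, ← Finset.sum_add_distrib]
    refine Finset.sum_congr rfl fun _ _ => Finset.sum_congr rfl fun _ _ => ?_
    simp only [Derivation.leibniz, smul_eq_mul, D_eq_ups hW]
    ring
  -- The Laplacian of `log Ω` from the product rule cancels against the one from the Schouten trace.
  -- The coefficient of `f |υ|²` is `1 + (d - 2) - (d - 2) / 2 = d / 2`.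
  have h6 : W ^ 2 * (Ω * (m.lap f + 2 * m.upsInn Ω W f + f * (m.upsLap Ω W + m.upsSq Ω W))
        + (d - 2) * m.upsInn Ω W (Ω * f))
      + W ^ 2 * (m.schouten - m.upsLap Ω W - (((d : ℝ) - 2) / 2) • m.upsSq Ω W) * (Ω * f)
      = W * (m.lap f + m.schouten * f + (d : ℝ) • m.upsInn Ω W f
        + ((d : ℝ) / 2) • (f * m.upsSq Ω W)) := by
    have e4 : ((d : ℝ) / 2) • (f * m.upsSq Ω W) =
        ((d : ℝ) - 2) • (f * m.upsSq Ω W) + f * m.upsSq Ω W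
          - (((d : ℝ) - 2) / 2) • (f * m.upsSq Ω W) := by
      module
    have e5 : (d : ℝ) • m.upsInn Ω W f = ((d : ℝ) - 2) • m.upsInn Ω W f + 2 * m.upsInn Ω W f := by
      rw [h2, ← Algebra.smul_def]; module
    rw [h5, e4, e5]
    simp only [e3, Algebra.smul_def]
    linear_combination (W * (m.lap f + 2 * m.upsInn Ω W f + f * (m.upsLap Ω W + m.upsSq Ω W)
      + algebraMap ℝ R ((d : ℝ) - 2) * (m.upsInn Ω W f + f * m.upsSq Ω W)
      + (m.schouten - m.upsLap Ω W - algebraMap ℝ R (((d : ℝ) - 2) / 2) * m.upsSq Ω W) * f)) * hW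
  rw [h6]
  -- The factor `-1 / d` turns the two extra terms into exactly the negatives of the extra terms of
  -- `inn_conf`.
  have e6 : 2 * (Ω * f) * (-(1 / (d : ℝ)) • (W * (m.lap f + m.schouten * f
      + (d : ℝ) • m.upsInn Ω W f + ((d : ℝ) / 2) • (f * m.upsSq Ω W)))) =
      2 * f * (-(1 / (d : ℝ)) • (m.lap f + m.schouten * f)) - 2 * f * m.upsInn Ω W f
        - f ^ 2 * m.upsSq Ω W := by
    have e7 : -(1 / (d : ℝ)) • (W * (m.lap f + m.schouten * f
      + (d : ℝ) • m.upsInn Ω W f + ((d : ℝ) / 2) • (f * m.upsSq Ω W))) =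
      W * (-(1 / (d : ℝ)) • (m.lap f + m.schouten * f) - m.upsInn Ω W f
        - (1 / 2 : ℝ) • (f * m.upsSq Ω W)) := by
      rw [← mul_smul_comm]
      congr 1
      simp only [smul_add, smul_smul]
      rw [show -(1 / (d : ℝ)) * d = -1 by field_simp, show -(1 / (d : ℝ)) * (d / 2) = -(1 / 2) by
        field_simp]
      module
    have e8 : 2 * ((1 / 2 : ℝ) • (f * m.upsSq Ω W)) = f * m.upsSq Ω W := by
      rw [h2, ← Algebra.smul_def, smul_smul]; norm_num
    rw [e7]
    set X := -(1 / (d : ℝ)) • (m.lap f + m.schouten * f)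
    linear_combination (2 * f * (X - m.upsInn Ω W f
        - (1 / 2 : ℝ) • (f * m.upsSq Ω W))) * hW - f * e8
  rw [e6]
  ring

end Conformal

end MetricData

/-! ### Orders of vanishing -/

section Order

variable {R : Type*} [CommRing R] [Algebra ℝ R] (I : Ideal R) (T : Derivation ℝ R R)

/-- The elements that vanish to order `k` with respect to the ideal `I` and the transverse
derivation `T`. -/
def Ord : ℕ → Set R
  | 0 => Set.univ
  | k + 1 => {f | f ∈ I ∧ T f ∈ Ord k}

variable {I T}

theorem mem_ord_one {f : R} : f ∈ Ord I T 1 ↔ f ∈ I := by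
  simp [Ord]

theorem ord_succ_subset (k : ℕ) {f : R} (hf : f ∈ Ord I T (k + 1)) : f ∈ Ord I T k := by
  induction k generalizing f with
  | zero => trivial
  | succ k ih => exact ⟨hf.1, ih hf.2⟩

theorem ord_anti {k l : ℕ} (h : k ≤ l) {f : R} (hf : f ∈ Ord I T l) : f ∈ Ord I T k := by
  induction l, h using Nat.le_induction with
  | base => exact hf
  | succ l _ ih => exact ih (ord_succ_subset l hf)

theorem ord_add {k : ℕ} {f g : R} (hf : f ∈ Ord I T k) (hg : g ∈ Ord I T k) :
    f + g ∈ Ord I T k := by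
  induction k generalizing f g with
  | zero => trivial
  | succ k ih => exact ⟨I.add_mem hf.1 hg.1, by rw [map_add]; exact ih hf.2 hg.2⟩

theorem ord_mul_left {k : ℕ} (r : R) {f : R} (hf : f ∈ Ord I T k) : r * f ∈ Ord I T k := by
  induction k generalizing r f with
  | zero => trivial
  | succ k ih =>
    refine ⟨I.mul_mem_left r hf.1, ?_⟩
    rw [Derivation.leibniz, smul_eq_mul, smul_eq_mul, mul_comm f]
    exact ord_add (ih r hf.2) (ih _ (ord_succ_subset k hf))

theorem ord_zero_mem (k : ℕ) : (0 : R) ∈ Ord I T k := by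
  induction k with
  | zero => trivial
  | succ k ih => exact ⟨I.zero_mem, by rwa [map_zero]⟩

theorem ord_neg {k : ℕ} {f : R} (hf : f ∈ Ord I T k) : -f ∈ Ord I T k := by
  simpa using ord_mul_left (-1) hf

theorem ord_sub {k : ℕ} {f g : R} (hf : f ∈ Ord I T k) (hg : g ∈ Ord I T k) :
    f - g ∈ Ord I T k := by
  rw [sub_eq_add_neg]; exact ord_add hf (ord_neg hg)

theorem ord_smul {k : ℕ} (c : ℝ) {f : R} (hf : f ∈ Ord I T k) : c • f ∈ Ord I T k := by
  rw [Algebra.smul_def]; exact ord_mul_left _ hf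

theorem ord_sum {ι : Type*} {k : ℕ} (t : Finset ι) {f : ι → R} (hf : ∀ i ∈ t, f i ∈ Ord I T k) :
    ∑ i ∈ t, f i ∈ Ord I T k := by
  classical
  induction t using Finset.induction_on with
  | empty => simpa using ord_zero_mem k
  | insert i t hi ih =>
    rw [Finset.sum_insert hi]
    exact ord_add (hf i (Finset.mem_insert_self i t))
      (ih fun j hj => hf j (Finset.mem_insert_of_mem hj))

/-- By the Leibniz rule, each term of `T (f g)` has one factor whose order has dropped by one, so
the sum of the orders drops by one. -/
theorem ord_mul {k l : ℕ} {f g : R} (hf : f ∈ Ord I T k) (hg : g ∈ Ord I T l) :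
    f * g ∈ Ord I T (k + l) := by
  induction hn : k + l generalizing k l f g with
  | zero => trivial
  | succ n ih =>
    cases k with
    | zero => rw [← hn, zero_add]; exact ord_mul_left f hg
    | succ k =>
      cases l with
      | zero => rw [← hn, add_zero, mul_comm]; exact ord_mul_left g hf
      | succ l =>
        refine ⟨I.mul_mem_right g hf.1, ?_⟩
        rw [Derivation.leibniz, smul_eq_mul, smul_eq_mul]
        exact ord_add (ih hf hg.2 (by omega)) (ih hg hf.2 (by omega))

theorem ord_mul' {k l n : ℕ} {f g : R} (hf : f ∈ Ord I T k) (hg : g ∈ Ord I T l)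
    (h : n ≤ k + l) : f * g ∈ Ord I T n := ord_anti h (ord_mul hf hg)

theorem ord_pow {f : R} (hf : f ∈ I) (k : ℕ) : f ^ k ∈ Ord I T k := by
  induction k with
  | zero => trivial
  | succ k ih => rw [pow_succ]; exact ord_mul ih (mem_ord_one.2 hf)

/-- Euler's relation: if `T s = 1`, then `s T f = k f` up to higher order. -/
theorem ord_euler {s : R} (hs : s ∈ I) (hT : T s = 1) {k : ℕ} {f : R} (hf : f ∈ Ord I T k) :
    s * T f - k * f ∈ Ord I T (k + 1) := by
  induction k generalizing f with
  | zero =>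
    simpa using mem_ord_one.2 (I.mul_mem_right (T f) hs)
  | succ k ih =>
    refine ⟨I.sub_mem (I.mul_mem_right _ hs) (I.mul_mem_left _ hf.1), ?_⟩
    have : T (s * T f - (k + 1 : ℕ) * f) = s * T (T f) - k * T f := by
      rw [map_sub, Derivation.leibniz, Derivation.leibniz, hT, Derivation.map_natCast]
      simp only [smul_eq_mul]; push_cast; ring
    rw [this]
    exact ih hf.2

end Order

/-! ### Transverse derivation and solution of `I² = 1` along a hypersurface -/

namespace MetricData

variable {d : ℕ} {R : Type*} [CommRing R] [Algebra ℝ R] (m : MetricData d R)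

/-- The components of the transverse vector field `N² g^{ab} ∂_b s`. -/
def tvec (s N : R) (b : Fin d) : R := N ^ 2 * ∑ a, m.h a b * m.D a s

/-- The transverse derivation `f ↦ N² ⟨ds, df⟩`. -/
def tder (s N : R) : Derivation ℝ R R := ∑ b, m.tvec s N b • m.D b

theorem tder_apply (s N f : R) : m.tder s N f = ∑ b, m.tvec s N b * m.D b f := by
  have h1 := congrFun (map_sum (Derivation.coeFnAddMonoidHom (R := ℝ) (A := R) (M := R))
    (fun b => m.tvec s N b • m.D b) Finset.univ) f
  rw [Finset.sum_apply] at h1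
  exact h1

theorem tder_eq_inn (s N f : R) : m.tder s N f = N ^ 2 * m.inn s f := by
  simp only [tder_apply, tvec, inn, Finset.sum_mul, Finset.mul_sum]
  rw [Finset.sum_comm]
  exact Finset.sum_congr rfl fun _ _ => Finset.sum_congr rfl fun _ _ => by ring

/-- The ideal `I` behaves like the ideal of functions that vanish on the hypersurface defined by
`s`, and `N = |ds|⁻¹`. -/
structure IsHypersurface (m : MetricData d R) (I : Ideal R) (s N : R) : Prop where
  metric : m.IsMetric
  mem : s ∈ I
  norm : N ^ 2 * m.inn s s = 1
  conormal : ∀ v ∈ I, ∀ a, m.D a v - m.D a s * m.tder s N v ∈ I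

variable {m} {I : Ideal R} {s N : R} (H : m.IsHypersurface I s N)

include H

theorem IsHypersurface.tder_self : m.tder s N s = 1 := by rw [tder_eq_inn, H.norm]

theorem IsHypersurface.inn_eq (f : R) : m.inn s f = m.inn s s * m.tder s N f := by
  rw [tder_eq_inn]; linear_combination (-m.inn s f) * H.norm

theorem IsHypersurface.inn_comm (f f' : R) : m.inn f f' = m.inn f' f := by
  simp only [inn]
  rw [Finset.sum_comm]
  exact Finset.sum_congr rfl fun _ _ => Finset.sum_congr rfl fun _ _ => by
    rw [H.metric.h_symm_apply]; ring

/-- The `D b` commute, so the commutator with `T` only sees the coefficients of `T`. -/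
theorem IsHypersurface.D_tder (a : Fin d) (f : R) :
    m.D a (m.tder s N f) = m.tder s N (m.D a f) + ∑ b, m.D a (m.tvec s N b) * m.D b f := by
  simp only [tder_apply, map_sum, Derivation.leibniz, smul_eq_mul, Finset.sum_add_distrib,
    H.metric.comm a]
  congr 1
  exact Finset.sum_congr rfl fun _ _ => mul_comm _ _

theorem IsHypersurface.D_tvec (a : Fin d) :
    ∑ b, m.D a (m.tvec s N b) * m.D b s = -m.tder s N (m.D a s) := by
  have := H.D_tder a s
  rw [H.tder_self, Derivation.map_one_eq_zero] at this
  linear_combination -this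

/-- Modulo `I`, any derivative of an element of `I` is a multiple of its transverse derivative, so a
derivative lowers the order by at most one. The commutator with `T` is again a combination of the `D
b`. -/
theorem IsHypersurface.D_mem {k : ℕ} {f : R} (hf : f ∈ Ord I (m.tder s N) (k + 1)) (a : Fin d) :
    m.D a f ∈ Ord I (m.tder s N) k := by
  induction k generalizing f a with
  | zero => trivial
  | succ k ih =>
    constructor
    · have h1 := H.conormal f hf.1 a
      have h2 := I.mul_mem_left (m.D a s) hf.2.1
      simpa using I.add_mem h1 h2
    · have h1 := H.D_tder a f
      rw [← sub_eq_iff_eq_add] at h1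
      rw [← h1]
      exact ord_sub (ih hf.2 a)
        (ord_sum _ fun b _ => ord_mul_left _ (ih (ord_succ_subset _ hf) b))

/-- The derivation `D a - (D a s) T` is tangential, so it does not lower the order. Its commutator
with `T` is a combination of such tangential derivations, because `D_tvec` supplies the missing
`T`-terms. -/
theorem IsHypersurface.D_sub_mem {k : ℕ} {f : R} (hf : f ∈ Ord I (m.tder s N) (k + 1))
    (a : Fin d) : m.D a f - m.D a s * m.tder s N f ∈ Ord I (m.tder s N) (k + 1) := by
  induction k generalizing f a with
  | zero => exact mem_ord_one.2 (H.conormal f hf.1 a)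
  | succ k ih =>
    refine ⟨H.conormal f hf.1 a, ?_⟩
    have h1 : m.tder s N (m.D a f - m.D a s * m.tder s N f) =
        (m.D a (m.tder s N f) - m.D a s * m.tder s N (m.tder s N f))
        - ∑ b, m.D a (m.tvec s N b) * (m.D b f - m.D b s * m.tder s N f) := by
      have e1 : ∑ b, m.D a (m.tvec s N b) * (m.D b f - m.D b s * m.tder s N f) =
          ∑ b, m.D a (m.tvec s N b) * m.D b f
          - (∑ b, m.D a (m.tvec s N b) * m.D b s) * m.tder s N f := by
        rw [Finset.sum_mul, ← Finset.sum_sub_distrib]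
        exact Finset.sum_congr rfl fun _ _ => by ring
      rw [e1, H.D_tvec, H.D_tder, map_sub, Derivation.leibniz]
      simp only [smul_eq_mul]
      ring
    rw [h1]
    exact ord_sub (ih hf.2 a) (ord_sum _ fun b _ => ord_mul_left _ (ih (ord_succ_subset _ hf) b))

/-- The order of vanishing does not depend on the choice of the defining function. -/
theorem IsHypersurface.ord_subset {m' : MetricData d R} (hD : m'.D = m.D) (s' N' : R) {k : ℕ}
    {f : R} (hf : f ∈ Ord I (m.tder s N) k) : f ∈ Ord I (m'.tder s' N') k := by
  induction k generalizing f with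
  | zero => trivial
  | succ k ih =>
    refine ⟨hf.1, ih ?_⟩
    rw [tder_apply]
    refine ord_sum _ fun b _ => ord_mul_left _ ?_
    rw [hD]
    exact H.D_mem hf b

theorem IsHypersurface.inn_self {f : R} (hf : f ∈ I) :
    m.inn f f - m.inn s s * m.tder s N f ^ 2 ∈ I := by
  have h1 : m.inn f f - m.inn s s * m.tder s N f ^ 2 =
      ∑ a, ∑ b, m.h a b * m.D b f * (m.D a f - m.D a s * m.tder s N f) := by
    have h2 : m.inn s s * m.tder s N f ^ 2 = m.inn s f * m.tder s N f := by
      rw [H.inn_eq f]; ring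
    rw [h2]
    simp only [inn, Finset.sum_mul, ← Finset.sum_sub_distrib]
    exact Finset.sum_congr rfl fun _ _ => Finset.sum_congr rfl fun _ _ => by ring
  rw [h1]
  exact I.sum_mem fun a _ => I.sum_mem fun b _ => I.mul_mem_left _ (H.conormal f hf a)

/-- Where `f` vanishes, `I²` reduces to `|df|²`, and `df` is conormal there. -/
theorem IsHypersurface.tsq_sub {f : R} (hf : f ∈ I) :
    m.tsq f - m.inn s s * m.tder s N f ^ 2 ∈ I := by
  have := I.add_mem (H.inn_self hf) (I.mul_mem_right
    (2 * (-(1 / (d : ℝ)) • (m.lap f + m.schouten * f))) hf)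
  rw [tsq]
  convert this using 1
  ring

/-- Only two transverse derivatives lower the order of `u` by two. Tangential derivatives do not
lower it, and the remaining terms contain at most one transverse derivative. -/
theorem IsHypersurface.lap_sub {j : ℕ} {u : R} (hu : u ∈ Ord I (m.tder s N) (j + 2)) :
    m.lap u - m.inn s s * m.tder s N (m.tder s N u) ∈ Ord I (m.tder s N) (j + 1) := by
  set T := m.tder s N
  have h1 : m.lap u - m.inn s s * T (T u) =
      ∑ a, ∑ b, m.h a b * (m.D a (m.D b u - m.D b s * T u) + m.D a (m.D b s) * T u
        + m.D b s * (m.D a (T u) - m.D a s * T (T u)) - ∑ c, m.chr c a b * m.D c u) := by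
    simp only [lap, hess, inn, Finset.sum_mul, ← Finset.sum_sub_distrib]
    refine Finset.sum_congr rfl fun _ _ => Finset.sum_congr rfl fun _ _ => ?_
    rw [map_sub, Derivation.leibniz]
    simp only [smul_eq_mul]
    ring
  rw [h1]
  refine ord_sum _ fun a _ => ord_sum _ fun b _ => ord_mul_left _ ?_
  refine ord_sub (ord_add (ord_add ?_ ?_) ?_) ?_
  · exact H.D_mem (H.D_sub_mem hu b) a
  · exact ord_mul_left _ hu.2
  · exact ord_mul_left _ (H.D_sub_mem hu.2 a)
  · exact ord_sum _ fun c _ => ord_mul_left _ (H.D_mem hu c)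

/-- The effect on `I²` of a perturbation that vanishes to order `j + 2`. -/
theorem IsHypersurface.tsq_add {j : ℕ} {f u : R} (hf : f ∈ I)
    (hu : u ∈ Ord I (m.tder s N) (j + 2)) :
    m.tsq (f + u) - m.tsq f - (2 * (1 - (j + 1) / (d : ℝ))) •
      (m.tder s N f * m.inn s s * m.tder s N u) ∈ Ord I (m.tder s N) (j + 2) := by
  set T := m.tder s N with hT
  set c : ℝ := -(1 / (d : ℝ)) with hc
  have hDu : ∀ a, m.D a u ∈ Ord I T (j + 1) := fun a => H.D_mem hu a
  have hinn : m.inn f u - T f * m.inn s s * T u ∈ Ord I T (j + 2) := by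
    have h1 : m.inn f u - T f * m.inn s s * T u =
        ∑ a, ∑ b, m.h a b * m.D a f * (m.D b u - m.D b s * T u) := by
      rw [show T f * m.inn s s * T u = m.inn f s * T u by
        rw [H.inn_comm f s, H.inn_eq f]; ring]
      simp only [inn, Finset.sum_mul, ← Finset.sum_sub_distrib]
      exact Finset.sum_congr rfl fun _ _ => Finset.sum_congr rfl fun _ _ => by ring
    rw [h1]
    exact ord_sum _ fun a _ => ord_sum _ fun b _ => ord_mul_left _ (H.D_sub_mem hu b)
  have hinn2 : m.inn u u ∈ Ord I T (j + 2) := by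
    refine ord_sum _ fun a _ => ord_sum _ fun b _ => ?_
    rw [mul_assoc]
    exact ord_mul_left _ (ord_mul' (hDu a) (hDu b) (by omega))
  have hf1 : f ∈ Ord I T 1 := mem_ord_one.2 hf
  have hs1 : s ∈ Ord I T 1 := mem_ord_one.2 H.mem
  -- To leading order `f` is `s T f` and `Δ u` is `|ds|² T (T u)`. Euler's relation for `T u`, which
  -- has order `j + 1`, turns `s T (T u)` into `(j + 1) T u`. This is the source of the fraction `(j
  -- + 1) / d`.
  have hlap : f * m.lap u - (j + 1 : ℕ) * (T f * m.inn s s * T u) ∈ Ord I T (j + 2) := by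
    have e1 : f * (m.lap u - m.inn s s * T (T u)) ∈ Ord I T (j + 2) :=
      ord_mul' hf1 (H.lap_sub hu) (by omega)
    have e2 : f - s * T f ∈ Ord I T 2 := by
      have := ord_euler H.mem H.tder_self hf1
      have h2 := ord_neg this
      convert h2 using 1
      simp [T]
    have e3 : (f - s * T f) * (m.inn s s * T (T u)) ∈ Ord I T (j + 2) :=
      ord_mul' e2 (ord_mul_left _ hu.2.2) (by omega)
    have e4 : T f * m.inn s s * (s * T (T u) - (j + 1 : ℕ) * T u) ∈ Ord I T (j + 2) :=
      ord_mul_left _ (ord_euler H.mem H.tder_self hu.2)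
    convert ord_add (ord_add e1 e3) e4 using 1
    ring
  have hfu : f * (m.schouten * u) ∈ Ord I T (j + 2) := ord_mul_left _ (ord_mul_left _ hu)
  have hlin : m.lap (f + u) = m.lap f + m.lap u := by
    simp only [lap, hess, map_add, ← Finset.sum_add_distrib]
    refine Finset.sum_congr rfl fun _ _ => Finset.sum_congr rfl fun _ _ => ?_
    simp only [mul_add, Finset.sum_add_distrib]
    ring
  have hinn3 : m.inn (f + u) (f + u) = m.inn f f + 2 * m.inn f u + m.inn u u := by
    have : m.inn (f + u) (f + u) = m.inn f f + m.inn f u + (m.inn u f + m.inn u u) := by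
      simp only [inn, map_add, ← Finset.sum_add_distrib]
      exact Finset.sum_congr rfl fun _ _ => Finset.sum_congr rfl fun _ _ => by ring
    rw [this, H.inn_comm u f]; ring
  have hX : (2 * (1 - (j + 1) / (d : ℝ))) • (T f * m.inn s s * T u) =
      2 * (T f * m.inn s s * T u)
        + (2 * c) • (((j + 1 : ℕ) : R) * (T f * m.inn s s * T u)) := by
    have h2 : (2 : R) = algebraMap ℝ R 2 := (map_ofNat _ 2).symm
    have h3 : ((j + 1 : ℕ) : R) = algebraMap ℝ R ((j : ℝ) + 1) := by
      rw [map_add, map_natCast, map_one]; push_cast; rfl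
    rw [h2, h3, ← Algebra.smul_def, ← Algebra.smul_def, smul_smul, ← add_smul]
    congr 1
    rw [hc]; ring
  have h2c : ∀ x : R, (2 * c) • x = 2 * (c • x) := fun x => by
    have h2 : (2 : R) = algebraMap ℝ R 2 := (map_ofNat _ 2).symm
    rw [h2, ← Algebra.smul_def, smul_smul]
  have key : m.tsq (f + u) - m.tsq f - (2 * (1 - (j + 1) / (d : ℝ))) • (T f * m.inn s s * T u) =
      2 * (m.inn f u - T f * m.inn s s * T u) + m.inn u u
      + (2 * c) • (f * m.lap u - (j + 1 : ℕ) * (T f * m.inn s s * T u))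
      + (2 * c) • (f * (m.schouten * u))
      + (2 * c) • ((m.lap f + m.schouten * f + m.lap u + m.schouten * u) * u) := by
    rw [hX]
    simp only [tsq, hlin, hinn3, h2c, ← hc]
    simp only [Algebra.smul_def]
    ring
  rw [key]
  exact ord_add (ord_add (ord_add (ord_add (ord_mul_left _ hinn) hinn2) (ord_smul _ hlap))
    (ord_smul _ hfu)) (ord_smul _ (ord_mul_left _ hu))

/-- Each correction is chosen so that the change of `I²` computed in `tsq_add` cancels the current
error to leading order. The condition `T f ≡ N` modulo `I` fixes the orientation and persists, since
corrections have order at least two. The bound `k < d` keeps all denominators `d - (k + 1)` of the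
corrections nonzero. -/
theorem IsHypersurface.approx_spec (k : ℕ) (hk : k < d) :
    m.approx s N k ∈ I ∧ m.tder s N (m.approx s N k) - N ∈ I ∧
      m.tsq (m.approx s N k) - 1 ∈ Ord I (m.tder s N) (k + 1) := by
  set T := m.tder s N with hT
  induction k with
  | zero =>
    have h1 : s * N ∈ I := I.mul_mem_right N H.mem
    have h2 : T (s * N) - N ∈ I := by
      rw [Derivation.leibniz, H.tder_self]
      simp only [smul_eq_mul, mul_one, add_sub_cancel_right]
      exact I.mul_mem_right _ H.mem
    refine ⟨h1, h2, mem_ord_one.2 ?_⟩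
    have h3 := H.tsq_sub h1
    have h4 := I.mul_mem_left (m.inn s s * (T (s * N) + N)) h2
    convert I.add_mem h3 h4 using 1
    simp only [approx]
    linear_combination H.norm
  | succ k ih =>
    obtain ⟨h1, h2, h3⟩ := ih (by omega)
    set f := m.approx s N k with hf
    set e := m.tsq f - 1 with he
    set c : ℝ := (d : ℝ) / (2 * ((d : ℝ) - (k + 1)) * (k + 2)) with hc
    set u := -(c • (N * s * e)) with hu
    have hstep : m.approx s N (k + 1) = f + u := by
      rw [approx, ← hf, ← he, ← hc, hu, sub_eq_add_neg]
    have hs1 : s ∈ Ord I T 1 := mem_ord_one.2 H.mem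
    have hu2 : u ∈ Ord I T (k + 2) := by
      refine ord_neg (ord_smul _ ?_)
      rw [mul_assoc]
      exact ord_mul_left _ (ord_mul' hs1 h3 (by omega))
    refine ⟨?_, ?_, ?_⟩
    · rw [hstep]; exact I.add_mem h1 hu2.1
    · rw [hstep, map_add, add_sub_right_comm]
      exact I.add_mem h2 hu2.2.1
    · rw [hstep]
      -- The error `e` has order `k + 1`, so Euler's relation gives `T (N s e) ≈ N e + (k + 1) N e`.
      have hTu : T u + ((k + 2 : ℕ) : R) * (c • (N * e)) ∈ Ord I T (k + 2) := by
        have e1 := ord_euler H.mem H.tder_self h3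
        have e2 : s * e * T N ∈ Ord I T (k + 2) := by
          rw [mul_comm]; exact ord_mul_left _ (ord_mul' hs1 h3 (by omega))
        have e3 := ord_smul (-c) (ord_add (ord_mul_left N e1) e2)
        convert e3 using 1
        have e4 : T (N * s * e) = N * e + N * (s * T e) + s * e * T N := by
          simp only [Derivation.leibniz, smul_eq_mul]
          rw [H.tder_self]; ring
        rw [hu, map_neg, Derivation.map_smul, e4]
        simp only [Algebra.smul_def, map_neg]
        push_cast
        ring
      have hnorm : T f * m.inn s s * N - 1 ∈ Ord I T 1 := by
        refine mem_ord_one.2 ?_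
        convert I.mul_mem_left (m.inn s s * N) h2 using 1
        linear_combination H.norm
      have h5 := H.tsq_add h1 hu2
      have h6 := ord_smul (2 * (1 - (k + 1) / (d : ℝ)))
        (ord_mul_left (T f * m.inn s s) hTu)
      have h7 : (T f * m.inn s s * N - 1) * e ∈ Ord I T (k + 2) :=
        ord_mul' hnorm h3 (by omega)
      convert ord_sub (ord_add h5 h6) h7 using 1
      -- This determines the constant in `approx`: the factor from `tsq_add` times the Euler factor
      -- `k + 2` times the constant must be `1`.
      have hcoef : 2 * (1 - (k + 1) / (d : ℝ)) * (k + 2) * c = 1 := by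
        have hd0 : (d : ℝ) ≠ 0 := by
          have : 0 < d := by omega
          positivity
        have hd1 : (d : ℝ) - (k + 1) ≠ 0 := by
          have : (k : ℝ) + 1 < d := by exact_mod_cast hk
          linarith
        have hk2 : (k : ℝ) + 2 ≠ 0 := by positivity
        rw [hc]; field_simp
      have hcR : algebraMap ℝ R (2 * (1 - (k + 1) / (d : ℝ))) * ((k + 2 : ℕ) : R)
          * algebraMap ℝ R c = 1 := by
        have : ((k + 2 : ℕ) : R) = algebraMap ℝ R ((k : ℝ) + 2) := by
          rw [map_add, map_natCast, map_ofNat]; push_cast; rfl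
        rw [this, ← map_mul, ← map_mul, hcoef, map_one]
      simp only [Algebra.smul_def]
      rw [← hT]
      linear_combination (-(T f * m.inn s s * N * e)) * hcR + he

/-- Two unit defining elements with the same orientation agree up to order `d`. -/
theorem IsHypersurface.unit_unique (hd : 1 ≤ d) {f f' : R} (hf : f ∈ I) (hf' : f' ∈ I)
    (h : m.tsq f - 1 ∈ Ord I (m.tder s N) d) (h' : m.tsq f' - 1 ∈ Ord I (m.tder s N) d)
    (hor : m.tder s N f' - m.tder s N f ∈ I) : f' - f ∈ Ord I (m.tder s N) (d + 1) := by
  set T := m.tder s N with hT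
  have main : ∀ j, j + 1 ≤ d → f' - f ∈ Ord I T (j + 2) := by
    intro j
    induction j with
    | zero =>
      intro _
      exact ⟨I.sub_mem hf' hf, by rw [map_sub]; exact mem_ord_one.2 hor⟩
    | succ j ih =>
      intro hj
      have hu := ih (by omega)
      set u := f' - f with hu'
      refine ⟨hu.1, ?_⟩
      have h1 := H.tsq_add hf hu
      rw [show f + u = f' by rw [hu']; ring, ← hT] at h1
      set c : ℝ := 2 * (1 - (j + 1) / (d : ℝ)) with hc
      -- The step from `j` to `j + 1` assumes `j + 2 ≤ d`, so `(j + 1) / d < 1`.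
      have hc0 : c ≠ 0 := by
        have hd0 : (0 : ℝ) < d := by exact_mod_cast hd
        have : ((j : ℝ) + 1) / d < 1 := by
          rw [div_lt_one hd0]; exact_mod_cast hj
        rw [hc]
        have : 0 < 1 - ((j : ℝ) + 1) / d := by linarith
        positivity
      have h2 : c • (T f * m.inn s s * T u) ∈ Ord I T (j + 2) := by
        have := ord_sub (ord_sub (ord_anti hj h') (ord_anti hj h)) h1
        convert this using 1
        ring
      have h3 : T f * m.inn s s * T u ∈ Ord I T (j + 2) := by
        have := ord_smul c⁻¹ h2
        rwa [smul_smul, inv_mul_cancel₀ hc0, one_smul] at this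
      -- Modulo `I` this makes `T f` inverse to `T f |ds|²`, so that factor can be removed from `h3`
      -- without losing an order.
      have h4 : m.inn s s * T f ^ 2 - 1 ∈ Ord I T 1 := by
        refine mem_ord_one.2 ?_
        convert I.sub_mem (mem_ord_one.1 (ord_anti hd h)) (H.tsq_sub hf) using 1
        ring
      have h5 := ord_sub (ord_mul_left (T f) h3) (ord_mul' h4 hu.2 (n := j + 2) (by omega))
      convert h5 using 1
      ring
  -- The last admissible `j` is `d - 1`, which yields order `d + 1`.
  obtain ⟨j, rfl⟩ : ∃ j, d = j + 1 := ⟨d - 1, by omega⟩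
  exact main j le_rfl

end MetricData

/-! ### Universal polynomials -/

/-- Iterated derivatives in a differential algebra. -/
def MetricData.iterD {d : ℕ} {R : Type*} [CommRing R] [Algebra ℝ R] (m : MetricData d R) :
    List (Fin d) → R → R
  | [], f => f
  | a :: α, f => m.D a (m.iterD α f)

/-- The variables of the universal differential algebra generated by a metric with its inverse and a
function with `|ds|⁻¹`. -/
inductive LVar (d : ℕ) : Type
  /-- `∂_{a₁} ⋯ ∂_{aₖ} g_{bc}` -/
  | metric (α : List (Fin d)) (b c : Fin d)
  /-- `g^{bc}` -/
  | inv (b c : Fin d)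
  /-- `∂_{b₁} ⋯ ∂_{bₗ} s` -/
  | fn (α : List (Fin d))
  /-- `|ds|⁻¹` -/
  | normInv

namespace LVar

variable {d : ℕ}

open MvPolynomial

/-- The derivative of the inverse metric. -/
def dInv (a b c : Fin d) : MvPolynomial (LVar d) ℝ :=
  -∑ e, ∑ f, X (inv b e) * X (metric [a] e f) * X (inv f c)

/-- The derivatives of the variables. -/
def dVar (a : Fin d) : LVar d → MvPolynomial (LVar d) ℝ
  | metric α b c => X (metric (a :: α) b c)
  | inv b c => dInv a b c
  | fn α => X (fn (a :: α))
  | normInv => (-(1 / 2) : ℝ) • (X normInv ^ 3 * ∑ b, ∑ c, (dInv a b c * X (fn [b]) * X (fn [c]) +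
      X (inv b c) * (X (fn [a, b]) * X (fn [c]) + X (fn [b]) * X (fn [a, c]))))

end LVar

namespace MetricData

open MvPolynomial

variable {d : ℕ}

/-- The metric of the universal differential algebra. -/
def univ (d : ℕ) : MetricData d (MvPolynomial (LVar d) ℝ) where
  D a := mkDerivation ℝ (LVar.dVar a)
  g := Matrix.of fun b c => X (.metric [] b c)
  h := Matrix.of fun b c => X (.inv b c)

variable {R : Type*} [CommRing R] [Algebra ℝ R] (m : MetricData d R)

/-- The values of the variables in a differential algebra. -/
def lval (s N : R) : LVar d → R
  | .metric α b c => m.iterD α (m.g b c)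
  | .inv b c => m.h b c
  | .fn α => m.iterD α s
  | .normInv => N

variable {m}

theorem IsMetric.D_h' (hm : m.IsMetric) (a b c : Fin d) : m.D a (m.h b c) =
    -∑ e, ∑ f, m.h b e * m.D a (m.g e f) * m.h f c := by
  have h1 : m.DM a m.h * m.g + m.h * m.DM a m.g = 0 := by rw [← DM_mul, hm.mul', DM_one]
  have h2 : m.DM a m.h = -(m.h * m.DM a m.g * m.h) := by
    have : (m.DM a m.h * m.g + m.h * m.DM a m.g) * m.h = 0 := by rw [h1, Matrix.zero_mul]
    rw [Matrix.add_mul, Matrix.mul_assoc, hm.mul, Matrix.mul_one] at this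
    exact eq_neg_of_add_eq_zero_left this
  have h4 := congrFun (congrFun h2 b) c
  simp only [DM_apply, Matrix.neg_apply, Matrix.mul_apply, Finset.sum_mul] at h4
  rw [h4, Finset.sum_comm]

/-- Differentiate `N² |ds|² = 1` and multiply by `N`. The right side is the shape of the derivative
prescribed for `normInv` in `LVar.dVar`. -/
theorem IsMetric.D_norm (hm : m.IsMetric) {s N : R} (hN : N ^ 2 * m.inn s s = 1) (a : Fin d) :
    m.D a N = (-(1 / 2) : ℝ) • (N ^ 3 * ∑ b, ∑ c,
      ((-∑ e, ∑ f, m.h b e * m.D a (m.g e f) * m.h f c) * m.D b s * m.D c s +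
      m.h b c * (m.D a (m.D b s) * m.D c s + m.D b s * m.D a (m.D c s)))) := by
  have h1 : m.D a (m.inn s s) = ∑ b, ∑ c,
      ((-∑ e, ∑ f, m.h b e * m.D a (m.g e f) * m.h f c) * m.D b s * m.D c s +
      m.h b c * (m.D a (m.D b s) * m.D c s + m.D b s * m.D a (m.D c s))) := by
    simp only [inn, map_sum, Derivation.leibniz, smul_eq_mul, hm.D_h']
    exact Finset.sum_congr rfl fun _ _ => Finset.sum_congr rfl fun _ _ => by ring
  have h2 := congrArg (m.D a) hN
  simp only [Derivation.leibniz, Derivation.leibniz_pow, smul_eq_mul,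
    Derivation.map_one_eq_zero, nsmul_eq_mul] at h2
  rw [← h1]
  have h3 : (2 : R) * m.D a N = -(N ^ 3 * m.D a (m.inn s s)) := by
    push_cast at h2
    linear_combination N * h2 - 2 * m.D a N * hN
  have h4 : (2 : ℝ) • m.D a N = (2 : R) * m.D a N := by
    rw [two_smul, two_mul]
  have h5 : m.D a N = (1 / 2 : ℝ) • ((2 : ℝ) • m.D a N) := by
    rw [smul_smul]; norm_num
  rw [h5, h4, h3, smul_neg, neg_smul]

/-- Both composites obey the Leibniz rule along the evaluation, so generators suffice, and there the
prescribed derivatives are the true ones. The relations `g h = 1`, symmetry of `g` and commuting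
derivatives are not imposed on the free algebra; they hold only after evaluation. -/
theorem IsMetric.isHom_univ (hm : m.IsMetric) {s N : R} (hN : N ^ 2 * m.inn s s = 1) :
    IsHom (univ d) m (aeval (m.lval s N)) where
  map_g a b := by simp [univ, lval, iterD]
  map_h a b := by simp [univ, lval]
  map_D a q := by
    induction q using MvPolynomial.induction_on with
    | C r => simp [univ]
    | add p q hp hq => simp only [map_add, hp, hq]
    | mul_X p i hp =>
      simp only [Derivation.leibniz, smul_eq_mul, map_add, map_mul, hp, aeval_X]
      congr 2
      simp only [univ, mkDerivation_X]
      cases i with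
      | metric α b c => simp [LVar.dVar, lval, iterD]
      | inv b c => simp [LVar.dVar, LVar.dInv, lval, iterD, hm.D_h']
      | fn α => simp [LVar.dVar, lval, iterD]
      | normInv =>
        simp only [lval, hm.D_norm hN]
        simp [LVar.dVar, LVar.dInv, lval, iterD]

theorem IsHom.map_iterD {A : Type*} [CommRing A] [Algebra ℝ A] {n : MetricData d A}
    {π : A →ₐ[ℝ] R} (hπ : IsHom n m π) (α : List (Fin d)) (f : A) :
    π (n.iterD α f) = m.iterD α (π f) := by
  induction α with
  | nil => rfl
  | cons a α ih => simp [iterD, hπ.map_D, ih]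

/-- The universal polynomial of the approximate unit defining density. -/
def unitPoly (d : ℕ) : MvPolynomial (LVar d) ℝ := (univ d).approx (X (.fn [])) (X .normInv) (d - 1)

theorem IsMetric.aeval_iterD_unitPoly (hm : m.IsMetric) {s N : R} (hN : N ^ 2 * m.inn s s = 1)
    (α : List (Fin d)) : aeval (m.lval s N) ((univ d).iterD α (unitPoly d)) =
      m.iterD α (m.approx s N (d - 1)) := by
  rw [(hm.isHom_univ hN).map_iterD, unitPoly, (hm.isHom_univ hN).map_approx]
  simp [lval, iterD]

theorem IsHypersurface.iterD_mem {I : Ideal R} {s N : R} (H : m.IsHypersurface I s N) {k : ℕ}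
    {f : R} (hf : f ∈ Ord I (m.tder s N) (k + 1)) (α : List (Fin d)) (hα : α.length ≤ k) :
    m.iterD α f ∈ I := by
  -- The induction on the list must keep track of the order that remains after the derivatives
  -- already taken.
  have : ∀ j, α.length + j ≤ k → m.iterD α f ∈ Ord I (m.tder s N) (j + 1) := by
    clear hα
    induction α with
    | nil => intro j hj; exact ord_anti (by simpa using hj) hf
    | cons a α ih =>
      intro j hj
      exact H.D_mem (ih (j + 1) (by simp at hj; omega)) a
  exact (this 0 hα).1

end MetricData

/-! ### Smooth functions on an open subset of `ℝᵈ` -/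

section SmoothRing

open TopologicalSpace Filter Topology

variable {d : ℕ}

/-- The algebra of smooth functions on `U`. -/
def smoothSubalgebra (U : Opens (Coord d)) : Subalgebra ℝ (U → ℝ) where
  carrier := {f | ∃ F : Coord d → ℝ, ContDiffOn ℝ ∞ F U ∧ ∀ y : U, F y = f y}
  mul_mem' := by
    rintro f g ⟨F, hF, hf⟩ ⟨G, hG, hg⟩
    exact ⟨fun y => F y * G y, hF.mul hG, fun y => by simp [hf, hg]⟩
  add_mem' := by
    rintro f g ⟨F, hF, hf⟩ ⟨G, hG, hg⟩
    exact ⟨fun y => F y + G y, hF.add hG, fun y => by simp [hf, hg]⟩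
  algebraMap_mem' r := ⟨fun _ => r, contDiffOn_const, fun y => by simp⟩

/-- The ring of smooth functions on `U`. -/
abbrev SmoothRing (U : Opens (Coord d)) : Type := smoothSubalgebra U

namespace SmoothRing

variable {U : Opens (Coord d)}

/-- `r` is the restriction of `F` to `U`. -/
def Rep (r : SmoothRing U) (F : Coord d → ℝ) : Prop := ∀ y : U, r.1 y = F y

theorem exists_rep (r : SmoothRing U) : ∃ F : Coord d → ℝ, ContDiffOn ℝ ∞ F U ∧ r.Rep F := by
  obtain ⟨F, hF, h⟩ := r.2
  exact ⟨F, hF, fun y => (h y).symm⟩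

theorem ext {r r' : SmoothRing U} (h : ∀ y : U, r.1 y = r'.1 y) : r = r' :=
  Subtype.ext (funext h)

/-- Since `U` is open, representatives agree near each of its points, so their partial derivatives
on `U` do not depend on the choice. -/
theorem Rep.eventuallyEq {r : SmoothRing U} {F F' : Coord d → ℝ} (h : r.Rep F) (h' : r.Rep F')
    (y : U) : F =ᶠ[𝓝 (y : Coord d)] F' := by
  filter_upwards [U.isOpen.mem_nhds y.2] with z hz
  rw [← h ⟨z, hz⟩, h' ⟨z, hz⟩]

theorem _root_.ConformalHypersurface.pd_congr {F F' : Coord d → ℝ} {y : Coord d}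
    (h : F =ᶠ[𝓝 y] F') (a : Fin d) : pd a F y = pd a F' y := by
  rw [pd, pd, h.fderiv_eq]

theorem _root_.ConformalHypersurface.pd_eventuallyEq {F F' : Coord d → ℝ} {y : Coord d}
    (h : F =ᶠ[𝓝 y] F') (a : Fin d) : pd a F =ᶠ[𝓝 y] pd a F' := by
  filter_upwards [h.eventuallyEq_nhds] with z hz using pd_congr hz a

theorem _root_.ConformalHypersurface.iterPd_eventuallyEq {F F' : Coord d → ℝ} {y : Coord d}
    (h : F =ᶠ[𝓝 y] F') (α : List (Fin d)) : iterPd α F =ᶠ[𝓝 y] iterPd α F' := by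
  induction α with
  | nil => exact h
  | cons a α ih => exact pd_eventuallyEq ih a

theorem _root_.ConformalHypersurface.contDiffOn_pd {F : Coord d → ℝ}
    (hF : ContDiffOn ℝ ∞ F U) (a : Fin d) : ContDiffOn ℝ ∞ (pd a F) U :=
  (hF.fderiv_of_isOpen U.isOpen (by simp)).clm_apply contDiffOn_const

theorem Rep.differentiableAt {F : Coord d → ℝ} (hF : ContDiffOn ℝ ∞ F U) (y : U) :
    DifferentiableAt ℝ F y :=
  (hF.contDiffAt (U.isOpen.mem_nhds y.2)).differentiableAt (by simp)

/-- The restriction of a function that is smooth on `U`. -/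
def mk (F : Coord d → ℝ) (hF : ContDiffOn ℝ ∞ F U) : SmoothRing U :=
  ⟨fun y => F y, F, hF, fun _ => rfl⟩

theorem rep_mk (F : Coord d → ℝ) (hF : ContDiffOn ℝ ∞ F U) : (mk F hF).Rep F := fun _ => rfl

/-- A representative of a smooth function. -/
def out (r : SmoothRing U) : Coord d → ℝ := r.exists_rep.choose

theorem out_smooth (r : SmoothRing U) : ContDiffOn ℝ ∞ r.out U := r.exists_rep.choose_spec.1

theorem rep_out (r : SmoothRing U) : r.Rep r.out := r.exists_rep.choose_spec.2

theorem Rep.smooth {r : SmoothRing U} {F : Coord d → ℝ} (h : r.Rep F) : ContDiffOn ℝ ∞ F U :=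
  r.out_smooth.congr fun y hy => by rw [← h ⟨y, hy⟩, r.rep_out ⟨y, hy⟩]

section

variable {r r' : SmoothRing U} {F F' : Coord d → ℝ}

theorem Rep.add (h : r.Rep F) (h' : r'.Rep F') : (r + r').Rep (fun y => F y + F' y) := fun y => by
  change r.1 y + r'.1 y = _
  rw [h y, h' y]

theorem Rep.sub (h : r.Rep F) (h' : r'.Rep F') : (r - r').Rep (fun y => F y - F' y) := fun y => by
  change r.1 y - r'.1 y = _
  rw [h y, h' y]

theorem Rep.mul (h : r.Rep F) (h' : r'.Rep F') : (r * r').Rep (fun y => F y * F' y) := fun y => by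
  change r.1 y * r'.1 y = _
  rw [h y, h' y]

theorem Rep.smul (c : ℝ) (h : r.Rep F) : (c • r).Rep (fun y => c * F y) := fun y => by
  change c * r.1 y = _
  rw [h y]

end

/-- The partial derivative, as a derivation. -/
def der (a : Fin d) : Derivation ℝ (SmoothRing U) (SmoothRing U) where
  toFun r := mk (pd a r.out) (contDiffOn_pd r.out_smooth a)
  map_add' r r' := by
    refine ext fun y => ?_
    change pd a (r + r').out y = pd a r.out y + pd a r'.out y
    have h : (r + r').Rep (fun z => r.out z + r'.out z) := r.rep_out.add r'.rep_out
    rw [pd_congr ((rep_out _).eventuallyEq h y)]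
    have h1 := (Rep.differentiableAt r.out_smooth y).hasFDerivAt.add
      (Rep.differentiableAt r'.out_smooth y).hasFDerivAt
    exact congrArg (fun L => L (stdVec a)) h1.fderiv
  map_smul' c r := by
    refine ext fun y => ?_
    change pd a (c • r).out y = c * pd a r.out y
    have h : (c • r).Rep (fun z => c * r.out z) := r.rep_out.smul c
    rw [pd_congr ((rep_out _).eventuallyEq h y)]
    have h1 := (Rep.differentiableAt r.out_smooth y).hasFDerivAt.const_mul c
    rw [pd, h1.fderiv]
    rfl
  map_one_eq_zero' := by
    refine ext fun y => ?_
    change pd a (1 : SmoothRing U).out y = 0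
    have h : (1 : SmoothRing U).Rep (fun _ => 1) := fun z => rfl
    rw [pd_congr ((rep_out _).eventuallyEq h y)]
    simp [pd]
  leibniz' r r' := by
    refine ext fun y => ?_
    change pd a (r * r').out y = r.1 y * pd a r'.out y + r'.1 y * pd a r.out y
    have h : (r * r').Rep (fun z => r.out z * r'.out z) := r.rep_out.mul r'.rep_out
    rw [pd_congr ((rep_out _).eventuallyEq h y)]
    have h1 := (Rep.differentiableAt r.out_smooth y).hasFDerivAt.mul
      (Rep.differentiableAt r'.out_smooth y).hasFDerivAt
    rw [r.rep_out, r'.rep_out]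
    exact congrArg (fun L => L (stdVec a)) h1.fderiv

theorem Rep.der {r : SmoothRing U} {F : Coord d → ℝ} (h : r.Rep F) (a : Fin d) :
    (der a r).Rep (pd a F) := fun y =>
  pd_congr (r.rep_out.eventuallyEq h y) a

theorem _root_.ConformalHypersurface.pd_comm {F : Coord d → ℝ} {y : Coord d}
    (hF : ContDiffAt ℝ ∞ F y) (a b : Fin d) : pd a (pd b F) y = pd b (pd a F) y := by
  have h1 : DifferentiableAt ℝ (fderiv ℝ F) y :=
    (hF.fderiv_right (m := 1) (by norm_cast)).differentiableAt (by simp)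
  have h2 : ∀ a b : Fin d, pd a (pd b F) y = fderiv ℝ (fderiv ℝ F) y (stdVec a) (stdVec b) := by
    intro a b
    have := h1.hasFDerivAt.clm_apply (hasFDerivAt_const (stdVec b) y)
    rw [pd]
    change fderiv ℝ (fun z => fderiv ℝ F z (stdVec b)) y (stdVec a) = _
    rw [this.fderiv]
    simp
  rw [h2, h2]
  exact hF.isSymmSndFDerivAt (by simp; norm_cast) _ _

theorem der_comm (a b : Fin d) (r : SmoothRing U) : der a (der b r) = der b (der a r) := by
  refine ext fun y => ?_
  rw [(r.rep_out.der b).der a y, (r.rep_out.der a).der b y]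
  exact pd_comm (r.out_smooth.contDiffAt (U.isOpen.mem_nhds y.2)) a b

theorem Rep.sum {ι : Type*} {t : Finset ι} {r : ι → SmoothRing U} {F : ι → Coord d → ℝ}
    (h : ∀ i, (r i).Rep (F i)) : (∑ i ∈ t, r i).Rep (fun y => ∑ i ∈ t, F i y) := fun y => by
  simp only [← fun i => h i y]
  simp

/-- Evaluation at a point of `U`. -/
def evalAt (y : U) : SmoothRing U →ₐ[ℝ] ℝ :=
  (Pi.evalAlgHom ℝ (fun _ : U => ℝ) y).comp (smoothSubalgebra U).val

theorem evalAt_apply (y : U) (r : SmoothRing U) : evalAt y r = r.1 y := rfl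

/-- The pullback of smooth functions along a smooth map. -/
def pullback {U V : Opens (Coord d)} (τ : Coord d → Coord d) (hτ : ContDiffOn ℝ ∞ τ U)
    (hUV : Set.MapsTo τ U V) : SmoothRing V →ₐ[ℝ] SmoothRing U where
  toFun r := ⟨fun y => r.1 ⟨τ y, hUV y.2⟩, r.out ∘ τ, r.out_smooth.comp hτ hUV,
    fun y => (r.rep_out ⟨τ y, hUV y.2⟩).symm⟩
  map_one' := rfl
  map_mul' _ _ := rfl
  map_zero' := rfl
  map_add' _ _ := rfl
  commutes' _ := rfl

theorem rep_pullback {U V : Opens (Coord d)} (τ : Coord d → Coord d) (hτ : ContDiffOn ℝ ∞ τ U)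
    (hUV : Set.MapsTo τ U V) {r : SmoothRing V} {F : Coord d → ℝ} (h : r.Rep F) :
    (pullback τ hτ hUV r).Rep (F ∘ τ) := fun y => h ⟨τ y, hUV y.2⟩

theorem _root_.ConformalHypersurface.fderiv_apply_eq_sum_pd (F : Coord d → ℝ) (y v : Coord d) :
    fderiv ℝ F y v = ∑ i, v i * pd i F y := by
  have hv : v = ∑ i, v i • stdVec i := by
    ext j
    simp [stdVec, Pi.single_apply]
  conv_lhs => rw [hv]
  simp [pd]

/-- The chain rule. -/
theorem der_pullback {U V : Opens (Coord d)} (τ : Coord d → Coord d) (hτ : ContDiffOn ℝ ∞ τ U)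
    (hUV : Set.MapsTo τ U V) (r : SmoothRing V) (a : Fin d) (J : Fin d → SmoothRing U)
    (hJ : ∀ i, (J i).Rep (pd a (fun z => τ z i))) :
    der a (pullback τ hτ hUV r) = ∑ i, J i * pullback τ hτ hUV (der i r) := by
  refine ext fun y => ?_
  rw [(rep_pullback τ hτ hUV r.rep_out).der a y,
    (Rep.sum fun i => (hJ i).mul (rep_pullback τ hτ hUV (r.rep_out.der i))) y]
  have h1 : DifferentiableAt ℝ τ y :=
    (hτ.contDiffAt (U.isOpen.mem_nhds y.2)).differentiableAt (by simp)
  have h2 : DifferentiableAt ℝ r.out (τ y) := Rep.differentiableAt r.out_smooth ⟨τ y, hUV y.2⟩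
  rw [pd, fderiv_comp (y : Coord d) h2 h1, ContinuousLinearMap.comp_apply, fderiv_apply_eq_sum_pd]
  refine Finset.sum_congr rfl fun i _ => ?_
  congr 1
  have h3 := ((PiLp.proj (𝕜 := ℝ) 2 (fun _ : Fin d => ℝ) i).hasFDerivAt.comp
    (y : Coord d) h1.hasFDerivAt)
  rw [pd]
  change _ = fderiv ℝ ((PiLp.proj (𝕜 := ℝ) 2 (fun _ : Fin d => ℝ) i) ∘ τ) y _
  rw [h3.fderiv]
  simp

end SmoothRing

end SmoothRing

/-! ### Charts -/

section Charts

set_option linter.unusedSectionVars false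

open TopologicalSpace Filter Topology

variable {d : ℕ} {M : Type u} [TopologicalSpace M] [ChartedSpace (Coord d) M]
  [IsManifold (𝓡 d) ∞ M] {φ ψ : OpenPartialHomeomorph M (Coord d)}

theorem mdifferentiable_of_mem_smoothAtlas (hφ : φ ∈ smoothAtlas d M) :
    φ.MDifferentiable (𝓡 d) (𝓡 d) :=
  ⟨(contMDiffOn_of_mem_maximalAtlas hφ).mdifferentiableOn (by simp),
    (contMDiffOn_symm_of_mem_maximalAtlas hφ).mdifferentiableOn (by simp)⟩

theorem contDiffOn_comp_symm (hφ : φ ∈ smoothAtlas d M) {s : M → ℝ} (hs : SmoothFn d s) :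
    ContDiffOn ℝ ∞ (s ∘ φ.symm) φ.target :=
  contMDiffOn_iff_contDiffOn.1 (hs.comp_contMDiffOn (contMDiffOn_symm_of_mem_maximalAtlas hφ))

theorem mdifferentiableAt_chart_symm (hφ : φ ∈ smoothAtlas d M) {y : Coord d}
    (hy : y ∈ φ.target) : MDifferentiableAt 𝓘(ℝ, Coord d) (𝓡 d) φ.symm y :=
  (mdifferentiable_of_mem_smoothAtlas hφ).mdifferentiableAt_symm hy

theorem pd_comp_symm (hφ : φ ∈ smoothAtlas d M) {s : M → ℝ} (hs : SmoothFn d s) {y : Coord d}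
    (hy : y ∈ φ.target) (a : Fin d) :
    pd a (s ∘ φ.symm) y = differential d s (φ.symm y) (coordVec φ y a) := by
  have h1 : MDifferentiableAt (𝓡 d) 𝓘(ℝ, ℝ) s (φ.symm y) := hs.mdifferentiableAt (by simp)
  have h2 := mfderiv_comp y h1 (mdifferentiableAt_chart_symm hφ hy)
  rw [pd, ← mfderiv_eq_fderiv, h2]
  rfl

theorem exists_eq_mfderiv_symm (hφ : φ ∈ smoothAtlas d M) {y : Coord d} (hy : y ∈ φ.target)
    (v : TangentSpace (𝓡 d) (φ.symm y)) :
    ∃ u : Coord d, mfderiv 𝓘(ℝ, Coord d) (𝓡 d) φ.symm y u = v :=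
  (mdifferentiable_of_mem_smoothAtlas hφ).symm.mfderiv_surjective (x := y) hy v

theorem mfderiv_symm_eq_zero (hφ : φ ∈ smoothAtlas d M) {y : Coord d} (hy : y ∈ φ.target)
    {u : Coord d} (hu : mfderiv 𝓘(ℝ, Coord d) (𝓡 d) φ.symm y u = 0) : u = 0 := by
  have := (mdifferentiable_of_mem_smoothAtlas hφ).symm.mfderiv_injective (x := y) hy
  apply this
  exact hu.trans (map_zero _).symm

theorem mfderiv_symm_apply (y u : Coord d) :
    mfderiv 𝓘(ℝ, Coord d) (𝓡 d) φ.symm y u = ∑ a, u a • coordVec φ y a := by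
  have hv : u = ∑ i, u i • stdVec i := by
    ext j
    simp [stdVec, Pi.single_apply]
  conv_lhs => rw [hv]
  have := map_sum (mfderiv 𝓘(ℝ, Coord d) (𝓡 d) φ.symm y) (fun i => u i • stdVec i) Finset.univ
  refine this.trans (Finset.sum_congr rfl fun i _ => ?_)
  exact map_smul (mfderiv 𝓘(ℝ, Coord d) (𝓡 d) φ.symm y) (u i) (stdVec i)

theorem differential_eq_zero_iff (hφ : φ ∈ smoothAtlas d M) {s : M → ℝ} (hs : SmoothFn d s)
    {y : Coord d} (hy : y ∈ φ.target) :
    differential d s (φ.symm y) = 0 ↔ ∀ a, pd a (s ∘ φ.symm) y = 0 := by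
  constructor
  · intro h a
    rw [pd_comp_symm hφ hs hy, h]
    rfl
  · intro h
    ext v
    obtain ⟨u, rfl⟩ := exists_eq_mfderiv_symm hφ hy v
    rw [mfderiv_symm_apply, map_sum]
    refine Finset.sum_eq_zero fun a _ => ?_
    rw [map_smul, ← pd_comp_symm hφ hs hy, h, smul_zero]

/-- The metric in a chart. -/
theorem contDiffOn_gram (hφ : φ ∈ smoothAtlas d M) (G : OrientedMetric d M) (a b : Fin d) :
    ContDiffOn ℝ ∞ (fun y => gram φ G y a b) φ.target := by
  have hvec : ∀ a, ContMDiffOn 𝓘(ℝ, Coord d) ((𝓡 d).prod 𝓘(ℝ, Coord d)) ∞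
      (fun y => (Bundle.TotalSpace.mk' (Coord d) (φ.symm y) (coordVec φ y a) :
        TangentBundle (𝓡 d) M)) φ.target := by
    intro a
    -- A coordinate vector field is the image of a constant field under the tangent map of `φ.symm`,
    -- hence smooth.
    have h1 := (contMDiffOn_symm_of_mem_maximalAtlas hφ).contMDiffOn_tangentMapWithin (m := ∞)
      (by simp) φ.open_target.uniqueMDiffOn
    have h2 : ContMDiffOn 𝓘(ℝ, Coord d) ((𝓡 d).prod 𝓘(ℝ, Coord d)) ∞
        (fun y : Coord d => (⟨y, stdVec a⟩ : TangentBundle 𝓘(ℝ, Coord d) (Coord d)))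
        φ.target := by
      intro y hy
      exact contMDiffWithinAt_vectorSpace_iff_contDiffWithinAt.2 contDiffWithinAt_const
    refine (h1.comp h2 fun y hy => hy).congr fun y hy => ?_
    simp only [Function.comp, tangentMapWithin]
    rw [mfderivWithin_of_isOpen φ.open_target hy]
    rfl
  have hg : ContMDiffOn 𝓘(ℝ, Coord d) ((𝓡 d).prod 𝓘(ℝ, Coord d →L[ℝ] Coord d →L[ℝ] ℝ)) ∞
      (fun y => Bundle.TotalSpace.mk' (Coord d →L[ℝ] Coord d →L[ℝ] ℝ)
        (E := fun x : M => TangentSpace (𝓡 d) x →L[ℝ] TangentSpace (𝓡 d) x →L[ℝ] ℝ)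
        (φ.symm y) (G.metric.inner (φ.symm y))) φ.target :=
    G.metric.contMDiff.comp_contMDiffOn (contMDiffOn_symm_of_mem_maximalAtlas hφ)
  intro y hy
  have : ContMDiffWithinAt 𝓘(ℝ, Coord d) ((𝓡 d).prod 𝓘(ℝ)) ∞
      (fun m ↦ Bundle.TotalSpace.mk' ℝ (E := Bundle.Trivial M ℝ) (φ.symm m)
        (G.metric.inner (φ.symm m) (coordVec φ m a) (coordVec φ m b))) φ.target y := by
    apply ContMDiffWithinAt.clm_bundle_apply₂ (F₁ := Coord d) (F₂ := Coord d)
    · exact hg y hy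
    · exact hvec a y hy
    · exact hvec b y hy
  rw [Bundle.contMDiffWithinAt_totalSpace] at this
  exact contMDiffWithinAt_iff_contDiffWithinAt.1 this.2

theorem gram_symm (G : OrientedMetric d M) (y : Coord d) (a b : Fin d) :
    gram φ G y a b = gram φ G y b a := G.metric.symm _ _ _

theorem gram_posDef (hφ : φ ∈ smoothAtlas d M) (G : OrientedMetric d M) {y : Coord d}
    (hy : y ∈ φ.target) : (gram φ G y).PosDef := by
  refine Matrix.PosDef.of_dotProduct_mulVec_pos ?_ fun x hx => ?_
  · ext a b
    simpa using gram_symm G y b a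
  · set u : Coord d := WithLp.toLp 2 x with hu
    have h1 : mfderiv 𝓘(ℝ, Coord d) (𝓡 d) φ.symm y u ≠ 0 := fun h => hx <| by
      have := mfderiv_symm_eq_zero hφ hy h
      funext a
      exact congrArg (fun z : Coord d => z a) this
    have h2 := G.metric.pos (φ.symm y) _ h1
    rw [mfderiv_symm_apply] at h2
    simp only [map_sum, map_smul, _root_.sum_apply, _root_.smul_apply,
      smul_eq_mul] at h2
    refine lt_of_lt_of_eq h2 ?_
    simp only [dotProduct, Matrix.mulVec, Finset.mul_sum]
    rw [Finset.sum_comm]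
    refine Finset.sum_congr rfl fun a _ => Finset.sum_congr rfl fun b _ => ?_
    simp [gram, hu]
    ring

theorem gram_mul_gramInv (hφ : φ ∈ smoothAtlas d M) (G : OrientedMetric d M) {y : Coord d}
    (hy : y ∈ φ.target) : gram φ G y * gramInv φ G y = 1 :=
  Matrix.mul_nonsing_inv _ (gram_posDef hφ G hy).det_pos.ne'.isUnit

/-- By Cramer's rule the entries are cofactors over the determinant, which is positive. -/
theorem contDiffOn_gramInv (hφ : φ ∈ smoothAtlas d M) (G : OrientedMetric d M) (a b : Fin d) :
    ContDiffOn ℝ ∞ (fun y => gramInv φ G y a b) φ.target := by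
  have hdet : ∀ A : Coord d → Matrix (Fin d) (Fin d) ℝ,
      (∀ i j, ContDiffOn ℝ ∞ (fun y => A y i j) φ.target) →
      ContDiffOn ℝ ∞ (fun y => (A y).det) φ.target := by
    intro A hA
    simp only [Matrix.det_apply]
    refine ContDiffOn.sum fun σ _ => ContDiffOn.const_smul _ ?_
    exact contDiffOn_prod fun i _ => hA _ _
  have h1 := hdet (gram φ G) (contDiffOn_gram hφ G)
  have h2 : ContDiffOn ℝ ∞ (fun y => (gram φ G y).adjugate a b) φ.target := by
    simp only [Matrix.adjugate_apply]
    refine hdet _ fun i j => ?_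
    by_cases h : i = b
    · subst h
      simpa using contDiffOn_const
    · simpa [Matrix.updateRow_ne h] using contDiffOn_gram hφ G i j
  have h3 : ContDiffOn ℝ ∞ (fun y => ((gram φ G y).det)⁻¹ * (gram φ G y).adjugate a b) φ.target :=
    (h1.inv fun y hy => (gram_posDef hφ G hy).det_pos.ne').mul h2
  refine h3.congr fun y _ => ?_
  simp [gramInv, Matrix.inv_def]

theorem gradSq_pos (hφ : φ ∈ smoothAtlas d M) (G : OrientedMetric d M) {s : M → ℝ}
    (hs : SmoothFn d s) {y : Coord d} (hy : y ∈ φ.target)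
    (hd : differential d s (φ.symm y) ≠ 0) : 0 < gradSq φ G s y := by
  have h1 : (gramInv φ G y).PosDef := (gram_posDef hφ G hy).inv
  have h2 : (fun a => pd a (s ∘ φ.symm) y) ≠ 0 := fun h =>
    hd ((differential_eq_zero_iff hφ hs hy).2 fun a => congrFun h a)
  have h3 := h1.dotProduct_mulVec_pos h2
  refine lt_of_lt_of_eq h3 ?_
  simp only [gradSq, dotProduct, Matrix.mulVec, Finset.mul_sum]
  refine Finset.sum_congr rfl fun a _ => Finset.sum_congr rfl fun b _ => ?_
  simp
  ring

/-! ### Transition functions -/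

theorem contDiffOn_transition (hφ : φ ∈ smoothAtlas d M) (hψ : ψ ∈ smoothAtlas d M) :
    ContDiffOn ℝ ∞ (ψ ∘ φ.symm) (φ.target ∩ φ.symm ⁻¹' ψ.source) :=
  contMDiffOn_iff_contDiffOn.1 ((contMDiffOn_of_mem_maximalAtlas hψ).comp
    ((contMDiffOn_symm_of_mem_maximalAtlas hφ).mono Set.inter_subset_left) fun _ h => h.2)

theorem isOpen_transition_source (φ ψ : OpenPartialHomeomorph M (Coord d)) :
    IsOpen (φ.target ∩ φ.symm ⁻¹' ψ.source) :=
  φ.symm.isOpen_inter_preimage ψ.open_source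

/-- The tangent spaces at all points are the same model space, so vectors can be moved along an
equality of base points that is not definitional. -/
theorem metric_congr (G : OrientedMetric d M) {x x' : M} (h : x = x') (v w : Coord d) :
    G.metric.inner x v w = G.metric.inner x' v w := by
  subst h; rfl

/-- This is the chain rule for `φ.symm = ψ.symm ∘ τ` near `y`. The two sides live over base points
that are only provably equal, hence the ascriptions to `Coord d`. -/
theorem coordVec_transition (hφ : φ ∈ smoothAtlas d M) (hψ : ψ ∈ smoothAtlas d M) {y : Coord d}
    (hy : y ∈ φ.target) (hy' : φ.symm y ∈ ψ.source) (a : Fin d) :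
    (coordVec φ y a : Coord d) = ∑ i, pd a (fun z => (ψ (φ.symm z)) i) y •
      (coordVec ψ (ψ (φ.symm y)) i : Coord d) := by
  set τ := ψ ∘ φ.symm with hτ
  have hopen := (isOpen_transition_source φ ψ).mem_nhds ⟨hy, hy'⟩
  have hτd : DifferentiableAt ℝ τ y :=
    ((contDiffOn_transition hφ hψ).contDiffAt hopen).differentiableAt (by simp)
  have h1 : φ.symm =ᶠ[𝓝 y] ψ.symm ∘ τ := by
    filter_upwards [hopen] with z hz
    simp [hτ, ψ.left_inv hz.2]
  have h2 : mfderiv 𝓘(ℝ, Coord d) (𝓡 d) (ψ.symm ∘ τ) y =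
      (mfderiv 𝓘(ℝ, Coord d) (𝓡 d) ψ.symm (τ y)).comp (mfderiv 𝓘(ℝ, Coord d) 𝓘(ℝ, Coord d) τ y) :=
    mfderiv_comp y (mdifferentiableAt_chart_symm hψ (ψ.map_source hy')) hτd.mdifferentiableAt
  have h3 : (coordVec φ y a : Coord d) =
      (mfderiv 𝓘(ℝ, Coord d) (𝓡 d) ψ.symm (τ y) (fderiv ℝ τ y (stdVec a)) : Coord d) := by
    have h4 : (mfderiv 𝓘(ℝ, Coord d) (𝓡 d) φ.symm y : Coord d →L[ℝ] Coord d) =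
        (mfderiv 𝓘(ℝ, Coord d) (𝓡 d) (ψ.symm ∘ τ) y : Coord d →L[ℝ] Coord d) :=
      h1.mfderiv_eq
    have h5 := congrArg (fun L : Coord d →L[ℝ] Coord d => L (stdVec a)) (h4.trans h2)
    rw [mfderiv_eq_fderiv] at h5
    exact h5
  refine h3.trans ?_
  refine (mfderiv_symm_apply (φ := ψ) (τ y) (fderiv ℝ τ y (stdVec a))).trans ?_
  refine Finset.sum_congr rfl fun i _ => ?_
  congr 1
  have h6 := ((PiLp.proj (𝕜 := ℝ) 2 (fun _ : Fin d => ℝ) i).hasFDerivAt.comp y hτd.hasFDerivAt)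
  rw [pd]
  change _ = fderiv ℝ ((PiLp.proj (𝕜 := ℝ) 2 (fun _ : Fin d => ℝ) i) ∘ τ) y _
  rw [h6.fderiv]
  simp

theorem gram_transition (hφ : φ ∈ smoothAtlas d M) (hψ : ψ ∈ smoothAtlas d M)
    (G : OrientedMetric d M) {y : Coord d}
    (hy : y ∈ φ.target) (hy' : φ.symm y ∈ ψ.source) (a b : Fin d) :
    gram φ G y a b = ∑ i, ∑ j, pd a (fun z => (ψ (φ.symm z)) i) y *
      gram ψ G (ψ (φ.symm y)) i j * pd b (fun z => (ψ (φ.symm z)) j) y := by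
  have h1 : gram φ G y a b = G.metric.inner (ψ.symm (ψ (φ.symm y)))
      (coordVec φ y a : Coord d) (coordVec φ y b : Coord d) :=
    metric_congr G (ψ.left_inv hy').symm _ _
  rw [h1, coordVec_transition hφ hψ hy hy' a, coordVec_transition hφ hψ hy hy' b]
  set c : Fin d → TangentSpace (𝓡 d) (ψ.symm (ψ (φ.symm y))) := coordVec ψ (ψ (φ.symm y))
  set r : Fin d → ℝ := fun i => pd a (fun z => (ψ (φ.symm z)) i) y
  set r' : Fin d → ℝ := fun i => pd b (fun z => (ψ (φ.symm z)) i) y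
  change G.metric.inner (ψ.symm (ψ (φ.symm y))) (∑ i, r i • c i) (∑ i, r' i • c i) =
    ∑ i, ∑ j, r i * G.metric.inner (ψ.symm (ψ (φ.symm y))) (c i) (c j) * r' j
  simp only [map_sum, map_smul, _root_.sum_apply, _root_.smul_apply,
      smul_eq_mul]
  rw [Finset.sum_comm]
  simp only [Finset.mul_sum]
  exact Finset.sum_congr rfl fun i _ => Finset.sum_congr rfl fun j _ => by ring

/-- The chain rule is applied to the composite of the two transition maps, which is the identity
near the point. -/
theorem jacobian_mul (hφ : φ ∈ smoothAtlas d M) (hψ : ψ ∈ smoothAtlas d M) {y : Coord d}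
    (hy : y ∈ φ.target) (hy' : φ.symm y ∈ ψ.source) (i j : Fin d) :
    ∑ a, pd a (fun z => (ψ (φ.symm z)) i) y *
      pd j (fun z => (φ (ψ.symm z)) a) (ψ (φ.symm y)) = if i = j then 1 else 0 := by
  set τ := ψ ∘ φ.symm with hτ
  set σ := φ ∘ ψ.symm with hσ
  have hy2 : τ y ∈ ψ.target ∩ ψ.symm ⁻¹' φ.source :=
    ⟨ψ.map_source hy', by simpa [hτ, ψ.left_inv hy'] using φ.map_target hy⟩
  have hστ : σ (τ y) = y := by simp [hτ, hσ, ψ.left_inv hy', φ.right_inv hy]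
  have hopen := (isOpen_transition_source ψ φ).mem_nhds hy2
  have hτd : DifferentiableAt ℝ τ (σ (τ y)) := by
    rw [hστ]
    exact ((contDiffOn_transition hφ hψ).contDiffAt ((isOpen_transition_source φ ψ).mem_nhds
      ⟨hy, hy'⟩)).differentiableAt (by simp)
  have hσd : DifferentiableAt ℝ σ (τ y) :=
    ((contDiffOn_transition hψ hφ).contDiffAt hopen).differentiableAt (by simp)
  have h1 : (fun z => τ (σ z) i) =ᶠ[𝓝 (τ y)] fun z => z i := by
    filter_upwards [hopen] with z hz
    simp [hτ, hσ, φ.left_inv hz.2, ψ.right_inv hz.1]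
  have hproj : ∀ k, HasFDerivAt (fun z : Coord d => z k)
      (PiLp.proj (𝕜 := ℝ) 2 (fun _ : Fin d => ℝ) k) (τ y) := fun k =>
    (PiLp.proj (𝕜 := ℝ) 2 (fun _ : Fin d => ℝ) k).hasFDerivAt
  have h2 : pd j (fun z => τ (σ z) i) (τ y) = if i = j then 1 else 0 := by
    rw [pd_congr h1, pd, (hproj i).fderiv]
    simp [stdVec]
  have hτi : DifferentiableAt ℝ (fun z => τ z i) (σ (τ y)) :=
    (PiLp.proj (𝕜 := ℝ) 2 (fun _ : Fin d => ℝ) i).differentiableAt.comp _ hτd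
  have h3 : pd j (fun z => τ (σ z) i) (τ y) =
      fderiv ℝ (fun z => τ z i) (σ (τ y)) (fderiv ℝ σ (τ y) (stdVec j)) := by
    rw [pd]
    change fderiv ℝ ((fun z => τ z i) ∘ σ) (τ y) (stdVec j) = _
    rw [fderiv_comp (τ y) hτi hσd]
    rfl
  rw [← h2, h3, fderiv_apply_eq_sum_pd, hστ]
  refine Finset.sum_congr rfl fun a _ => ?_
  rw [mul_comm]
  congr 1
  have h6 := ((PiLp.proj (𝕜 := ℝ) 2 (fun _ : Fin d => ℝ) a).hasFDerivAt.comp (τ y)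
    hσd.hasFDerivAt)
  rw [pd]
  change fderiv ℝ ((PiLp.proj (𝕜 := ℝ) 2 (fun _ : Fin d => ℝ) a) ∘ σ) (τ y) _ = _
  rw [h6.fderiv]
  simp

end Charts

/-! ### The differential algebra of a chart -/

section ChartAlgebra

set_option linter.unusedSectionVars false

open TopologicalSpace Filter Topology SmoothRing MetricData

variable {d : ℕ} {M : Type u} [TopologicalSpace M] [ChartedSpace (Coord d) M]
  [IsManifold (𝓡 d) ∞ M] {φ ψ : OpenPartialHomeomorph M (Coord d)} {U : Opens (Coord d)}

/-- The metric of `G` on an open subset of the target of the chart `φ`. -/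
def chartMetric (hφ : φ ∈ smoothAtlas d M) (G : OrientedMetric d M)
    (hU : (U : Set (Coord d)) ⊆ φ.target) : MetricData d (SmoothRing U) where
  D := der
  g := Matrix.of fun a b => SmoothRing.mk (fun y => gram φ G y a b)
    ((contDiffOn_gram hφ G a b).mono hU)
  h := Matrix.of fun a b => SmoothRing.mk (fun y => gramInv φ G y a b)
    ((contDiffOn_gramInv hφ G a b).mono hU)

/-- A smooth function in the chart `φ`. -/
def chartFn (hφ : φ ∈ smoothAtlas d M) (hU : (U : Set (Coord d)) ⊆ φ.target) {s : M → ℝ}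
    (hs : SmoothFn d s) : SmoothRing U :=
  SmoothRing.mk (s ∘ φ.symm) ((contDiffOn_comp_symm hφ hs).mono hU)

variable (hφ : φ ∈ smoothAtlas d M) (G : OrientedMetric d M)
  (hU : (U : Set (Coord d)) ⊆ φ.target)

theorem rep_g (a b : Fin d) : ((chartMetric hφ G hU).g a b).Rep fun y => gram φ G y a b :=
  fun _ => rfl

theorem rep_h (a b : Fin d) : ((chartMetric hφ G hU).h a b).Rep fun y => gramInv φ G y a b :=
  fun _ => rfl

theorem isMetric_chartMetric : (chartMetric hφ G hU).IsMetric where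
  comm a b r := der_comm a b r
  symm := Matrix.ext fun a b => SmoothRing.ext fun y => gram_symm G y b a
  mul := Matrix.ext fun a b => SmoothRing.ext fun y => by
    have h1 := congrFun (congrFun (gram_mul_gramInv hφ G (hU y.2)) a) b
    rw [Matrix.mul_apply] at h1 ⊢
    rw [Rep.sum (fun i => (rep_g hφ G hU a i).mul (rep_h hφ G hU i b)) y]
    refine h1.trans ?_
    by_cases h : a = b
    · subst h; simp
    · simp [h]

theorem rep_chr (c a b : Fin d) :
    ((chartMetric hφ G hU).chr c a b).Rep (christoffel φ G c a b) :=
  Rep.smul _ (Rep.sum fun e => (rep_h hφ G hU c e).mul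
    ((((rep_g hφ G hU b e).der a).add ((rep_g hφ G hU a e).der b)).sub
      ((rep_g hφ G hU a b).der e)))

theorem rep_scal : (chartMetric hφ G hU).scal.Rep (scalarCurv φ G) := by
  have h1 : ∀ a b c f, ((chartMetric hφ G hU).riem a b c f).Rep (riemann φ G a b c f) :=
    fun a b c f => (((rep_chr hφ G hU c b f).der a).sub ((rep_chr hφ G hU c a f).der b)).add
      (Rep.sum fun e => ((rep_chr hφ G hU c a e).mul (rep_chr hφ G hU e b f)).sub
        ((rep_chr hφ G hU c b e).mul (rep_chr hφ G hU e a f)))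
  exact Rep.sum fun a => Rep.sum fun b => (rep_h hφ G hU a b).mul (Rep.sum fun c => h1 c a c b)

theorem rep_inn {f : SmoothRing U} {s : M → ℝ} (hf : f.Rep (s ∘ φ.symm)) :
    ((chartMetric hφ G hU).inn f f).Rep (gradSq φ G s) :=
  Rep.sum fun a => Rep.sum fun b => ((rep_h hφ G hU a b).mul (hf.der a)).mul (hf.der b)

theorem rep_tsq {f : SmoothRing U} {s : M → ℝ} (hf : f.Rep (s ∘ φ.symm)) :
    ((chartMetric hφ G hU).tsq f).Rep (tractorSq φ G s) := by
  have h1 : ((chartMetric hφ G hU).lap f).Rep (laplacian φ G s) :=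
    Rep.sum fun a => Rep.sum fun b => (rep_h hφ G hU a b).mul
      (((hf.der b).der a).sub (Rep.sum fun c => (rep_chr hφ G hU c a b).mul (hf.der c)))
  have h2 : (chartMetric hφ G hU).schouten.Rep (schoutenTrace φ G) := fun y => by
    rw [schouten, (rep_scal hφ G hU).smul _ y, schoutenTrace, div_eq_inv_mul]
  have h3 : (2 : SmoothRing U).Rep (fun _ => 2) := fun _ => rfl
  exact (rep_inn hφ G hU hf).add ((h3.mul hf).mul ((h1.add (h2.mul hf)).smul _))

theorem rep_iterD (m : MetricData d (SmoothRing U)) (hm : m.D = der) {f : SmoothRing U}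
    {F : Coord d → ℝ} (hf : f.Rep F) (α : List (Fin d)) : (m.iterD α f).Rep (iterPd α F) := by
  induction α with
  | nil => exact hf
  | cons a α ih =>
    rw [iterD, hm]
    exact ih.der a

section Norm

variable {s : M → ℝ} (hs : SmoothFn d s)
  (hds : ∀ y ∈ U, differential d s (φ.symm y) ≠ 0)

/-- The function `|ds|⁻¹` in a chart. -/
def chartNorm : SmoothRing U :=
  SmoothRing.mk (fun y => (Real.sqrt (gradSq φ G s y))⁻¹) <| by
    have h0 : ∀ y ∈ U, 0 < gradSq φ G s y := fun y hy => gradSq_pos hφ G hs (hU hy) (hds y hy)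
    exact ((rep_inn hφ G hU (rep_mk _ ((contDiffOn_comp_symm hφ hs).mono hU))).smooth.sqrt
      fun y hy => (h0 y hy).ne').inv fun y hy => (Real.sqrt_pos.2 (h0 y hy)).ne'

theorem chartNorm_pos (y : U) : 0 < (chartNorm hφ G hU hs hds).1 y :=
  inv_pos.2 (Real.sqrt_pos.2 (gradSq_pos hφ G hs (hU y.2) (hds y y.2)))

theorem chartNorm_sq_mul : chartNorm hφ G hU hs hds ^ 2 *
    (chartMetric hφ G hU).inn (chartFn hφ hU hs) (chartFn hφ hU hs) = 1 := by
  refine SmoothRing.ext fun y => ?_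
  have h0 := gradSq_pos hφ G hs (hU y.2) (hds y y.2)
  have h1 := rep_inn hφ G hU (f := chartFn hφ hU hs) (rep_mk _ _) y
  change ((Real.sqrt (gradSq φ G s y))⁻¹) ^ 2 * _ = 1
  rw [h1, inv_pow, Real.sq_sqrt h0.le, inv_mul_cancel₀ h0.ne']

end Norm

/-! ### Universal polynomials in charts -/

open MvPolynomial in
/-- The inverse metric as a polynomial in the metric and the inverse of its determinant. -/
def LVar.toJet : LVar d → MvPolynomial (JetVar d) ℝ
  | .metric α b c => X (.metric α b c)
  | .inv b c => X .detInv * (Matrix.of fun b c => X (.metric [] b c)).adjugate b c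
  | .fn α => X (.fn α)
  | .normInv => X .normInv

/-- Two algebra homomorphisms to `ℝ` are compared on generators. Only the inverse metric is not
itself a jet variable; it is the adjugate times `(det g)⁻¹`. -/
theorem evalAt_aeval {s : M → ℝ} (hs : SmoothFn d s)
    (hds : ∀ y ∈ U, differential d s (φ.symm y) ≠ 0) (y : U)
    (q : MvPolynomial (LVar d) ℝ) :
    (MvPolynomial.aeval ((chartMetric hφ G hU).lval (chartFn hφ hU hs)
      (chartNorm hφ G hU hs hds)) q).1 y =
    MvPolynomial.eval (JetVar.value φ G s y) (MvPolynomial.aeval LVar.toJet q) := by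
  set m := chartMetric hφ G hU
  have h : (evalAt y).comp (MvPolynomial.aeval (m.lval (chartFn hφ hU hs)
      (chartNorm hφ G hU hs hds))) =
      (MvPolynomial.aeval (JetVar.value φ G s y)).comp (MvPolynomial.aeval LVar.toJet) := by
    refine MvPolynomial.algHom_ext fun i => ?_
    simp only [AlgHom.comp_apply, MvPolynomial.aeval_X]
    cases i with
    | metric α b c =>
      simp only [LVar.toJet, MvPolynomial.aeval_X]
      exact rep_iterD m rfl (rep_g hφ G hU b c) α y
    | inv b c =>
      have h1 : (MvPolynomial.aeval (JetVar.value φ G s y))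
          ((Matrix.of fun b c => (MvPolynomial.X (JetVar.metric [] b c) :
            MvPolynomial (JetVar d) ℝ)).adjugate b c) = (gram φ G y).adjugate b c := by
        have h2 := AlgHom.map_adjugate (MvPolynomial.aeval (JetVar.value φ G s (y : Coord d)))
          (Matrix.of fun b c => (MvPolynomial.X (JetVar.metric [] b c) :
            MvPolynomial (JetVar d) ℝ))
        have h3 := congrFun (congrFun h2 b) c
        refine h3.trans ?_
        exact congrArg (fun A : Matrix (Fin d) (Fin d) ℝ => A.adjugate b c)
          (Matrix.ext fun i j => by simp [JetVar.value, iterPd])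
      simp only [LVar.toJet, map_mul, MvPolynomial.aeval_X, h1]
      have h4 := rep_h hφ G hU b c y
      refine h4.trans ?_
      simp [gramInv, Matrix.inv_def, JetVar.value]
    | fn α =>
      simp only [LVar.toJet, MvPolynomial.aeval_X]
      exact rep_iterD m rfl (rep_mk _ _) α y
    | normInv =>
      simp only [LVar.toJet, MvPolynomial.aeval_X]
      rfl
  have h5 := DFunLike.congr_fun h q
  rw [AlgHom.comp_apply, AlgHom.comp_apply] at h5
  rw [← MvPolynomial.coe_aeval_eq_eval]
  exact h5

/-- The universal approximate unit defining density, in a chart. -/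
def unitVal (φ : OpenPartialHomeomorph M (Coord d)) (G : OrientedMetric d M) (s : M → ℝ)
    (y : Coord d) : ℝ :=
  MvPolynomial.eval (JetVar.value φ G s y) (MvPolynomial.aeval LVar.toJet (unitPoly d))

/-- The approximate unit defining density as an element of the algebra of a chart. -/
def chartUnit {s : M → ℝ} (hs : SmoothFn d s)
    (hds : ∀ y ∈ U, differential d s (φ.symm y) ≠ 0) : SmoothRing U :=
  (chartMetric hφ G hU).approx (chartFn hφ hU hs) (chartNorm hφ G hU hs hds) (d - 1)

theorem rep_chartUnit {s : M → ℝ} (hs : SmoothFn d s)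
    (hds : ∀ y ∈ U, differential d s (φ.symm y) ≠ 0) :
    (chartUnit hφ G hU hs hds).Rep (unitVal φ G s) := fun y => by
  have h1 := (isMetric_chartMetric hφ G hU).aeval_iterD_unitPoly
    (chartNorm_sq_mul hφ G hU hs hds) []
  rw [unitVal, ← evalAt_aeval hφ G hU hs hds y (unitPoly d)]
  exact congrArg (fun r : SmoothRing U => r.1 y) h1.symm

/-- This is the purpose of the free differential algebra: evaluation intertwines the formal
derivations with the partial derivatives, so all derivatives of the solution are again universal
polynomials in jets. -/
theorem iterPd_unitVal (hφ : φ ∈ smoothAtlas d M) (G : OrientedMetric d M)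
    (hU : (U : Set (Coord d)) ⊆ φ.target) {s : M → ℝ} (hs : SmoothFn d s)
    (hds : ∀ y ∈ U, differential d s (φ.symm y) ≠ 0) (y : U) (α : List (Fin d)) :
    iterPd α (unitVal φ G s) y = MvPolynomial.eval (JetVar.value φ G s y)
      (MvPolynomial.aeval LVar.toJet ((univ d).iterD α (unitPoly d))) := by
  have h1 := (isMetric_chartMetric hφ G hU).aeval_iterD_unitPoly
    (chartNorm_sq_mul hφ G hU hs hds) α
  rw [← evalAt_aeval hφ G hU hs hds y, h1]
  exact (rep_iterD (chartMetric hφ G hU) rfl (rep_chartUnit hφ G hU hs hds) α y).symm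

/-- The composition of a polynomial with the universal unit defining density. -/
def substUnit : JetVar d → MvPolynomial (JetVar d) ℝ
  | .fn α => MvPolynomial.aeval LVar.toJet ((univ d).iterD α (unitPoly d))
  | i => MvPolynomial.X i

theorem isOpen_regular (hφ : φ ∈ smoothAtlas d M) {s : M → ℝ} (hs : SmoothFn d s) :
    IsOpen (φ.target ∩ {y | differential d s (φ.symm y) ≠ 0}) := by
  have h1 : φ.target ∩ {y | differential d s (φ.symm y) ≠ 0} =
      ⋃ a, φ.target ∩ (fun y => pd a (s ∘ φ.symm) y) ⁻¹' {0}ᶜ := by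
    ext y
    simp only [Set.mem_inter_iff, Set.mem_ofPred_eq, Set.mem_iUnion, Set.mem_preimage,
      Set.mem_compl_iff, Set.mem_singleton_iff, exists_and_left]
    refine and_congr_right fun hy => ?_
    rw [Ne, differential_eq_zero_iff hφ hs hy, not_forall]
  rw [h1]
  refine isOpen_iUnion fun a => ContinuousOn.isOpen_inter_preimage ?_ φ.open_target
    isOpen_compl_singleton
  exact (contDiffOn_pd (U := ⟨φ.target, φ.open_target⟩) (contDiffOn_comp_symm hφ hs) a).continuousOn

/-- The points of a chart at which `ds` does not vanish. -/
def regular (hφ : φ ∈ smoothAtlas d M) {s : M → ℝ} (hs : SmoothFn d s) : Opens (Coord d) :=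
  ⟨φ.target ∩ {y | differential d s (φ.symm y) ≠ 0}, isOpen_regular hφ hs⟩

/-- Evaluation and substitution agree variable by variable. The variable `normInv` has to be
excluded, since `substUnit` leaves it alone while `|dt|` and `|ds|` differ in general. -/
theorem eval_substUnit (hφ : φ ∈ smoothAtlas d M) (G : OrientedMetric d M) {s t : M → ℝ} (hs : SmoothFn d s) {y : Coord d} (hy : y ∈ φ.target)
    (hds : differential d s (φ.symm y) ≠ 0) (ht : t ∘ φ.symm =ᶠ[𝓝 y] unitVal φ G s)
    {p : MvPolynomial (JetVar d) ℝ} (hp : JetVar.normInv ∉ p.vars) :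
    MvPolynomial.eval (JetVar.value φ G s y) (MvPolynomial.aeval substUnit p) =
      MvPolynomial.eval (JetVar.value φ G t y) p := by
  rw [← MvPolynomial.coe_aeval_eq_eval, ← MvPolynomial.coe_aeval_eq_eval, RingHom.coe_coe,
    RingHom.coe_coe, ← AlgHom.comp_apply]
  refine MvPolynomial.hom_congr_vars (f₁ := ((MvPolynomial.aeval (JetVar.value φ G s y)).comp
    (MvPolynomial.aeval substUnit) : MvPolynomial (JetVar d) ℝ →ₐ[ℝ] ℝ).toRingHom)
    (f₂ := (MvPolynomial.aeval (JetVar.value φ G t y)).toRingHom) ?_ ?_ rfl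
  · ext r; simp
  · intro i hi _
    simp only [AlgHom.toRingHom_eq_coe, RingHom.coe_coe, AlgHom.comp_apply, MvPolynomial.aeval_X]
    cases i with
    | metric α b c => simp [substUnit, JetVar.value]
    | detInv => simp [substUnit, JetVar.value]
    | fn α =>
      have h1 := iterPd_unitVal hφ G (U := regular hφ hs) Set.inter_subset_left hs
        (fun z hz => hz.2) ⟨y, hy, hds⟩ α
      have h2 := (iterPd_eventuallyEq ht α).eq_of_nhds
      simp only [substUnit, JetVar.value]
      rw [h2, h1, ← MvPolynomial.coe_aeval_eq_eval]
      rfl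
    | normInv => exact absurd hi hp
    | vol a => simp [substUnit, JetVar.value]

end ChartAlgebra

/-! ### Comparison of unit defining functions in a chart -/

section Comparison

set_option linter.unusedSectionVars false

open TopologicalSpace Filter Topology SmoothRing MetricData

variable {d : ℕ} {M : Type u} [TopologicalSpace M] [ChartedSpace (Coord d) M]
  [IsManifold (𝓡 d) ∞ M] {φ ψ : OpenPartialHomeomorph M (Coord d)} {U : Opens (Coord d)}

/-- The ideal of the functions on `U` that vanish on `Z`. -/
def vanIdeal (U : Opens (Coord d)) (Z : Set (Coord d)) : Ideal (SmoothRing U) where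
  carrier := {r | ∀ y : U, (y : Coord d) ∈ Z → r.1 y = 0}
  add_mem' {r r'} hr hr' y hy := by
    change r.1 y + r'.1 y = 0
    rw [hr y hy, hr' y hy, add_zero]
  zero_mem' _ _ := rfl
  smul_mem' c r hr y hy := by
    change c.1 y * r.1 y = 0
    rw [hr y hy, mul_zero]

/-- The differential of a function that vanishes on the hypersurface is a multiple of `ds`. -/
theorem exists_pd_eq_mul {F V : Coord d → ℝ} {y : Coord d} (hF : ContDiffAt ℝ ∞ F y)
    (hV : ContDiffAt ℝ ∞ V y) (hy : F y = 0) (hFV : ∀ᶠ z in 𝓝 y, F z = 0 → V z = 0)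
    (hd : ∃ a, pd a F y ≠ 0) : ∃ r : ℝ, ∀ a, pd a V y = r * pd a F y := by
  -- On the level set of `F` through `y` the function `V` is constant near `y`, hence trivially
  -- extremal there, and Lagrange multipliers apply.
  have hext : IsLocalExtrOn V {z | F z = F y} y := by
    refine Or.inl ?_
    filter_upwards [mem_nhdsWithin_of_mem_nhds hFV, self_mem_nhdsWithin] with z hz hz'
    rw [hFV.self_of_nhds hy, hz (hz'.trans hy)]
  obtain ⟨a, b, hab, h⟩ := hext.exists_multipliers_of_hasStrictFDerivAt_1d
    (hF.hasStrictFDerivAt (by simp)) (hV.hasStrictFDerivAt (by simp))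
  have h1 : ∀ c, a * pd c F y + b * pd c V y = 0 := fun c =>
    congrArg (fun L : Coord d →L[ℝ] ℝ => L (stdVec c)) h
  -- If `b = 0`, then `a dF = 0` with `dF ≠ 0`, so both multipliers would vanish.
  have hb : b ≠ 0 := by
    rintro rfl
    obtain ⟨c, hc⟩ := hd
    have h2 := h1 c
    simp only [zero_mul, add_zero, mul_eq_zero, hc, or_false] at h2
    exact hab (by rw [h2]; rfl)
  refine ⟨-(a / b), fun c => ?_⟩
  have := h1 c
  field_simp
  linarith

variable (hφ : φ ∈ smoothAtlas d M) (G : OrientedMetric d M)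
  (hU : (U : Set (Coord d)) ⊆ φ.target)

theorem tder_val_of_der {s : M → ℝ} (hs : SmoothFn d s)
    (hds : ∀ y ∈ U, differential d s (φ.symm y) ≠ 0) {f f' : SmoothRing U} {y : U} {r : ℝ}
    (h : ∀ a, (der a f').1 y = r * (der a f).1 y) :
    ((chartMetric hφ G hU).tder (chartFn hφ hU hs) (chartNorm hφ G hU hs hds) f').1 y =
      r * ((chartMetric hφ G hU).tder (chartFn hφ hU hs) (chartNorm hφ G hU hs hds) f).1 y := by
  set m := chartMetric hφ G hU
  have e : ∀ f, (m.tder (chartFn hφ hU hs) (chartNorm hφ G hU hs hds) f).1 y =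
      ∑ b, (m.tvec (chartFn hφ hU hs) (chartNorm hφ G hU hs hds) b).1 y * (der b f).1 y :=
    fun f => by
      rw [tder_apply, ← evalAt_apply, map_sum]
      exact Finset.sum_congr rfl fun _ _ => map_mul _ _ _
  rw [e, e]
  simp only [h, mul_left_comm _ r, ← Finset.mul_sum]

/-- The conormal law holds pointwise: at a zero of `s`, `dv = r ds`, and `T s = 1` identifies `r`
with `T v`. -/
theorem isHypersurface_chart {s : M → ℝ} {S : Set M} (hs : IsDefiningFunction d s S)
    (hds : ∀ y ∈ U, differential d s (φ.symm y) ≠ 0) :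
    (chartMetric hφ G hU).IsHypersurface (vanIdeal U (φ.symm ⁻¹' S)) (chartFn hφ hU hs.1)
      (chartNorm hφ G hU hs.1 hds) := by
  have hS : ∀ x, x ∈ S ↔ s x = 0 := fun x => by rw [hs.2.1]; rfl
  refine ⟨isMetric_chartMetric hφ G hU, fun y hy => (hS _).1 hy, chartNorm_sq_mul hφ G hU hs.1 hds,
    fun v hv a y hy => ?_⟩
  set m := chartMetric hφ G hU
  set N := chartNorm hφ G hU hs.1 hds
  have hF : (chartFn hφ hU hs.1).Rep (s ∘ φ.symm) := fun _ => rfl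
  obtain ⟨r, hr⟩ : ∃ r : ℝ, ∀ a, pd a v.out y = r * pd a (s ∘ φ.symm) y := by
    refine exists_pd_eq_mul (hF.smooth.contDiffAt (U.isOpen.mem_nhds y.2))
      (v.out_smooth.contDiffAt (U.isOpen.mem_nhds y.2)) ((hS _).1 hy) ?_ ?_
    · filter_upwards [U.isOpen.mem_nhds y.2] with z hz h0
      rw [← v.rep_out ⟨z, hz⟩]
      exact hv ⟨z, hz⟩ ((hS _).2 h0)
    · by_contra! h
      exact hds y y.2 ((differential_eq_zero_iff hφ hs.1 (hU y.2)).2 h)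
  have h1 : ∀ a, (m.D a v).1 y = r * (m.D a (chartFn hφ hU hs.1)).1 y := fun a => by
    rw [show m.D a = der a from rfl, v.rep_out.der a y, hF.der a y, hr]
  have h2 : (m.tder (chartFn hφ hU hs.1) N v).1 y = r := by
    have h3 := tder_val_of_der hφ G hU hs.1 hds h1
    have h4 : m.tder (chartFn hφ hU hs.1) N (chartFn hφ hU hs.1) = 1 := by
      rw [tder_eq_inn, chartNorm_sq_mul]
    rw [h4] at h3
    exact h3.trans (mul_one r)
  change (m.D a v).1 y - (m.D a (chartFn hφ hU hs.1)).1 y *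
    (m.tder (chartFn hφ hU hs.1) N v).1 y = 0
  rw [h1, h2]
  ring

theorem chartUnit_spec (hd : 1 ≤ d) {s : M → ℝ} {S : Set M} (hs : IsDefiningFunction d s S)
    (hds : ∀ y ∈ U, differential d s (φ.symm y) ≠ 0) :
    chartUnit hφ G hU hs.1 hds ∈ vanIdeal U (φ.symm ⁻¹' S) ∧
    (chartMetric hφ G hU).tder (chartFn hφ hU hs.1) (chartNorm hφ G hU hs.1 hds)
      (chartUnit hφ G hU hs.1 hds) - chartNorm hφ G hU hs.1 hds ∈ vanIdeal U (φ.symm ⁻¹' S) ∧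
    (chartMetric hφ G hU).tsq (chartUnit hφ G hU hs.1 hds) - 1 ∈ Ord (vanIdeal U (φ.symm ⁻¹' S))
      ((chartMetric hφ G hU).tder (chartFn hφ hU hs.1) (chartNorm hφ G hU hs.1 hds)) d := by
  have h := (isHypersurface_chart hφ G hU hs hds).approx_spec (d - 1) (by omega)
  rwa [Nat.sub_add_cancel hd] at h

/-- On the hypersurface the differential is conormal, and its transverse derivative there is `N`. -/
theorem der_chartUnit (hd : 1 ≤ d) {s : M → ℝ} {S : Set M} (hs : IsDefiningFunction d s S)
    (hds : ∀ y ∈ U, differential d s (φ.symm y) ≠ 0) (y : U) (hy : φ.symm y ∈ S) (a : Fin d) :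
    (der a (chartUnit hφ G hU hs.1 hds)).1 y =
      (chartNorm hφ G hU hs.1 hds).1 y * (der a (chartFn hφ hU hs.1)).1 y := by
  obtain ⟨h1, h2, -⟩ := chartUnit_spec hφ G hU hd hs hds
  have h3 := (isHypersurface_chart hφ G hU hs hds).conormal _ h1 a y hy
  have h4 := h2 y hy
  set m := chartMetric hφ G hU
  set f := chartUnit hφ G hU hs.1 hds
  set N := chartNorm hφ G hU hs.1 hds
  change (der a f).1 y - (der a (chartFn hφ hU hs.1)).1 y *
    (m.tder (chartFn hφ hU hs.1) N f).1 y = 0 at h3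
  change (m.tder (chartFn hφ hU hs.1) N f).1 y - N.1 y = 0 at h4
  linear_combination h3 + (der a (chartFn hφ hU hs.1)).1 y * h4

/-- A unit defining function has the same `d`-jet along the hypersurface as the universal one. -/
theorem iterPd_eq_unitVal (hd : 1 ≤ d) {s : M → ℝ} {S : Set M} (hs : IsDefiningFunction d s S)
    (hds : ∀ y ∈ U, differential d s (φ.symm y) ≠ 0) {f : SmoothRing U}
    (hf : f ∈ vanIdeal U (φ.symm ⁻¹' S))
    (hf1 : (chartMetric hφ G hU).tsq f - 1 ∈ Ord (vanIdeal U (φ.symm ⁻¹' S))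
      ((chartMetric hφ G hU).tder (chartFn hφ hU hs.1) (chartNorm hφ G hU hs.1 hds)) d)
    (hpos : ∀ y : U, φ.symm y ∈ S → ∃ r : ℝ, 0 < r ∧
      ∀ a, (der a f).1 y = r * (der a (chartFn hφ hU hs.1)).1 y)
    {F : Coord d → ℝ} (hF : f.Rep F) {y : Coord d} (hy : y ∈ U) (hyS : φ.symm y ∈ S)
    (α : List (Fin d)) (hα : α.length ≤ d) :
    iterPd α F y = iterPd α (unitVal φ G s) y := by
  set m := chartMetric hφ G hU with hm
  have H := isHypersurface_chart hφ G hU hs hds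
  obtain ⟨h1, h2, h3⟩ := chartUnit_spec hφ G hU hd hs hds
  set N := chartNorm hφ G hU hs.1 hds with hN
  set T := m.tder (chartFn hφ hU hs.1) N with hT
  -- On the hypersurface `|ds|² (T f)² = 1`, so `T f = ±N`; positivity of `r` selects the sign, and
  -- `chartUnit` has transverse derivative `N` as well.
  have h4 : T f - T (chartUnit hφ G hU hs.1 hds) ∈ vanIdeal U (φ.symm ⁻¹' S) := by
    have e1 := (vanIdeal U (φ.symm ⁻¹' S)).sub_mem (mem_ord_one.1 (ord_anti hd hf1)) (H.tsq_sub hf)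
    have e2 : T f - N ∈ vanIdeal U (φ.symm ⁻¹' S) := fun y hy => by
      have e3 := e1 y hy
      have e4 := congrArg (fun r : SmoothRing U => r.1 y) H.norm
      change N.1 y ^ 2 * (m.inn (chartFn hφ hU hs.1) (chartFn hφ hU hs.1)).1 y = 1 at e4
      change (m.tsq f).1 y - 1 - ((m.tsq f).1 y -
        (m.inn (chartFn hφ hU hs.1) (chartFn hφ hU hs.1)).1 y * (T f).1 y ^ 2) = 0 at e3
      change (T f).1 y - N.1 y = 0
      have e5 : (T f).1 y ^ 2 = N.1 y ^ 2 := by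
        linear_combination N.1 y ^ 2 * e3 - ((T f).1 y ^ 2) * e4
      rw [sub_eq_zero]
      have e7 : 0 < (T f).1 y := by
        obtain ⟨r, hr, hr'⟩ := hpos y hy
        have e8 := tder_val_of_der hφ G hU hs.1 hds hr'
        rw [← hT, H.tder_self] at e8
        rw [e8]
        simpa using hr
      exact (pow_left_inj₀ e7.le (chartNorm_pos hφ G hU hs.1 hds y).le two_ne_zero).1 e5
    have e6 := (vanIdeal U (φ.symm ⁻¹' S)).sub_mem e2 h2
    convert e6 using 1
    ring
  -- Agreement up to order `d + 1` kills all partial derivatives of length at most `d` of the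
  -- difference.
  have h5 := H.iterD_mem (H.unit_unique hd h1 hf h3 hf1 h4) α hα ⟨y, hy⟩ hyS
  have hr := rep_chartUnit hφ G hU hs.1 hds
  rw [rep_iterD m rfl (hF.sub hr) α ⟨y, hy⟩] at h5
  have h6 : ∀ (α : List (Fin d)) (z : U), iterPd α (fun z => F z - unitVal φ G s z) z =
      iterPd α F z - iterPd α (unitVal φ G s) z := fun α z => by
    rw [← rep_iterD m rfl (hF.sub hr) α z, ← rep_iterD m rfl hF α z, ← rep_iterD m rfl hr α z]
    have : m.iterD α (f - chartUnit hφ G hU hs.1 hds) =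
        m.iterD α f - m.iterD α (chartUnit hφ G hU hs.1 hds) := by
      induction α with
      | nil => rfl
      | cons a α ih => simp only [iterD, ih, map_sub]
    rw [this]
    rfl
  rw [h6 α ⟨y, hy⟩, sub_eq_zero] at h5
  exact h5

end Comparison

/-! ### Independence of the chart -/

section Invariance

theorem differential_ne_zero_congr {d : ℕ} {M : Type u} [TopologicalSpace M]
    [ChartedSpace (Coord d) M] {s : M → ℝ} {x x' : M} (h : x = x') :
    differential d s x ≠ 0 ↔ differential d s x' ≠ 0 := by
  subst h; rfl

open TopologicalSpace Filter Topology SmoothRing MetricData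

variable {d : ℕ} {M : Type u} [TopologicalSpace M] [ChartedSpace (Coord d) M]
  [IsManifold (𝓡 d) ∞ M] {φ ψ : OpenPartialHomeomorph M (Coord d)}

/-- Transition functions are changes of coordinates. -/
theorem exists_isChange (hφ : φ ∈ smoothAtlas d M) (hψ : ψ ∈ smoothAtlas d M)
    (G : OrientedMetric d M) {U V : Opens (Coord d)} (hU : (U : Set (Coord d)) ⊆ φ.target)
    (hV : (V : Set (Coord d)) ⊆ ψ.target) (hUψ : ∀ y ∈ U, φ.symm y ∈ ψ.source)
    (hτ : ContDiffOn ℝ ∞ (ψ ∘ φ.symm) U) (hUV : Set.MapsTo (ψ ∘ φ.symm) U V) :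
    ∃ J K, IsChange (chartMetric hψ G hV) (chartMetric hφ G hU)
      (pullback (ψ ∘ φ.symm) hτ hUV) J K := by
  have hτi : ∀ i, ContDiffOn ℝ ∞ (fun z => (ψ (φ.symm z)) i) U := fun i =>
    (PiLp.proj (𝕜 := ℝ) 2 (fun _ : Fin d => ℝ) i).contDiff.comp_contDiffOn hτ
  have hσ : ∀ a, ContDiffOn ℝ ∞ (fun z => (φ (ψ.symm z)) a) (ψ.target ∩ ψ.symm ⁻¹' φ.source) :=
    fun a => (PiLp.proj (𝕜 := ℝ) 2 (fun _ : Fin d => ℝ) a).contDiff.comp_contDiffOn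
      (contDiffOn_transition hψ hφ)
  have hK : ∀ a j, ContDiffOn ℝ ∞
      (fun y => pd j (fun z => (φ (ψ.symm z)) a) (ψ (φ.symm y))) U := fun a j =>
    (contDiffOn_pd (U := ⟨_, isOpen_transition_source ψ φ⟩) (hσ a) j).comp hτ fun y hy =>
      ⟨hV (hUV hy), by
        simpa [ψ.left_inv (hUψ y hy)] using φ.map_target (hU hy)⟩
  set J : Matrix (Fin d) (Fin d) (SmoothRing U) := Matrix.of fun i a =>
    SmoothRing.mk (pd a (fun z => (ψ (φ.symm z)) i)) (contDiffOn_pd (hτi i) a)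
  have hJ : ∀ i a, (J i a).Rep (pd a (fun z => (ψ (φ.symm z)) i)) := fun i a _ => rfl
  set K : Matrix (Fin d) (Fin d) (SmoothRing U) := Matrix.of fun a j => SmoothRing.mk _ (hK a j)
  have hKr : ∀ a j, (K a j).Rep fun y => pd j (fun z => (φ (ψ.symm z)) a) (ψ (φ.symm y)) :=
    fun a j _ => rfl
  refine ⟨J, K, ⟨fun a f => ?_, fun a b i => ?_, ?_, ?_⟩⟩
  · exact der_pullback _ hτ hUV f a (fun i => J i a) fun i => hJ i a
  · refine SmoothRing.ext fun y => ?_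
    refine ((hJ i b).der a y).trans (Eq.trans ?_ ((hJ i a).der b y).symm)
    exact pd_comm ((hτi i).contDiffAt (U.isOpen.mem_nhds y.2)) a b
  · refine Matrix.ext fun i j => SmoothRing.ext fun y => ?_
    rw [Matrix.mul_apply, Rep.sum (fun a => (hJ i a).mul (hKr a j)) y]
    refine (jacobian_mul hφ hψ (hU y.2) (hUψ y y.2) i j).trans ?_
    by_cases h : i = j
    · subst h; simp
    · simp [h]
  · refine Matrix.ext fun a b => SmoothRing.ext fun y => ?_
    refine (gram_transition hφ hψ G (hU y.2) (hUψ y y.2) a b).trans ?_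
    simp only [Matrix.mul_apply, Matrix.transpose_apply, Matrix.map_apply]
    have h1 : ∀ i j, (pullback (ψ ∘ φ.symm) hτ hUV ((chartMetric hψ G hV).g i j)).Rep
        ((fun y => gram ψ G y i j) ∘ (ψ ∘ φ.symm)) := fun i j =>
      rep_pullback _ hτ hUV (rep_g hψ G hV i j)
    rw [Rep.sum (fun j => (Rep.sum fun i => (hJ i a).mul (h1 i j)).mul (hJ j b)) y]
    simp only [Finset.sum_mul]
    rw [Finset.sum_comm]
    rfl

/-- Pullback along the transition function takes `s` and `|ds|⁻¹` in one chart to those in the other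
and commutes with `approx`, because `I²` is independent of the coordinates. -/
theorem unitVal_transition (hφ : φ ∈ smoothAtlas d M) (hψ : ψ ∈ smoothAtlas d M)
    (G : OrientedMetric d M) {s : M → ℝ} (hs : SmoothFn d s) {x : M} (hxφ : x ∈ φ.source)
    (hxψ : x ∈ ψ.source) (hds : differential d s x ≠ 0) :
    unitVal φ G s (φ x) = unitVal ψ G s (ψ x) := by
  set U : Opens (Coord d) := regular hφ hs ⊓ ⟨_, isOpen_transition_source φ ψ⟩
  have hU : (U : Set (Coord d)) ⊆ φ.target := fun y hy => hy.1.1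
  have hUd : ∀ y ∈ U, differential d s (φ.symm y) ≠ 0 := fun y hy => hy.1.2
  have hUψ : ∀ y ∈ U, φ.symm y ∈ ψ.source := fun y hy => hy.2.2
  have hV : (regular hψ hs : Set (Coord d)) ⊆ ψ.target := fun y hy => hy.1
  have hVd : ∀ y ∈ regular hψ hs, differential d s (ψ.symm y) ≠ 0 := fun y hy => hy.2
  have hτ : ContDiffOn ℝ ∞ (ψ ∘ φ.symm) U := (contDiffOn_transition hφ hψ).mono fun y hy => hy.2
  have hUV : Set.MapsTo (ψ ∘ φ.symm) U (regular hψ hs) := fun y hy =>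
    ⟨ψ.map_source (hUψ y hy), (differential_ne_zero_congr (ψ.left_inv (hUψ y hy))).2 (hUd y hy)⟩
  obtain ⟨J, K, hc⟩ := exists_isChange hφ hψ G hU hV hUψ hτ hUV
  set π := pullback (ψ ∘ φ.symm) hτ hUV
  have hm := isMetric_chartMetric hφ G hU
  have hn := isMetric_chartMetric hψ G hV
  have hs1 : π (chartFn hψ hV hs) = chartFn hφ hU hs := SmoothRing.ext fun y =>
    congrArg s (ψ.left_inv (hUψ y y.2))
  have hN : π (chartNorm hψ G hV hs hVd) = chartNorm hφ G hU hs hUd := SmoothRing.ext fun y => by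
    have h1 := congrArg (fun r : SmoothRing U => r.1 y)
      (hc.inn_eq hm hn (chartFn hψ hV hs) (chartFn hψ hV hs))
    have h2 : gradSq φ G s y = gradSq ψ G s (ψ (φ.symm y)) := by
      rw [hs1] at h1
      rw [← rep_inn hφ G hU (f := chartFn hφ hU hs) (fun _ => rfl) y]
      exact h1.trans (rep_inn hψ G hV (f := chartFn hψ hV hs) (fun _ => rfl) ⟨_, hUV y.2⟩)
    change (Real.sqrt (gradSq ψ G s (ψ (φ.symm y))))⁻¹ = (Real.sqrt (gradSq φ G s y))⁻¹
    rw [h2]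
  have h3 := hc.map_approx hm hn (chartFn hψ hV hs) (chartNorm hψ G hV hs hVd) (d - 1)
  rw [hs1, hN] at h3
  have hy : φ x ∈ U := ⟨⟨φ.map_source hxφ,
    (differential_ne_zero_congr (φ.left_inv hxφ)).2 hds⟩, φ.map_source hxφ, by
    simpa only [Set.mem_preimage, φ.left_inv hxφ] using hxψ⟩
  have h4 := congrArg (fun r : SmoothRing U => r.1 ⟨φ x, hy⟩) h3
  have h5 := rep_chartUnit hφ G hU hs hUd ⟨φ x, hy⟩
  have h6 := rep_chartUnit hψ G hV hs hVd ⟨_, hUV hy⟩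
  rw [← h5]
  refine h4.symm.trans (h6.trans ?_)
  simp only [Function.comp, φ.left_inv hxφ]

/-- `t` is a smooth function that agrees near `x` with the universal unit defining density. -/
def IsUnitExtension (G : OrientedMetric d M) (s : M → ℝ) (x : M) (t : M → ℝ) : Prop :=
  SmoothFn d t ∧ ∀ φ ∈ smoothAtlas d M, x ∈ φ.source → t ∘ φ.symm =ᶠ[𝓝 (φ x)] unitVal φ G s

/-- `P` takes functions on all of `M`, whereas the universal solution lives where `ds ≠ 0`. A bump
function supported there extends it, and chart independence gives the agreement in every chart
around `x`. -/
theorem exists_isUnitExtension [T2Space M] (G : OrientedMetric d M) {s : M → ℝ}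
    (hs : SmoothFn d s) {x : M} (hds : differential d s x ≠ 0) :
    ∃ t, IsUnitExtension G s x t := by
  set χ := chartAt (Coord d) x with hχ'
  have hχ : χ ∈ smoothAtlas d M := IsManifold.chart_mem_maximalAtlas x
  have hx : x ∈ χ.source := mem_chart_source _ x
  set u : M → ℝ := fun z => unitVal χ G s (χ z)
  set W : Set M := χ.source ∩ χ ⁻¹' (regular hχ hs) with hW
  have hWo : IsOpen W := χ.isOpen_inter_preimage (regular hχ hs).isOpen
  have hxW : x ∈ W := ⟨hx, χ.map_source hx,
    (differential_ne_zero_congr (χ.left_inv hx)).2 hds⟩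
  have hu : ContMDiffOn (𝓡 d) 𝓘(ℝ, ℝ) ∞ u W := by
    have h1 : ContDiffOn ℝ ∞ (unitVal χ G s) (regular hχ hs) :=
      (rep_chartUnit hχ G (U := regular hχ hs) (fun y hy => hy.1) hs fun y hy => hy.2).smooth
    exact h1.contMDiffOn.comp ((contMDiffOn_of_mem_maximalAtlas hχ).mono fun z hz => hz.1)
      fun z hz => hz.2
  obtain ⟨f, -, hf⟩ := (SmoothBumpFunction.nhds_basis_tsupport (I := 𝓡 d) x).mem_iff.1
    (hWo.mem_nhds hxW)
  refine ⟨fun z => f z * u z, ?_, fun φ hφ hxφ => ?_⟩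
  · refine contMDiff_of_tsupport fun z hz => ?_
    have hzW : z ∈ W := hf (tsupport_mul_subset_left hz)
    exact (f.contMDiff z).mul (hu.contMDiffAt (hWo.mem_nhds hzW))
  · have h1 : ∀ᶠ z in 𝓝 x, f z = 1 ∧ z ∈ W ∧ z ∈ φ.source := by
      filter_upwards [f.eventuallyEq_one, hWo.mem_nhds hxW, φ.open_source.mem_nhds hxφ] with
        z h1 h2 h3 using ⟨h1, h2, h3⟩
    have h2 : Tendsto φ.symm (𝓝 (φ x)) (𝓝 x) := by
      have := φ.continuousAt_symm (φ.map_source hxφ)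
      rwa [ContinuousAt, φ.left_inv hxφ] at this
    filter_upwards [h2.eventually h1, φ.open_target.mem_nhds (φ.map_source hxφ)] with y hy hy'
    have h3 := unitVal_transition hφ hχ G hs hy.2.2 hy.2.1.1
      ((differential_ne_zero_congr (χ.left_inv hy.2.1.1)).1 hy.2.1.2.2)
    simp only [Function.comp, hy.1, one_mul, u]
    rw [← h3, φ.right_inv hy']

end Invariance

/-! ### Jets of unit defining densities along the hypersurface -/

section Jets

set_option linter.unusedSectionVars false

open TopologicalSpace Filter Topology SmoothRing MetricData

variable {d : ℕ} {M : Type u} [TopologicalSpace M] [ChartedSpace (Coord d) M]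
  [IsManifold (𝓡 d) ∞ M]

theorem IsDefiningFunction.mem_iff {s : M → ℝ} {S : Set M} (hs : IsDefiningFunction d s S)
    (x : M) : x ∈ S ↔ s x = 0 := by
  rw [hs.2.1]; rfl

theorem mem_regular {φ : OpenPartialHomeomorph M (Coord d)} (hφ : φ ∈ smoothAtlas d M)
    {s : M → ℝ} (hs : SmoothFn d s) {x : M} (hx : x ∈ φ.source) (hds : differential d s x ≠ 0) :
    φ x ∈ regular hφ hs :=
  ⟨φ.map_source hx, (differential_ne_zero_congr (φ.left_inv hx)).2 hds⟩

/-- A unit extension vanishes along the hypersurface to first order only. -/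
theorem IsUnitExtension.eq_zero_and_differential_ne_zero (hd : 1 ≤ d) {G : OrientedMetric d M}
    {s t : M → ℝ} {S : Set M} (hs : IsDefiningFunction d s S) {x : M} (hx : x ∈ S)
    (ht : IsUnitExtension G s x t) : t x = 0 ∧ differential d t x ≠ 0 := by
  set φ := chartAt (Coord d) x
  have hφ : φ ∈ smoothAtlas d M := IsManifold.chart_mem_maximalAtlas x
  have hxφ : x ∈ φ.source := mem_chart_source _ x
  have hy := mem_regular hφ hs.1 hxφ (hs.2.2 x hx)
  have hyS : φ.symm (φ x) ∈ S := by rwa [φ.left_inv hxφ]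
  have hU : (regular hφ hs.1 : Set (Coord d)) ⊆ φ.target := fun y hy => hy.1
  have hds : ∀ y ∈ regular hφ hs.1, differential d s (φ.symm y) ≠ 0 := fun y hy => hy.2
  have htφ := ht.2 φ hφ hxφ
  constructor
  · have h1 := (chartUnit_spec hφ G hU hd hs hds).1 ⟨φ x, hy⟩ hyS
    rw [rep_chartUnit hφ G hU hs.1 hds ⟨φ x, hy⟩, ← htφ.eq_of_nhds] at h1
    rwa [Function.comp, φ.left_inv hxφ] at h1
  · refine (differential_ne_zero_congr (φ.left_inv hxφ)).1 fun h => ?_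
    refine hds _ hy ((differential_eq_zero_iff hφ hs.1 (hU hy)).2 fun a => ?_)
    have h1 := (differential_eq_zero_iff hφ ht.1 (hU hy)).1 h a
    have h2 := der_chartUnit hφ G hU hd hs hds ⟨φ x, hy⟩ hyS a
    rw [(rep_chartUnit hφ G hU hs.1 hds).der a, ← pd_congr htφ, h1,
      Rep.der (F := s ∘ φ.symm) (fun _ => rfl) a] at h2
    exact (mul_eq_zero.1 h2.symm).resolve_left
      (chartNorm_pos hφ G hU hs.1 hds ⟨φ x, hy⟩).ne'

theorem exists_pd_eq_of_compatiblyOriented {φ : OpenPartialHomeomorph M (Coord d)}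
    (hφ : φ ∈ smoothAtlas d M) {s s' : M → ℝ} {S : Set M} (hs : SmoothFn d s)
    (hs' : SmoothFn d s') (h : CompatiblyOriented d s s' S) {y : Coord d} (hy : y ∈ φ.target)
    (hyS : φ.symm y ∈ S) :
    ∃ r : ℝ, 0 < r ∧ ∀ a, pd a (s ∘ φ.symm) y = r * pd a (s' ∘ φ.symm) y := by
  obtain ⟨r, hr, h1⟩ := h _ hyS
  refine ⟨r⁻¹, inv_pos.2 hr, fun a => ?_⟩
  rw [pd_comp_symm hφ hs hy, pd_comp_symm hφ hs' hy, h1, _root_.smul_apply, smul_eq_mul,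
    inv_mul_cancel_left₀ hr.ne']

/-- A conformal unit defining density has the same `d`-jet along the hypersurface as the universal
one. -/
theorem sameJet_of_isConformalUnit (hd : 1 ≤ d) {G : OrientedMetric d M} {σ s t : M → ℝ}
    {S : Set M} (hσ : IsConformalUnit G σ S) (hs : IsDefiningFunction d s S)
    (hor : CompatiblyOriented d σ s S) {x : M} (hx : x ∈ S) (ht : IsUnitExtension G s x t) :
    SameJet d d t σ x := by
  intro φ hφ hxφ α hα
  obtain ⟨hσ0, A, hA, hσA⟩ := hσ
  have hU : (regular hφ hs.1 : Set (Coord d)) ⊆ φ.target := fun y hy => hy.1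
  have hds : ∀ y ∈ regular hφ hs.1, differential d s (φ.symm y) ≠ 0 := fun y hy => hy.2
  rw [(iterPd_eventuallyEq (ht.2 φ hφ hxφ) α).eq_of_nhds]
  have hσI : chartFn hφ hU hσ0.1 ∈ vanIdeal (regular hφ hs.1) (φ.symm ⁻¹' S) :=
    fun y hy => (hσ0.mem_iff _).1 hy
  refine (iterPd_eq_unitVal hφ G hU hd hs hds hσI ?_ (fun y hy => ?_)
    (fun _ => rfl) (mem_regular hφ hs.1 hxφ (hs.2.2 x hx)) (by rwa [φ.left_inv hxφ]) α hα).symm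
  -- Here `I² - 1 = A σ^d`, and `σ` lies in the ideal, so the error has order `d`.
  · have h1 : (chartMetric hφ G hU).tsq (chartFn hφ hU hσ0.1) - 1 =
        chartFn hφ hU hA * chartFn hφ hU hσ0.1 ^ d := SmoothRing.ext fun y => by
      have h2 := rep_tsq hφ G hU (f := chartFn hφ hU hσ0.1) (s := σ) (fun _ => rfl) y
      have h3 := hσA φ hφ (φ.symm y) (φ.map_target (hU y.2))
      rw [φ.right_inv (hU y.2)] at h3
      change ((chartMetric hφ G hU).tsq (chartFn hφ hU hσ0.1)).1 y - 1 =
        A (φ.symm y) * σ (φ.symm y) ^ d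
      rw [h2, h3]
      ring
    rw [h1]
    exact ord_mul_left _ (ord_pow hσI d)
  · exact exists_pd_eq_of_compatiblyOriented hφ hσ0.1 hs.1 hor (hU y.2) hy |>.imp
      fun r hr => ⟨hr.1, fun a => by
        rw [Rep.der (F := σ ∘ φ.symm) (fun _ => rfl) a y,
          Rep.der (F := s ∘ φ.symm) (fun _ => rfl) a y, hr.2 a]⟩

/-- The `d`-jet of the universal unit defining density along the hypersurface only depends on the
oriented hypersurface. -/
theorem sameJet_of_compatiblyOriented (hd : 1 ≤ d) {G : OrientedMetric d M} {s s' t t' : M → ℝ}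
    {S : Set M} (hs : IsDefiningFunction d s S) (hs' : IsDefiningFunction d s' S)
    (hor : CompatiblyOriented d s s' S) {x : M} (hx : x ∈ S) (ht : IsUnitExtension G s x t)
    (ht' : IsUnitExtension G s' x t') : SameJet d d t t' x := by
  intro φ hφ hxφ α hα
  set U := regular hφ hs.1 ⊓ regular hφ hs'.1
  have hU : (U : Set (Coord d)) ⊆ φ.target := fun y hy => hy.1.1
  have hds : ∀ y ∈ U, differential d s (φ.symm y) ≠ 0 := fun y hy => hy.1.2
  have hds' : ∀ y ∈ U, differential d s' (φ.symm y) ≠ 0 := fun y hy => hy.2.2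
  rw [(iterPd_eventuallyEq (ht.2 φ hφ hxφ) α).eq_of_nhds,
    (iterPd_eventuallyEq (ht'.2 φ hφ hxφ) α).eq_of_nhds]
  obtain ⟨h1, -, h3⟩ := chartUnit_spec hφ G hU hd hs hds
  -- The solution made from `s` is a competitor for the one made from `s'`. Its error was measured
  -- with the transverse derivation of `s`; `ord_subset` transfers the order to that of `s'`.
  refine iterPd_eq_unitVal hφ G hU hd hs' hds' h1
    ((isHypersurface_chart hφ G hU hs hds).ord_subset rfl _ _ h3) (fun y hy => ?_)
    (rep_chartUnit hφ G hU hs.1 hds) ⟨mem_regular hφ hs.1 hxφ (hs.2.2 x hx),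
      mem_regular hφ hs'.1 hxφ (hs'.2.2 x hx)⟩ (by rwa [φ.left_inv hxφ]) α hα
  obtain ⟨r, hr, h4⟩ := exists_pd_eq_of_compatiblyOriented hφ hs.1 hs'.1 hor (hU y.2) hy
  refine ⟨(chartNorm hφ G hU hs.1 hds).1 y * r,
    mul_pos (chartNorm_pos hφ G hU hs.1 hds y) hr, fun a => ?_⟩
  rw [der_chartUnit hφ G hU hd hs hds y hy a, Rep.der (F := s ∘ φ.symm) (fun _ => rfl) a y,
    Rep.der (F := s' ∘ φ.symm) (fun _ => rfl) a y, h4 a]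
  ring

theorem chartMetric_rescaling {φ : OpenPartialHomeomorph M (Coord d)} {U : Opens (Coord d)}
    (hφ : φ ∈ smoothAtlas d M) (hU : (U : Set (Coord d)) ⊆ φ.target) {G G' : OrientedMetric d M}
    {Ω : M → ℝ} (h : IsRescaling Ω G G') :
    ∃ W, chartFn hφ hU h.1 * W = 1 ∧
      chartMetric hφ G' hU = (chartMetric hφ G hU).conf (chartFn hφ hU h.1) W := by
  have hW : SmoothFn d (fun x => (Ω x)⁻¹) := fun x => (h.1 x).inv₀ (h.2.1 x).ne'
  refine ⟨chartFn hφ hU hW, SmoothRing.ext fun y => mul_inv_cancel₀ (h.2.1 (φ.symm y)).ne', ?_⟩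
  have hg : ∀ y, gram φ G' y = Ω (φ.symm y) ^ 2 • gram φ G y := fun y =>
    Matrix.ext fun a b => h.2.2.1 _ _ _
  have hh : ∀ y ∈ φ.target, gramInv φ G' y = (Ω (φ.symm y))⁻¹ ^ 2 • gramInv φ G y := by
    intro y hy
    refine Matrix.inv_eq_right_inv ?_
    rw [hg, Matrix.smul_mul, Matrix.mul_smul, gram_mul_gramInv hφ G hy, smul_smul, ← mul_pow,
      mul_inv_cancel₀ (h.2.1 _).ne', one_pow, one_smul]
  refine congrArg₂ (MetricData.mk der) (Matrix.ext fun a b => SmoothRing.ext fun y => ?_)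
    (Matrix.ext fun a b => SmoothRing.ext fun y => ?_)
  · exact congrFun (congrFun (hg y) a) b
  · exact congrFun (congrFun (hh y (hU y.2)) a) b

/-- The `d`-jet of the universal unit defining density along the hypersurface is conformally
covariant. -/
theorem sameJet_of_isRescaling (hd : 2 ≤ d) {G G' : OrientedMetric d M} {Ω s t t' : M → ℝ}
    {S : Set M} (h : IsRescaling Ω G G') (hs : IsDefiningFunction d s S) {x : M} (hx : x ∈ S)
    (ht : IsUnitExtension G s x t) (ht' : IsUnitExtension G' s x t') :
    SameJet d d t' (fun z => Ω z * t z) x := by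
  intro φ hφ hxφ α hα
  have hd1 : 1 ≤ d := by omega
  have hU : (regular hφ hs.1 : Set (Coord d)) ⊆ φ.target := fun y hy => hy.1
  have hds : ∀ y ∈ regular hφ hs.1, differential d s (φ.symm y) ≠ 0 := fun y hy => hy.2
  have e : (fun z => Ω z * t z) ∘ φ.symm =ᶠ[𝓝 (φ x)] fun y => Ω (φ.symm y) * unitVal φ G s y := by
    filter_upwards [ht.2 φ hφ hxφ] with y hy
    rw [← hy]; rfl
  rw [(iterPd_eventuallyEq (ht'.2 φ hφ hxφ) α).eq_of_nhds, (iterPd_eventuallyEq e α).eq_of_nhds]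
  obtain ⟨h1, -, h3⟩ := chartUnit_spec hφ G hU hd1 hs hds
  obtain ⟨W, hW, hc⟩ := chartMetric_rescaling hφ hU h
  -- The competitor for `G'` is `Ω` times the solution for `G`; conformal invariance of `I²` gives
  -- it the same error.
  have h4 : (chartMetric hφ G' hU).tsq (chartFn hφ hU h.1 * chartUnit hφ G hU hs.1 hds) =
      (chartMetric hφ G hU).tsq (chartUnit hφ G hU hs.1 hds) := by
    rw [hc]
    exact (isMetric_chartMetric hφ G hU).tsq_conf hW hd _
  have hD : (chartMetric hφ G' hU).D = (chartMetric hφ G hU).D := rfl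
  have h6 := (isHypersurface_chart hφ G hU hs hds).ord_subset hD (chartFn hφ hU hs.1)
    (chartNorm hφ G' hU hs.1 hds) h3
  have hΩ : (chartFn hφ hU h.1).Rep (Ω ∘ φ.symm) := fun _ => rfl
  refine (iterPd_eq_unitVal hφ G' hU hd1 hs hds
    ((vanIdeal _ _).mul_mem_left (chartFn hφ hU h.1) h1) ?_ (fun y hy => ?_)
    (hΩ.mul (rep_chartUnit hφ G hU hs.1 hds)) (mem_regular hφ hs.1 hxφ (hs.2.2 x hx))
    (by rwa [φ.left_inv hxφ]) α hα).symm
  · rw [h4]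
    exact h6
  -- The other Leibniz term contains the solution itself, which is zero on the hypersurface.
  · refine ⟨Ω (φ.symm y) * (chartNorm hφ G hU hs.1 hds).1 y,
      mul_pos (h.2.1 _) (chartNorm_pos hφ G hU hs.1 hds y), fun a => ?_⟩
    have h5 := der_chartUnit hφ G hU hd1 hs hds y hy a
    rw [Derivation.leibniz]
    change Ω (φ.symm y) * (der a (chartUnit hφ G hU hs.1 hds)).1 y +
      (chartUnit hφ G hU hs.1 hds).1 y * (der a (chartFn hφ hU h.1)).1 y = _
    rw [h5, h1 y hy]
    ring

end Jets

/-! ### Naturality of universal polynomials -/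

section Naturality

set_option linter.unusedSectionVars false

open TopologicalSpace Filter Topology

variable {d : ℕ} {M : Type u} [TopologicalSpace M] [ChartedSpace (Coord d) M]
  [IsManifold (𝓡 d) ∞ M]

/-- The pullback of a chart along a diffeomorphism. -/
def pullbackChart (F : M ≃ₘ^∞⟮𝓡 d, 𝓡 d⟯ M) (φ : OpenPartialHomeomorph M (Coord d)) :
    OpenPartialHomeomorph M (Coord d) :=
  F.toHomeomorph.transOpenPartialHomeomorph φ

variable {F : M ≃ₘ^∞⟮𝓡 d, 𝓡 d⟯ M} {φ : OpenPartialHomeomorph M (Coord d)}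

theorem pullbackChart_mem (F : M ≃ₘ^∞⟮𝓡 d, 𝓡 d⟯ M) (hφ : φ ∈ smoothAtlas d M) :
    pullbackChart F φ ∈ smoothAtlas d M := by
  refine OpenPartialHomeomorph.mem_maximalAtlas_of_contMDiffOn _ ?_ ?_
  · exact (contMDiffOn_of_mem_maximalAtlas hφ).comp F.contMDiff.contMDiffOn fun x hx => hx
  · exact F.symm.contMDiff.comp_contMDiffOn (contMDiffOn_symm_of_mem_maximalAtlas hφ)

theorem comp_pullbackChart_symm (s : M → ℝ) : (s ∘ F) ∘ (pullbackChart F φ).symm = s ∘ φ.symm :=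
  funext fun y => congrArg s (F.apply_symm_apply (φ.symm y))

theorem mfderiv_coordVec_pullbackChart (hφ : φ ∈ smoothAtlas d M) {y : Coord d}
    (hy : y ∈ φ.target) (a : Fin d) :
    (mfderiv (𝓡 d) (𝓡 d) F ((pullbackChart F φ).symm y) (coordVec (pullbackChart F φ) y a) :
      Coord d) = (coordVec φ y a : Coord d) := by
  have h1 : F ∘ (pullbackChart F φ).symm = φ.symm :=
    funext fun y => F.apply_symm_apply (φ.symm y)
  have h2 : mfderiv 𝓘(ℝ, Coord d) (𝓡 d) (F ∘ (pullbackChart F φ).symm) y =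
      (mfderiv (𝓡 d) (𝓡 d) F ((pullbackChart F φ).symm y)).comp
        (mfderiv 𝓘(ℝ, Coord d) (𝓡 d) (pullbackChart F φ).symm y) :=
    mfderiv_comp y (F.contMDiff.mdifferentiableAt (by simp))
      (mdifferentiableAt_chart_symm (pullbackChart_mem F hφ) hy)
  have h3 : (mfderiv 𝓘(ℝ, Coord d) (𝓡 d) (F ∘ (pullbackChart F φ).symm) y :
      Coord d →L[ℝ] Coord d) = (mfderiv 𝓘(ℝ, Coord d) (𝓡 d) φ.symm y : Coord d →L[ℝ] Coord d) := by
    rw [h1]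
  exact congrArg (fun L : Coord d →L[ℝ] Coord d => L (stdVec a)) (h2.symm.trans h3)

theorem vol_congr (G : OrientedMetric d M) {x x' : M} (h : x = x') (v : Fin d → Coord d) :
    G.vol x v = G.vol x' v := by
  subst h; rfl

theorem gram_pullbackChart (hφ : φ ∈ smoothAtlas d M) {G G' : OrientedMetric d M}
    (hF : IsPullback F G G') {y : Coord d} (hy : y ∈ φ.target) :
    gram (pullbackChart F φ) G y = gram φ G' y := by
  refine Matrix.ext fun a b => (hF.1 _ _ _).trans ?_
  refine (metric_congr G' (F.apply_symm_apply (φ.symm y)) _ _).trans ?_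
  rw [mfderiv_coordVec_pullbackChart hφ hy, mfderiv_coordVec_pullbackChart hφ hy]
  rfl

/-- Between the pulled-back chart and the original one, `F` is the identity in coordinates. -/
theorem value_pullbackChart (hφ : φ ∈ smoothAtlas d M) {G G' : OrientedMetric d M}
    (hF : IsPullback F G G') (s : M → ℝ) {y : Coord d} (hy : y ∈ φ.target) :
    JetVar.value (pullbackChart F φ) G (s ∘ F) y = JetVar.value φ G' s y := by
  funext i
  cases i with
  | metric α b c =>
    refine (iterPd_eventuallyEq ?_ α).eq_of_nhds
    filter_upwards [φ.open_target.mem_nhds hy] with z hz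
    rw [gram_pullbackChart hφ hF hz]
  | detInv => simp only [JetVar.value, gram_pullbackChart hφ hF hy]
  | fn α => simp only [JetVar.value, comp_pullbackChart_symm]
  | normInv =>
    simp only [JetVar.value, gradSq, gramInv, gram_pullbackChart hφ hF hy, comp_pullbackChart_symm]
  | vol a =>
    refine (hF.2 _ _).trans ?_
    refine (vol_congr G' (F.apply_symm_apply (φ.symm y)) _).trans ?_
    have h : (fun i => (mfderiv (𝓡 d) (𝓡 d) F ((pullbackChart F φ).symm y)
        (coordVec (pullbackChart F φ) y (a i)) : Coord d)) =
        fun i => (coordVec φ y (a i) : Coord d) :=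
      funext fun i => mfderiv_coordVec_pullbackChart hφ hy (a i)
    exact congrArg (fun v : Fin d → Coord d => G'.vol (φ.symm y) v) h

theorem differential_comp_eq_zero_iff (F : M ≃ₘ^∞⟮𝓡 d, 𝓡 d⟯ M) {s : M → ℝ} (hs : SmoothFn d s)
    (x : M) : differential d (s ∘ F) x = 0 ↔ differential d s (F x) = 0 := by
  set φ := chartAt (Coord d) (F x)
  have hφ : φ ∈ smoothAtlas d M := IsManifold.chart_mem_maximalAtlas (F x)
  have hx : F x ∈ φ.source := mem_chart_source _ (F x)
  have h1 := differential_eq_zero_iff (pullbackChart_mem F hφ) (hs.comp F.contMDiff)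
    (y := φ (F x)) (φ.map_source hx)
  have h2 := differential_eq_zero_iff hφ hs (y := φ (F x)) (φ.map_source hx)
  rw [comp_pullbackChart_symm] at h1
  have e1 : (pullbackChart F φ).symm (φ (F x)) = x := by
    change F.symm (φ.symm (φ (F x))) = x
    rw [φ.left_inv hx, F.symm_apply_apply]
  rw [← not_iff_not]
  exact (differential_ne_zero_congr e1).symm.trans
    ((not_congr (h1.trans h2.symm)).trans (differential_ne_zero_congr (φ.left_inv hx)))

end Naturality

/-! ### The hypersurface invariant -/

section Invariant

variable {d : ℕ}

open Classical in
/-- The invariant `s ↦ p(t)` where `t` is the universal unit defining density made from `s`. -/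
def unitInvariant (p : MvPolynomial (JetVar d) ℝ) : InvariantFamily.{u} d :=
  -- Naturality is demanded at every point, not only on the hypersurface; the constant `0` is a
  -- natural value where `ds` vanishes.
  fun _ _ _ _ G s x => if differential d s x = 0 then 0 else
    MvPolynomial.eval (JetVar.value (chartAt (Coord d) x) G s (chartAt (Coord d) x x))
      (MvPolynomial.aeval substUnit p)

variable {P : InvariantFamily.{u} d} {p : MvPolynomial (JetVar d) ℝ}

/-- `P` is given by the polynomial `p` in every chart. -/
def IsGivenBy (P : InvariantFamily.{u} d) (p : MvPolynomial (JetVar d) ℝ) : Prop :=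
  ∀ (M : Type u) [TopologicalSpace M] [ChartedSpace (Coord d) M]
    [IsManifold (𝓡 d) ∞ M] [T2Space M] [SecondCountableTopology M] [ConnectedSpace M]
    (G : OrientedMetric d M) (s : M → ℝ), SmoothFn d s →
    ∀ φ ∈ smoothAtlas d M, ∀ x ∈ φ.source,
      P M G s x = MvPolynomial.eval (JetVar.value φ G s (φ x)) p

variable {M : Type u} [TopologicalSpace M] [ChartedSpace (Coord d) M]
  [IsManifold (𝓡 d) ∞ M] [T2Space M] [SecondCountableTopology M] [ConnectedSpace M]

/-- The right side does not mention the chart, so the left side is independent of it. -/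
theorem eval_substUnit_eq (hp : JetVar.normInv ∉ p.vars) (hP : IsGivenBy P p)
    {G : OrientedMetric d M} {s t : M → ℝ} (hs : SmoothFn d s) {x : M}
    (hds : differential d s x ≠ 0) (ht : IsUnitExtension G s x t)
    {φ : OpenPartialHomeomorph M (Coord d)} (hφ : φ ∈ smoothAtlas d M) (hx : x ∈ φ.source) :
    MvPolynomial.eval (JetVar.value φ G s (φ x)) (MvPolynomial.aeval substUnit p) = P M G t x := by
  rw [eval_substUnit hφ G hs (φ.map_source hx)
    ((differential_ne_zero_congr (φ.left_inv hx)).2 hds) (ht.2 φ hφ hx) hp,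
    hP M G t ht.1 φ hφ x hx]

/-- This transfers the properties of `P` to the new invariant: covariance and dependence on the
`d`-jet can be applied to the global function `t`. -/
theorem unitInvariant_eq (hp : JetVar.normInv ∉ p.vars) (hP : IsGivenBy P p)
    {G : OrientedMetric d M} {s t : M → ℝ} (hs : SmoothFn d s) {x : M}
    (hds : differential d s x ≠ 0) (ht : IsUnitExtension G s x t) :
    unitInvariant p M G s x = P M G t x := by
  rw [unitInvariant, if_neg hds]
  exact eval_substUnit_eq hp hP hs hds ht (IsManifold.chart_mem_maximalAtlas x)
    (mem_chart_source _ x)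

theorem unitInvariant_eq_eval (hp : JetVar.normInv ∉ p.vars) (hP : IsGivenBy P p)
    (G : OrientedMetric d M) {s : M → ℝ} (hs : SmoothFn d s)
    {φ : OpenPartialHomeomorph M (Coord d)} (hφ : φ ∈ smoothAtlas d M) {x : M} (hx : x ∈ φ.source)
    (hds : differential d s x ≠ 0) : unitInvariant p M G s x =
      MvPolynomial.eval (JetVar.value φ G s (φ x)) (MvPolynomial.aeval substUnit p) := by
  obtain ⟨t, ht⟩ := exists_isUnitExtension G hs hds
  rw [unitInvariant_eq hp hP hs hds ht, eval_substUnit_eq hp hP hs hds ht hφ hx]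

theorem unitInvariant_natural (hp : JetVar.normInv ∉ p.vars) (hP : IsGivenBy P p)
    (F : M ≃ₘ^∞⟮𝓡 d, 𝓡 d⟯ M) {G G' : OrientedMetric d M} (hF : IsPullback F G G') {s : M → ℝ}
    (hs : SmoothFn d s) (x : M) :
    unitInvariant p M G (s ∘ F) x = unitInvariant p M G' s (F x) := by
  by_cases h : differential d s (F x) = 0
  · have h' := (differential_comp_eq_zero_iff F hs x).2 h
    rw [unitInvariant, unitInvariant, if_pos h, if_pos h']
  · have h' := mt (differential_comp_eq_zero_iff F hs x).1 h
    set φ := chartAt (Coord d) (F x)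
    have hφ : φ ∈ smoothAtlas d M := IsManifold.chart_mem_maximalAtlas (F x)
    have hx : F x ∈ φ.source := mem_chart_source _ (F x)
    rw [unitInvariant_eq_eval hp hP G' hs hφ hx h, unitInvariant_eq_eval hp hP G
      (hs.comp F.contMDiff) (pullbackChart_mem F hφ) (x := x) hx h',
      ← value_pullbackChart hφ hF s (φ.map_source hx)]
    rfl

end Invariant

end

end ConformalHypersurface

/-! ### Proof of the theorem -/

theorem mainTheorem10 (d : ℕ) (hd : 3 ≤ d) (w : ℝ) (P : InvariantFamily.{u} d)
    (hP : IsCoupledConformalInvariant 1 w P) (hjet : DependsOnJet d P) :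
    ∃ Q : InvariantFamily.{u} d, IsHypersurfaceConformalInvariant w Q ∧
      ∀ (M : Type u) [TopologicalSpace M] [ChartedSpace (Coord d) M] [IsManifold (𝓡 d) ∞ M]
        [T2Space M] [SecondCountableTopology M] [ConnectedSpace M]
        (c : ConformalStructure d M) (S : Set M) (σ : Density c 1), IsConformalUnitDensity σ S →
        ∀ (G : c.metrics) (s : M → ℝ), IsDefiningFunction d s S →
          CompatiblyOriented d (σ.val G) s S →
          ∀ x ∈ S, P M G.1 (σ.val G) x = Q M G.1 s x := by
  have hd1 : 1 ≤ d := by omega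
  have hd2 : 2 ≤ d := by omega
  obtain ⟨p, hp, hPp⟩ := hP.polynomial
  refine ⟨unitInvariant p, ⟨⟨?_, ?_, ?_⟩, ?_⟩, ?_⟩
  · intro M _ _ _ _ _ _ F G G' hF s S hs x
    exact unitInvariant_natural hp hPp F hF hs.1 x
  · intro M _ _ _ _ _ _ G s s' S hs hs' hor x hx
    obtain ⟨t, ht⟩ := exists_isUnitExtension G hs.1 (hs.2.2 x hx)
    obtain ⟨t', ht'⟩ := exists_isUnitExtension G hs'.1 (hs'.2.2 x hx)
    obtain ⟨h0, h1⟩ := ht.eq_zero_and_differential_ne_zero hd1 hs hx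
    rw [unitInvariant_eq hp hPp hs.1 (hs.2.2 x hx) ht,
      unitInvariant_eq hp hPp hs'.1 (hs'.2.2 x hx) ht']
    exact hjet M G t t' ht.1 ht'.1 x h0 h1
      (sameJet_of_compatiblyOriented hd1 hs hs' hor hx ht ht')
  · exact ⟨MvPolynomial.aeval substUnit p, fun M _ _ _ _ _ _ G s S hs φ hφ x hx hds =>
      unitInvariant_eq_eval hp hPp G hs.1 hφ hx hds⟩
  · intro M _ _ _ _ _ _ G G' Ω hΩ s S hs x hx
    obtain ⟨t, ht⟩ := exists_isUnitExtension G hs.1 (hs.2.2 x hx)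
    obtain ⟨t', ht'⟩ := exists_isUnitExtension G' hs.1 (hs.2.2 x hx)
    obtain ⟨h0, h1⟩ := ht'.eq_zero_and_differential_ne_zero hd1 hs hx
    rw [unitInvariant_eq hp hPp hs.1 (hs.2.2 x hx) ht,
      -- Covariance of `P` turns the weighted value for `t` in the metric `G` into its value for `Ω
      -- t` in `G'`. It remains to compare the `d`-jets of `Ω t` and `t'`.
      unitInvariant_eq hp hPp hs.1 (hs.2.2 x hx) ht', ← hP.covariant M G G' Ω hΩ t ht.1 x]
    simp only [Real.rpow_one]
    exact hjet M G' t' _ ht'.1 (hΩ.1.mul ht.1) x h0 h1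
      (sameJet_of_isRescaling hd2 hΩ hs hx ht ht')
  · intro M _ _ _ _ _ _ c S σ hσ G s hs hor x hx
    obtain ⟨t, ht⟩ := exists_isUnitExtension G.1 hs.1 (hs.2.2 x hx)
    obtain ⟨h0, h1⟩ := ht.eq_zero_and_differential_ne_zero hd1 hs hx
    rw [unitInvariant_eq hp hPp hs.1 (hs.2.2 x hx) ht]
    exact (hjet M G.1 t (σ.val G) ht.1 (hσ G).1.1 x h0 h1
      (sameJet_of_isConformalUnit hd1 (hσ G) hs hor hx ht)).symm
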